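/- Let $A=(A_{ij})_{i,j\in I}$ be a symmetrizable generalized Cartan matrix with $I$ finite and totally ordered, and let $P$ be a weight lattice for $A$: a free abelian group of finite rank with linearly independent simple roots $\alpha_i\in P$, linearly independent simple coroots $\alpha_i^\vee\in\mathrm{Hom}(P,\mathbb Z)$ and fundamental weights $\Lambda_i\in P$, where $\langle\alpha_i,\alpha_j^\vee\rangle=A_{ij}$ and $\langle\Lambda_i,\alpha_j^\vee\rangle=\delta_{ij}$. Let $W$ be the Weyl group, $\Phi^+$ the set of positive real roots, and $\rho=\sum_i\Lambda_i$. For $\beta\in\Phi^+$ and $h\in\mathbb Z$ let $s_{\beta,h}(x)=x-(\langle x,\beta^\vee\rangle-h)\beta$ and $s_\beta=s_{\beta,0}$. *Abstract crystals.* An abstract crystal is a nonempty set $B$ with maps $e_i,f_i\colon B\to B\sqcup\{0\}$, $\varepsilon_i,\varphi_i\colon B\to\mathbb Z\sqcup\{-\infty\}$, $\mathrm{wt}\colon B\to P$ such that $\varphi_i(b)=\varepsilon_i(b)+\langle\mathrm{wt}(b),\alpha_i^\vee\rangle$; if $e_ib\neq0$ then $\varepsilon_i,\varphi_i,\mathrm{wt}$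 change by $-1,+1,+\alpha_i$; if $f_ib\ne0$ then they change by $+1,-1,-\alpha_i$; $f_ib=b'\iff b=e_ib'$; and $e_ib=f_ib=0$ if $\varphi_i(b)=-\infty$. A morphism $B_1\to B_2$ is a map $\psi\colon B_1\sqcup\{0\}\to B_2\sqcup\{0\}$ with $\psi(0)=0$ that preserves $\mathrm{wt},\varepsilon_i,\varphi_i$ of every $b\in B_1$ with $\psi(b)\neq0$, and satisfies $\psi(e_ib)=e_i\psi(b)$ whenever both sides are nonzero, and likewise for $f_i$. It is an embedding (isomorphism) if it is injective (bijective) on $B_1\sqcup\{0\}\to B_2\sqcup\{0\}$. $T_\lambda=\{t_\lambda\}$ is the crystal with $e_it_\lambda=f_it_\lambda=0$, $\varepsilon_i=\varphi_i=-\infty$, $\mathrm{wt}(t_\lambda)=\lambda$. On $B_2\otimes B_1=B_2\times B_1$ the operator $e_i$ acts on the factor $b_2$ if $\varepsilon_i(b_2)>\varphi_i(b_1)$ and on $b_1$ otherwise; $f_i$ acts on $b_2$ if $\varepsilon_i(b_2)\ge\varphi_i(b_1)$ and on $b_1$ otherwise; $\varepsilon_i=\max(\varepsilon_i(b_1),\varepsilon_i(b_2)-\langle\mathrm{wt}(b_1),\alpha_i^\vee\rangle)$,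 $\varphi_i=\max(\varphi_i(b_2),\varphi_i(b_1)+\langle\mathrm{wt}(b_2),\alpha_i^\vee\rangle)$, and weights add. The direct limit $\vec B$ of a directed system of crystals $B_j$ is the set of nonzero elements of the direct limit of the pointed sets $B_j\sqcup\{0\}$, with canonical maps $\psi_{(j)}\colon B_j\sqcup\{0\}\to\vec B\sqcup\{0\}$; $e_i\vec b=\psi_{(j)}(e_ib_j)$ if some representative $b_j$ of $\vec b$ has $e_ib_j\ne0$, and $e_i\vec b=0$ otherwise; likewise $f_i$; and $\mathrm{wt},\varepsilon_i,\varphi_i$ are computed on representatives. *Chains.* For dominant $\lambda\in P$ let $\Gamma_\lambda$ be the set $R_\lambda=\{(\beta,h):\beta\in\Phi^+,\,0\le h<\langle\lambda,\beta^\vee\rangle\}$, ordered by the lexicographic order of the vectors $\langle\lambda,\beta^\vee\rangle^{-1}\bigl(h,(c_i)_{i\in I}\bigr)$, where $\beta^\vee=\sum_ic_i\alpha_i^\vee$. The $\infty$-chain $\cdots*\Gamma_\rho*\Gamma_\rho$ consists of copies of $\Gamma_\rho$ numbered $\dots,-2,-1$ from left to right, the element $(\beta,h)$ of copy $q$ standing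 for $(\beta,h+q\langle\rho,\beta^\vee\rangle)$. The element at position $j$ of a chain is written $(\beta_j,\ell_j)$; put $r_j=s_{\beta_j}$ and $\hat r_j=s_{\beta_j,-\ell_j}$. *Alcove model.* A finite set $J=\{j_1<\dots<j_p\}$ of positions is admissible if $1\lessdot r_{j_1}\lessdot r_{j_1}r_{j_2}\lessdot\dots\lessdot r_{j_1}\cdots r_{j_p}=:\tau(J)$ are covers in the Bruhat order of $W$. Let $\mathrm{Al}(\lambda)$ and $\mathrm{Al}(\infty)$ be the sets of admissible sets for $\Gamma_\lambda$ and for the $\infty$-chain. Put $\mathrm{wt}(J)=-\hat r_{j_1}\cdots\hat r_{j_p}(-\lambda)$, with $\lambda=0$ for $\mathrm{Al}(\infty)$. For a position $k$ let $\gamma_k=r_{j_1}\cdots r_{j_t}(\beta_k)$, where $j_1,\dots,j_t$ are the elements of $J$ before $k$; let $I_{\alpha_i}=\{k:\gamma_k=\pm\alpha_i\}$. The reduced $i$-signature is obtained from the word of signs of $\gamma_k$, $k\in I_{\alpha_i}\setminus J$, by cancelling pairs $-+$ until none remain. If it contains a $+$ and $a$ is the position of the rightmost one, then $f_iJ$ is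 obtained from $J$ by adding $a$ and removing the least element of $J\cap I_{\alpha_i}$ to the right of $a$ (if there is one); otherwise $f_iJ=0$. If it contains a $-$ and $a$ is the position of the leftmost one, then $e_iJ$ is obtained by adding $a$ and removing the greatest element of $J\cap I_{\alpha_i}$ to the left of $a$ (if there is one); if it contains no $-$, then $e_iJ=J\setminus\{\max(J\cap I_{\alpha_i})\}$ if $\langle\tau(J)(\rho),\alpha_i^\vee\rangle<0$, and $e_iJ=0$ otherwise. On both sets $\varepsilon_i(J)=\max\{n:e_i^nJ\ne0\}$. On $\mathrm{Al}(\lambda)$, $\varphi_i(J)=\max\{n:f_i^nJ\neq0\}$; on $\mathrm{Al}(\infty)$, $\varphi_i(J)=\varepsilon_i(J)+\langle\mathrm{wt}(J),\alpha_i^\vee\rangle$. *Shift maps.* For $k'\ge k\ge0$ let $\psi_{k',k}=S_{(k'-k)\rho}$ send $t_{-k\rho}\otimes J$ to $t_{-k'\rho}\otimes J'$, where $J'$ arises from $J$ by replacing every $(\beta_j,\ell_j)$, $j\in J$, by $(\beta_j,\ell_j+(k'-k)\langle\rho,\beta_j^\vee\rangle)$. Let $S^{\mathrm{in}}_{-k\rho}$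 send $t_{-k\rho}\otimes J$ to the set of positions of the $\infty$-chain obtained by replacing every $(\beta_j,\ell_j)$ by $(\beta_j,\ell_j-k\langle\rho,\beta_j^\vee\rangle)$. (The value is $0$ if the result is not admissible; also $0\mapsto0$.) **Statement.** The family $\{T_{-k\rho}\otimes\mathrm{Al}(k\rho)\}_{k\ge0}$ with the maps $\psi_{k',k}$ is a directed system of abstract crystals, and every $\psi_{k',k}$ is a crystal embedding. Its direct limit and $\mathrm{Al}(\infty)$ are abstract crystals, and there is exactly one map $$S\colon\Bigl(\varinjlim_{k}T_{-k\rho}\otimes\mathrm{Al}(k\rho)\Bigr)\sqcup\{0\}\to\mathrm{Al}(\infty)\sqcup\{0\}$$ with $S\circ\psi_{(k)}=S^{\mathrm{in}}_{-k\rho}$ for all $k\geq0$. This map $S$ is a crystal isomorphism. -/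

import Mathlib

universe u v w w'

/-! ## Cartan data, Weyl group, real roots -/

/-- A symmetrizable generalized Cartan matrix. -/
structure IsSymmetrizableGCM {I : Type u} (A : Matrix I I ℤ) : Prop where
  diag : ∀ i, A i i = 2
  nonpos : ∀ i j, i ≠ j → A i j ≤ 0
  zero_iff : ∀ i j, A i j = 0 ↔ A j i = 0
  symmetrizable : ∃ d : I → ℚ, (∀ i, 0 < d i) ∧ ∀ i j, d i * A i j = d j * A j i

/-- A realization of the matrix `A` over `ℤ` with weight lattice `P`: simple roots and fundamental
weights in `P`, simple coroots in the coweight lattice `Hom(P, ℤ)`.  The canonical pairing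
`⟨x, h⟩` of a weight `x` and a coweight `h` is `h x`. -/
structure CartanDatum {I : Type u} [DecidableEq I] (A : Matrix I I ℤ)
    (P : Type v) [AddCommGroup P] where
  gcm : IsSymmetrizableGCM A
  simpleRoot : I → P
  simpleCoroot : I → Module.Dual ℤ P
  fundWeight : I → P
  pairing : ∀ i j, simpleCoroot j (simpleRoot i) = A i j
  linearIndependent_root : LinearIndependent ℤ simpleRoot
  linearIndependent_coroot : LinearIndependent ℤ simpleCoroot
  pairing_fundWeight : ∀ i j, simpleCoroot j (fundWeight i) = if i = j then 1 else 0

namespace CartanDatum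

variable {I : Type u} [DecidableEq I] {A : Matrix I I ℤ} {P : Type v} [AddCommGroup P]

/-- The simple reflection `s_i` acting on the weight lattice. -/
noncomputable def simpleReflection (D : CartanDatum A P) (i : I) : P ≃ₗ[ℤ] P :=
  Module.reflection (x := D.simpleRoot i) (f := D.simpleCoroot i)
    ((D.pairing i i).trans (D.gcm.diag i))

/-- The Weyl group, as a group of automorphisms of the weight lattice. -/
def weylGroup (D : CartanDatum A P) : Subgroup (P ≃ₗ[ℤ] P) :=
  Subgroup.closure (Set.range D.simpleReflection)

/-- The length of a Weyl group element: the minimal length of an expression as a product of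
simple reflections. -/
noncomputable def length (D : CartanDatum A P) (g : P ≃ₗ[ℤ] P) : ℕ :=
  sInf {n | ∃ l : List I, l.length = n ∧ (l.map D.simpleReflection).prod = g}

/-- `D.IsRealRoot b bv` says that `b` is a real root with coroot `bv`, i.e. `b = g α_i` and
`bv = g α_i^∨` for some `i` and some Weyl group element `g`. -/
inductive IsRealRoot (D : CartanDatum A P) : P → Module.Dual ℤ P → Prop
  | simple (i : I) : IsRealRoot D (D.simpleRoot i) (D.simpleCoroot i)
  | reflect (m : I) {b : P} {bv : Module.Dual ℤ P} : IsRealRoot D b bv →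
      IsRealRoot D (b - D.simpleCoroot m b • D.simpleRoot m)
        (bv - bv (D.simpleRoot m) • D.simpleCoroot m)

/-- A positive (real) root, together with its coroot. -/
@[ext] structure PosRoot (D : CartanDatum A P) where
  root : P
  coroot : Module.Dual ℤ P
  isReal : D.IsRealRoot root coroot
  pos : root ∈ AddSubmonoid.closure (Set.range D.simpleRoot)

theorem IsRealRoot.pairing_self {D : CartanDatum A P} {b : P} {bv : Module.Dual ℤ P}
    (h : D.IsRealRoot b bv) : bv b = 2 := by
  induction h with
  | simple i => exact (D.pairing i i).trans (D.gcm.diag i)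
  | @reflect m b bv _ ih =>
    have h2 : D.simpleCoroot m (D.simpleRoot m) = 2 := (D.pairing m m).trans (D.gcm.diag m)
    simp only [LinearMap.sub_apply, map_sub, LinearMap.smul_apply, map_smul, smul_eq_mul, h2, ih]
    ring

/-- The reflection `s_β` for a positive root `β`. -/
noncomputable def PosRoot.reflection {D : CartanDatum A P} (b : D.PosRoot) : P ≃ₗ[ℤ] P :=
  Module.reflection b.isReal.pairing_self

/-- The affine reflection `s_{β,h}` across the hyperplane `⟨x, β^∨⟩ = h`. -/
def PosRoot.affineReflection {D : CartanDatum A P} (b : D.PosRoot) (h : ℤ) (x : P) : P :=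
  x - (b.coroot x - h) • b.root

/-- The cover relation `g ⋖ g'` of the Bruhat order on the Weyl group: `g' = g s_β` for a
positive root `β`, and the length goes up by exactly one. -/
def BruhatCover (D : CartanDatum A P) (g g' : P ≃ₗ[ℤ] P) : Prop :=
  g ∈ D.weylGroup ∧ (∃ b : D.PosRoot, g' = g * b.reflection) ∧ D.length g' = D.length g + 1

theorem IsRealRoot.exists_coeff [Fintype I] {D : CartanDatum A P} {b : P}
    {bv : Module.Dual ℤ P} (h : D.IsRealRoot b bv) {d : I → ℚ}
    (hd0 : ∀ i, 0 < d i) (hd : ∀ i j, d i * A i j = d j * A j i) :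
    ∃ c c' : I → ℤ, b = ∑ k, c k • D.simpleRoot k ∧ bv = ∑ k, c' k • D.simpleCoroot k ∧
      (∃ q : ℚ, 0 < q ∧ ∀ k, q * c k = c' k * d k) ∧
      (∃ f : I → ℤ, ∑ k, f k * c k = 1) ∧ ∃ f : I → ℤ, ∑ k, f k * c' k = 1 := by
  induction h with
  | simple i =>
    refine ⟨Pi.single i 1, Pi.single i 1, ?_, ?_, ⟨d i, hd0 i, fun k => ?_⟩,
      ⟨Pi.single i 1, ?_⟩, ⟨Pi.single i 1, ?_⟩⟩
    · simp [Pi.single_apply]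
    · simp [Pi.single_apply]
    · by_cases hk : k = i
      · subst hk; simp
      · simp [hk]
    · simp [Pi.single_apply]
    · simp [Pi.single_apply]
  | @reflect m b bv _ ih =>
    obtain ⟨c, c', hb, hbv, ⟨q, hq, hqc⟩, ⟨f, hf⟩, ⟨f', hf'⟩⟩ := ih
    have e1 : D.simpleCoroot m b = ∑ k, c k * A k m := by
      simp [hb, D.pairing]
    have e2 : bv (D.simpleRoot m) = ∑ k, c' k * A m k := by
      simp [hbv, D.pairing, LinearMap.sum_apply]
    have hdiag := D.gcm.diag m
    have key : ∀ (F C G : I → ℤ), ∑ k, F k * C k = 1 → G m = 2 →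
        ∑ k, (F k - G k * F m) * (C k - Pi.single (M := fun _ => ℤ) m (∑ k, C k * G k) k) = 1 := by
      intro F C G h1 h2
      have : ∀ k, (F k - G k * F m) * (C k - Pi.single (M := fun _ => ℤ) m (∑ k, C k * G k) k)
          = F k * C k - F m * (C k * G k)
            - Pi.single (M := fun _ => ℤ) m ((F m - G m * F m) * ∑ k, C k * G k) k := by
        intro k
        by_cases hk : k = m
        · subst hk; simp; ring
        · simp [hk]; ring
      simp only [this, Finset.sum_sub_distrib, ← Finset.mul_sum, h1]
      simp [h2]; ring
    refine ⟨fun k => c k - Pi.single (M := fun _ => ℤ) m (∑ k, c k * A k m) k,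
      fun k => c' k - Pi.single (M := fun _ => ℤ) m (∑ k, c' k * A m k) k, ?_, ?_, ⟨q, hq, ?_⟩,
      ⟨_, key f c (fun k => A k m) hf hdiag⟩, ⟨_, key f' c' (fun k => A m k) hf' hdiag⟩⟩
    · rw [e1]; simp [sub_smul, Finset.sum_sub_distrib, ← hb, Pi.single_apply]
    · rw [e2]; simp [sub_smul, Finset.sum_sub_distrib, ← hbv, Pi.single_apply]
    · intro k
      by_cases hk : k = m
      · subst hk
        simp only [Pi.single_eq_same]
        push_cast
        have : q * ∑ j, (c j : ℚ) * A j k = (∑ j, (c' j : ℚ) * A k j) * d k := by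
          rw [Finset.mul_sum, Finset.sum_mul]
          refine Finset.sum_congr rfl fun j _ => ?_
          calc q * ((c j : ℚ) * A j k) = (q * c j) * A j k := by ring
            _ = c' j * (d j * A j k) := by rw [hqc j]; ring
            _ = (c' j : ℚ) * A k j * d k := by rw [hd j k]; ring
        rw [mul_sub, sub_mul, this, hqc k]
      · simpa [hk] using hqc k

/-- The coefficients `c_i` of a coroot `β^∨ = ∑ c_i α_i^∨`. -/
theorem PosRoot.exists_corootCoeff [Fintype I] {D : CartanDatum A P} (b : D.PosRoot) :
    ∃ c : I → ℤ, b.coroot = ∑ k, c k • D.simpleCoroot k := by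
  obtain ⟨d, hd0, hd⟩ := D.gcm.symmetrizable
  obtain ⟨_, c', _, h, _⟩ := b.isReal.exists_coeff hd0 hd
  exact ⟨c', h⟩

noncomputable def PosRoot.corootCoeff [Fintype I] {D : CartanDatum A P} (b : D.PosRoot) :
    I → ℤ :=
  b.exists_corootCoeff.choose

theorem PosRoot.coroot_eq [Fintype I] {D : CartanDatum A P} (b : D.PosRoot) :
    b.coroot = ∑ k, b.corootCoeff k • D.simpleCoroot k :=
  b.exists_corootCoeff.choose_spec

theorem PosRoot.corootCoeff_unique [Fintype I] {D : CartanDatum A P} (b : D.PosRoot)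
    {c : I → ℤ} (h : b.coroot = ∑ k, c k • D.simpleCoroot k) : b.corootCoeff = c := by
  funext k
  have h1 : ∑ k, (b.corootCoeff k - c k) • D.simpleCoroot k = 0 := by
    simp only [sub_smul, Finset.sum_sub_distrib]
    rw [← b.coroot_eq, ← h, sub_self]
  have := Fintype.linearIndependent_iff.1 D.linearIndependent_coroot _ h1 k
  linarith

/-- Proportional vectors of integers that are both primitive are equal. -/
theorem eq_of_proportional {K : Type u} [Fintype K] {c c' f f' : K → ℤ} (hf : ∑ k, f k * c k = 1)
    (hf' : ∑ k, f' k * c' k = 1) {r s : ℚ} (hr : 0 < r) (hs : 0 < s)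
    (h : ∀ k, r * c k = s * c' k) : c = c' := by
  have a1 : r = s * (∑ k, f k * c' k : ℤ) := by
    have : r * (∑ k, f k * c k : ℤ) = s * (∑ k, f k * c' k : ℤ) := by
      push_cast
      rw [Finset.mul_sum, Finset.mul_sum]
      refine Finset.sum_congr rfl fun k _ => ?_
      linear_combination (f k : ℚ) * h k
    rwa [hf, Int.cast_one, mul_one] at this
  have a2 : s = r * (∑ k, f' k * c k : ℤ) := by
    have : s * (∑ k, f' k * c' k : ℤ) = r * (∑ k, f' k * c k : ℤ) := by
      push_cast
      rw [Finset.mul_sum, Finset.mul_sum]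
      refine Finset.sum_congr rfl fun k _ => ?_
      linear_combination -(f' k : ℚ) * h k
    rwa [hf', Int.cast_one, mul_one] at this
  set x : ℤ := ∑ k, f k * c' k
  set y : ℤ := ∑ k, f' k * c k
  have hx : 0 < x := by
    have : (0 : ℚ) < x := by
      by_contra hn
      nlinarith
    exact_mod_cast this
  have hy : 0 < y := by
    have : (0 : ℚ) < y := by
      by_contra hn
      nlinarith
    exact_mod_cast this
  have hrs : r = s := by
    have hx1 : (1 : ℚ) ≤ x := by exact_mod_cast hx
    have hy1 : (1 : ℚ) ≤ y := by exact_mod_cast hy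
    apply le_antisymm <;> nlinarith
  funext k
  have := h k
  rw [hrs] at this
  exact_mod_cast mul_left_cancel₀ hs.ne' this

theorem PosRoot.eq_of_proportional [Fintype I] {D : CartanDatum A P} {b b' : D.PosRoot}
    {r s : ℚ} (hr : 0 < r) (hs : 0 < s)
    (h : ∀ k, r * b.corootCoeff k = s * b'.corootCoeff k) : b = b' := by
  obtain ⟨d, hd0, hd⟩ := D.gcm.symmetrizable
  obtain ⟨c, c', h1, h2, ⟨q, hq, hqc⟩, ⟨f, hf⟩, ⟨f', hf'⟩⟩ := b.isReal.exists_coeff hd0 hd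
  obtain ⟨e, e', k1, k2, ⟨p, hp, hpc⟩, ⟨g, hg⟩, ⟨g', hg'⟩⟩ := b'.isReal.exists_coeff hd0 hd
  rw [b.corootCoeff_unique h2, b'.corootCoeff_unique k2] at h
  have hv : c' = e' := CartanDatum.eq_of_proportional hf' hg' hr hs h
  have hroot : c = e := by
    refine CartanDatum.eq_of_proportional hf hg hq hp fun k => ?_
    rw [hqc k, hpc k, hv]
  ext1
  · rw [h1, k1, hroot]
  · rw [h2, k2, hv]

/-- The weight `ρ`, the sum of the fundamental weights. -/
def rho [Fintype I] (D : CartanDatum A P) : P := ∑ i, D.fundWeight i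

end CartanDatum

/-! ## Abstract crystals -/

/-- The data underlying an abstract crystal on the set `B`; `none : Option B` is the element `0`
of `B ⊔ {0}`, and `⊥ : WithBot ℤ` is `-∞`. -/
structure CrystalData {I : Type u} [DecidableEq I] {A : Matrix I I ℤ} {P : Type v}
    [AddCommGroup P] (D : CartanDatum A P) (B : Type w) where
  e : I → B → Option B
  f : I → B → Option B
  ep : I → B → WithBot ℤ
  ph : I → B → WithBot ℤ
  wt : B → P

namespace CrystalData

variable {I : Type u} [DecidableEq I] {A : Matrix I I ℤ} {P : Type v} [AddCommGroup P]
  {D : CartanDatum A P}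

/-- The axioms of an abstract crystal. -/
structure IsCrystal {B : Type w} (C : CrystalData D B) : Prop where
  nonempty : Nonempty B
  ph_eq : ∀ i b, C.ph i b = C.ep i b + (D.simpleCoroot i (C.wt b) : ℤ)
  ep_e : ∀ i b b', C.e i b = some b' → C.ep i b = C.ep i b' + 1
  ph_e : ∀ i b b', C.e i b = some b' → C.ph i b' = C.ph i b + 1
  wt_e : ∀ i b b', C.e i b = some b' → C.wt b' = C.wt b + D.simpleRoot i
  ep_f : ∀ i b b', C.f i b = some b' → C.ep i b' = C.ep i b + 1
  ph_f : ∀ i b b', C.f i b = some b' → C.ph i b = C.ph i b' + 1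
  wt_f : ∀ i b b', C.f i b = some b' → C.wt b' = C.wt b - D.simpleRoot i
  f_iff_e : ∀ i b b', C.f i b = some b' ↔ C.e i b' = some b
  eq_zero_of_ph : ∀ i b, C.ph i b = ⊥ → C.e i b = none ∧ C.f i b = none

/-- A crystal morphism `B₁ ⊔ {0} → B₂ ⊔ {0}`. -/
structure IsMorphism {B₁ : Type w} {B₂ : Type w'} (C₁ : CrystalData D B₁) (C₂ : CrystalData D B₂)
    (F : Option B₁ → Option B₂) : Prop where
  map_zero : F none = none
  wt_eq : ∀ b b', F (some b) = some b' → C₂.wt b' = C₁.wt b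
  ep_eq : ∀ i b b', F (some b) = some b' → C₂.ep i b' = C₁.ep i b
  ph_eq : ∀ i b b', F (some b) = some b' → C₂.ph i b' = C₁.ph i b
  map_e : ∀ i b, F (C₁.e i b) ≠ none → (F (some b)).bind (C₂.e i) ≠ none →
    F (C₁.e i b) = (F (some b)).bind (C₂.e i)
  map_f : ∀ i b, F (C₁.f i b) ≠ none → (F (some b)).bind (C₂.f i) ≠ none →
    F (C₁.f i b) = (F (some b)).bind (C₂.f i)

/-- A crystal embedding: a morphism that is injective on `B₁ ⊔ {0}`. -/
def IsEmbedding {B₁ : Type w} {B₂ : Type w'} (C₁ : CrystalData D B₁) (C₂ : CrystalData D B₂)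
    (F : Option B₁ → Option B₂) : Prop :=
  IsMorphism C₁ C₂ F ∧ Function.Injective F

/-- A crystal isomorphism: a morphism that is bijective from `B₁ ⊔ {0}` to `B₂ ⊔ {0}`. -/
def IsIsomorphism {B₁ : Type w} {B₂ : Type w'} (C₁ : CrystalData D B₁) (C₂ : CrystalData D B₂)
    (F : Option B₁ → Option B₂) : Prop :=
  IsMorphism C₁ C₂ F ∧ Function.Bijective F

/-- The one-element crystal `T_x = {t_x}`. -/
def T (D : CartanDatum A P) (x : P) : CrystalData D Unit where
  e _ _ := none
  f _ _ := none
  ep _ _ := ⊥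
  ph _ _ := ⊥
  wt _ := x

/-- The tensor product `B₂ ⊗ B₁`. -/
noncomputable def tensor {B₂ : Type w'} {B₁ : Type w} (C₂ : CrystalData D B₂) (C₁ : CrystalData D B₁) :
    CrystalData D (B₂ × B₁) where
  e i b := if C₁.ph i b.2 < C₂.ep i b.1
    then (C₂.e i b.1).map (fun x => (x, b.2)) else (C₁.e i b.2).map (fun y => (b.1, y))
  f i b := if C₁.ph i b.2 ≤ C₂.ep i b.1
    then (C₂.f i b.1).map (fun x => (x, b.2)) else (C₁.f i b.2).map (fun y => (b.1, y))
  ep i b := max (C₁.ep i b.2) (C₂.ep i b.1 + ((-D.simpleCoroot i (C₁.wt b.2) : ℤ) : WithBot ℤ))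
  ph i b := max (C₂.ph i b.1) (C₁.ph i b.2 + ((D.simpleCoroot i (C₂.wt b.1) : ℤ) : WithBot ℤ))
  wt b := C₂.wt b.1 + C₁.wt b.2

/-- `max {n | g^n b ≠ 0}` for an operator `g : B → B ⊔ {0}`. -/
noncomputable def stringLength {B : Type w} (g : B → Option B) (b : B) : ℕ :=
  sSup {n | (fun o : Option B => o.bind g)^[n] (some b) ≠ none}

/-! ### Direct limits -/

section Limit

variable {J : Type} [Preorder J] {B : J → Type w}

/-- A directed system of abstract crystals: `Ψ h : B_j ⊔ {0} → B_k ⊔ {0}` for `h : j ≤ k`. -/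
structure IsDirectedSystem (C : ∀ j, CrystalData D (B j))
    (Ψ : ∀ ⦃j k : J⦄, j ≤ k → Option (B j) → Option (B k)) : Prop where
  isCrystal : ∀ j, (C j).IsCrystal
  isMorphism : ∀ ⦃j k : J⦄ (h : j ≤ k), IsMorphism (C j) (C k) (Ψ h)
  map_id : ∀ (j : J) x, Ψ (le_refl j) x = x
  map_comp : ∀ ⦃i j k : J⦄ (h : i ≤ j) (h' : j ≤ k) x, Ψ h' (Ψ h x) = Ψ (h.trans h') x

/-- The direct limit of the pointed sets `B_j ⊔ {0}`. -/
def PointedLimit (Ψ : ∀ ⦃j k : J⦄, j ≤ k → Option (B j) → Option (B k)) : Type w :=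
  Quot fun x y : Σ j, Option (B j) => ∃ h : x.1 ≤ y.1, Ψ h x.2 = y.2

/-- The class of an element of `B_j ⊔ {0}` in the pointed limit. -/
def PointedLimit.mk (Ψ : ∀ ⦃j k : J⦄, j ≤ k → Option (B j) → Option (B k)) (j : J)
    (x : Option (B j)) : PointedLimit Ψ :=
  Quot.mk _ ⟨j, x⟩

/-- The underlying set of the direct limit: the elements of the pointed limit other than `0`. -/
def Limit (Ψ : ∀ ⦃j k : J⦄, j ≤ k → Option (B j) → Option (B k)) : Type w :=
  {x : PointedLimit Ψ // ∀ j : J, x ≠ PointedLimit.mk Ψ j none}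

open Classical in
/-- The canonical map `B_j ⊔ {0} → (lim B) ⊔ {0}`. -/
noncomputable def toLimit (Ψ : ∀ ⦃j k : J⦄, j ≤ k → Option (B j) → Option (B k)) (j : J)
    (x : Option (B j)) : Option (Limit Ψ) :=
  if h : ∀ k : J, PointedLimit.mk Ψ j x ≠ PointedLimit.mk Ψ k none
    then some ⟨PointedLimit.mk Ψ j x, h⟩ else none

theorem exists_rep (Ψ : ∀ ⦃j k : J⦄, j ≤ k → Option (B j) → Option (B k)) (x : Limit Ψ) :
    ∃ p : Σ j, B j, toLimit Ψ p.1 (some p.2) = some x := by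
  obtain ⟨x, hx⟩ := x
  induction x using Quot.ind with
  | mk a =>
    obtain ⟨j, o⟩ := a
    cases o with
    | none => exact absurd rfl (hx j)
    | some b => exact ⟨⟨j, b⟩, dif_pos hx⟩

open Classical in
/-- The crystal structure on the direct limit.  The value of `e_i` on a class is the class of
`e_i b` for a representative `b` with `e_i b ≠ 0`, and `0` if there is none; likewise for `f_i`;
the other functions are computed on a representative. -/
noncomputable def limit (C : ∀ j, CrystalData D (B j))
    (Ψ : ∀ ⦃j k : J⦄, j ≤ k → Option (B j) → Option (B k)) : CrystalData D (Limit Ψ) where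
  e i x := if h : ∃ p : Σ j, B j, toLimit Ψ p.1 (some p.2) = some x ∧ (C p.1).e i p.2 ≠ none
    then toLimit Ψ h.choose.1 ((C h.choose.1).e i h.choose.2) else none
  f i x := if h : ∃ p : Σ j, B j, toLimit Ψ p.1 (some p.2) = some x ∧ (C p.1).f i p.2 ≠ none
    then toLimit Ψ h.choose.1 ((C h.choose.1).f i h.choose.2) else none
  ep i x := (C (exists_rep Ψ x).choose.1).ep i (exists_rep Ψ x).choose.2
  ph i x := (C (exists_rep Ψ x).choose.1).ph i (exists_rep Ψ x).choose.2
  wt x := (C (exists_rep Ψ x).choose.1).wt (exists_rep Ψ x).choose.2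

end Limit

end CrystalData

/-! ## Chains of roots and the alcove model -/

/-- A sequence of positive roots `β_k`, indexed by a totally ordered set, with levels `ℓ_k`. -/
structure RootChain {I : Type u} [DecidableEq I] {A : Matrix I I ℤ} {P : Type v}
    [AddCommGroup P] (D : CartanDatum A P) where
  Idx : Type v
  order : LinearOrder Idx
  root : Idx → D.PosRoot
  level : Idx → ℤ

attribute [instance] RootChain.order

namespace RootChain

section Lex

variable {I : Type u} [Fintype I] [LinearOrder I] {A : Matrix I I ℤ} {P : Type v}
  [AddCommGroup P] {D : CartanDatum A P}

/-- The set `R_x = {(β, h) | 0 ≤ h < ⟨x, β^∨⟩}`. -/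
def LexIdx (D : CartanDatum A P) (x : P) : Type v :=
  {p : D.PosRoot × ℤ // 0 ≤ p.2 ∧ p.2 < p.1.coroot x}

/-- The vector `(h, c_1, …, c_n) / ⟨x, β^∨⟩`, where `β^∨ = ∑ c_i α_i^∨`, in `ℚ^{n+1}` with the
lexicographic order. -/
noncomputable def lexVector (x : P) (p : LexIdx D x) : ℚ ×ₗ Lex (I → ℚ) :=
  toLex ((p.1.2 : ℚ) / (p.1.1.coroot x : ℚ),
    toLex fun i => (p.1.1.corootCoeff i : ℚ) / (p.1.1.coroot x : ℚ))

theorem lexVector_injective (x : P) :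
    Function.Injective (lexVector x : LexIdx D x → ℚ ×ₗ Lex (I → ℚ)) := by
  rintro ⟨⟨b, h⟩, h0, hlt⟩ ⟨⟨b', h'⟩, h0', hlt'⟩ heq
  simp only at h0 hlt h0' hlt'
  have hp : (0 : ℚ) < b.coroot x := by exact_mod_cast h0.trans_lt hlt
  have hp' : (0 : ℚ) < b'.coroot x := by exact_mod_cast h0'.trans_lt hlt'
  have heq' := Prod.ext_iff.1 (toLex_inj.1 heq)
  have h2 := fun i => congrFun (toLex_inj.1 heq'.2) i
  have h1 := heq'.1
  simp only at h1 h2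
  have hb : b = b' := by
    refine CartanDatum.PosRoot.eq_of_proportional hp' hp fun k => ?_
    have := h2 k
    rw [div_eq_div_iff hp.ne' hp'.ne'] at this
    linarith
  subst hb
  have hh : (h : ℚ) = h' := by
    rw [div_eq_div_iff hp.ne' hp.ne'] at h1
    exact mul_right_cancel₀ hp.ne' h1
  have hh' : h = h' := by exact_mod_cast hh
  subst hh'
  rfl

/-- The lex `x`-chain `Γ_x`. -/
noncomputable def lex (D : CartanDatum A P) (x : P) : RootChain D where
  Idx := LexIdx D x
  order := LinearOrder.lift' (lexVector x) (lexVector_injective x)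
  root p := p.1.1
  level p := p.1.2

end Lex

section Alcove

variable {I : Type u} [DecidableEq I] {A : Matrix I I ℤ} {P : Type v} [AddCommGroup P]
  {D : CartanDatum A P}

/-- The infinite chain `… ∗ Γ ∗ Γ` of an `x`-chain `Γ`.  The copies of `Γ` are numbered
`…, -2, -1` from left to right, and the levels in the copy `q` are shifted by `q ⟨x, β^∨⟩`. -/
def infinite (Γ : RootChain D) (x : P) : RootChain D where
  Idx := Set.Iio (0 : ℤ) ×ₗ Γ.Idx
  order := Prod.Lex.instLinearOrder _ _
  root p := Γ.root (ofLex p).2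
  level p := Γ.level (ofLex p).2 + (ofLex p).1.1 * (Γ.root (ofLex p).2).coroot x

/-- The pair `(β_k, ℓ_k)`. -/
def position (Γ : RootChain D) (k : Γ.Idx) : D.PosRoot × ℤ := (Γ.root k, Γ.level k)

/-- `r_{j_1} ⋯ r_{j_t}`, where `j_1 < ⋯ < j_t` are the elements of `J` that are less than `k`. -/
noncomputable def prefixProd (Γ : RootChain D) (J : Finset Γ.Idx) (k : Γ.Idx) : P ≃ₗ[ℤ] P :=
  (((J.filter (· < k)).sort).map fun j => (Γ.root j).reflection).prod

/-- `τ(J) = r_{j_1} ⋯ r_{j_p}`. -/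
noncomputable def tau (Γ : RootChain D) (J : Finset Γ.Idx) : P ≃ₗ[ℤ] P :=
  (J.sort.map fun j => (Γ.root j).reflection).prod

/-- `J` is admissible: `1 ⋖ r_{j_1} ⋖ r_{j_1} r_{j_2} ⋖ ⋯ ⋖ r_{j_1} ⋯ r_{j_p}`. -/
def Admissible (Γ : RootChain D) (J : Finset Γ.Idx) : Prop :=
  ∀ j ∈ J, D.BruhatCover (Γ.prefixProd J j) (Γ.prefixProd J j * (Γ.root j).reflection)

/-- The set of admissible subsets. -/
def Al (Γ : RootChain D) : Type v := {J : Finset Γ.Idx // Γ.Admissible J}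

/-- `wt(J) = - r̂_{j_1} ⋯ r̂_{j_p} (-x)`, where `r̂_j = s_{β_j, -ℓ_j}`. -/
noncomputable def weight (Γ : RootChain D) (x : P) (J : Finset Γ.Idx) : P :=
  -(J.sort.foldr (fun j y => (Γ.root j).affineReflection (-Γ.level j) y) (-x))

/-- `γ_k = r_{j_1} ⋯ r_{j_t} (β_k)` with `t = max {a | j_a < k}`. -/
noncomputable def gam (Γ : RootChain D) (J : Finset Γ.Idx) (k : Γ.Idx) : P :=
  Γ.prefixProd J k (Γ.root k).root

/-- The set `I_{α_i}` of the indices `k` with `γ_k = ± α_i`. -/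
def rootSet (Γ : RootChain D) (J : Finset Γ.Idx) (i : I) : Set Γ.Idx :=
  {k | Γ.gam J k = D.simpleRoot i ∨ Γ.gam J k = -D.simpleRoot i}

/-- For a word of signs, with letters at the positions in `S` and `+` exactly where `plus` holds:
`Cancels S plus c a` says that the `-` at `c` and the `+` at `a > c` are cancelled against each
other when pairs `- +` are cancelled until none remain, i.e. every letter strictly
between them is cancelled against another letter strictly between them. -/
inductive Cancels {K : Type v} [LinearOrder K] (S : Set K) (plus : K → Prop) : K → K → Prop
  | intro {c a : K} (hc : c ∈ S) (ha : a ∈ S) (hca : c < a) (hminus : ¬ plus c) (hplus : plus a)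
      (partner : K → K)
      (mem_partner : ∀ d ∈ S, c < d → d < a → c < partner d ∧ partner d < a)
      (cancels_minus : ∀ d ∈ S, c < d → d < a → ¬ plus d → Cancels S plus d (partner d))
      (cancels_plus : ∀ d ∈ S, c < d → d < a → plus d → Cancels S plus (partner d) d) :
      Cancels S plus c a

/-- The positions of the `+` in the reduced `i`-signature.  The letters of the unreduced word are
at `I_{α_i} \ J`, with sign `sgn(γ_k)`. -/
def reducedPlus (Γ : RootChain D) (J : Finset Γ.Idx) (i : I) : Set Γ.Idx :=
  {a | a ∈ Γ.rootSet J i \ J ∧ Γ.gam J a = D.simpleRoot i ∧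
    ∀ c, ¬ Cancels (Γ.rootSet J i \ J) (fun k => Γ.gam J k = D.simpleRoot i) c a}

/-- The positions of the `-` in the reduced `i`-signature. -/
def reducedMinus (Γ : RootChain D) (J : Finset Γ.Idx) (i : I) : Set Γ.Idx :=
  {c | c ∈ Γ.rootSet J i \ J ∧ Γ.gam J c ≠ D.simpleRoot i ∧
    ∀ a, ¬ Cancels (Γ.rootSet J i \ J) (fun k => Γ.gam J k = D.simpleRoot i) c a}

open Classical in
/-- `J` as an element of `Al(Γ) ⊔ {0}`. -/
noncomputable def ofFinset (Γ : RootChain D) (J : Finset Γ.Idx) : Option Γ.Al :=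
  if h : Γ.Admissible J then some ⟨J, h⟩ else none

open Classical in
/-- The crystal operator `f_i`.  If `a` is the rightmost `+` of the reduced `i`-signature, it adds
`a` to `J` and removes the least element of `J ∩ I_{α_i}` to the right of `a`, if there is one.
If there is no `+`, then `f_i J = 0`. -/
noncomputable def fOp (Γ : RootChain D) (i : I) (J : Γ.Al) : Option Γ.Al :=
  if h : ∃ a, IsGreatest (Γ.reducedPlus J.1 i) a then
    let S : Finset Γ.Idx := J.1.filter fun j => j ∈ Γ.rootSet J.1 i ∧ h.choose < j
    Γ.ofFinset (insert h.choose (if hS : S.Nonempty then J.1.erase (S.min' hS) else J.1))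
  else none

end Alcove

section Crystal

variable {I : Type u} [Fintype I] [DecidableEq I] {A : Matrix I I ℤ} {P : Type v}
  [AddCommGroup P] {D : CartanDatum A P}

open Classical in
/-- The crystal operator `e_i`.  If `a` is the leftmost `-` of the reduced `i`-signature, it adds
`a` to `J` and removes the greatest element of `J ∩ I_{α_i}` to the left of `a`, if there is one.
If there is no `-`, it removes the greatest element of `J ∩ I_{α_i}` if
`⟨τ(J)(ρ), α_i^∨⟩ < 0`, and `e_i J = 0` otherwise. -/
noncomputable def eOp (Γ : RootChain D) (i : I) (J : Γ.Al) : Option Γ.Al :=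
  if h : ∃ a, IsLeast (Γ.reducedMinus J.1 i) a then
    let S : Finset Γ.Idx := J.1.filter fun j => j ∈ Γ.rootSet J.1 i ∧ j < h.choose
    Γ.ofFinset (insert h.choose (if hS : S.Nonempty then J.1.erase (S.max' hS) else J.1))
  else if D.simpleCoroot i (Γ.tau J.1 D.rho) < 0 then
    let S : Finset Γ.Idx := J.1.filter fun j => j ∈ Γ.rootSet J.1 i
    if hS : S.Nonempty then Γ.ofFinset (J.1.erase (S.max' hS)) else none
  else none

/-- The crystal `Al(Γ)` for an `x`-chain `Γ`, with `ε_i` and `φ_i` given by regularity. -/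
noncomputable def crystal (Γ : RootChain D) (x : P) : CrystalData D Γ.Al where
  e := Γ.eOp
  f := Γ.fOp
  ep i J := ((CrystalData.stringLength (Γ.eOp i) J : ℤ) : WithBot ℤ)
  ph i J := ((CrystalData.stringLength (Γ.fOp i) J : ℤ) : WithBot ℤ)
  wt J := Γ.weight x J.1

/-- The crystal structure on the admissible subsets of an infinite chain: weights are computed
with `x = 0`, `ε_i` is given by upper regularity, and `φ_i = ε_i + ⟨wt, α_i^∨⟩`. -/
noncomputable def upperCrystal (Γ : RootChain D) : CrystalData D Γ.Al where
  e := Γ.eOp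
  f := Γ.fOp
  ep i J := ((CrystalData.stringLength (Γ.eOp i) J : ℤ) : WithBot ℤ)
  ph i J := ((CrystalData.stringLength (Γ.eOp i) J +
    D.simpleCoroot i (Γ.weight 0 J.1) : ℤ) : WithBot ℤ)
  wt J := Γ.weight 0 J.1

open Classical in
/-- The `y`-shift: it replaces every folding position `(ζ, ℓ)` of `J` by `(ζ, ℓ + ⟨y, ζ^∨⟩)`; the
value is `0` if the result is not an admissible set of positions of `Γ'`. -/
noncomputable def shift (Γ Γ' : RootChain D) (y : P) (J : Γ.Al) : Option Γ'.Al :=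
  if h : ∃ J' : Γ'.Al, Γ'.position '' (J'.1 : Set Γ'.Idx) =
      (fun p : D.PosRoot × ℤ => (p.1, p.2 + p.1.coroot y)) '' (Γ.position '' (J.1 : Set Γ.Idx))
  then some h.choose else none

end Crystal

end RootChain

/-! ## The directed system and the infinite model -/

namespace AlcoveModel

variable {I : Type u} [Fintype I] [LinearOrder I] {A : Matrix I I ℤ} {P : Type v}
  [AddCommGroup P] (D : CartanDatum A P)

/-- The lex chain `Γ_{kρ}`. -/
noncomputable abbrev chain (k : ℕ) : RootChain D := RootChain.lex D ((k : ℤ) • D.rho)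

/-- The `∞`-chain of the lex `ρ`-chain. -/
noncomputable abbrev chainInf : RootChain D := (RootChain.lex D D.rho).infinite D.rho

/-- The crystal `Al(∞)`. -/
noncomputable abbrev crystalInf : CrystalData D (chainInf D).Al := (chainInf D).upperCrystal

/-- The set underlying `T_{-kρ} ⊗ Al(kρ)`. -/
abbrev TwistedAl (k : ℕ) : Type v := Unit × (chain D k).Al

/-- The crystal `T_{-kρ} ⊗ Al(kρ)`. -/
noncomputable abbrev twistedCrystal (k : ℕ) : CrystalData D (TwistedAl D k) :=
  (CrystalData.T D (-((k : ℤ) • D.rho))).tensor ((chain D k).crystal ((k : ℤ) • D.rho))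

/-- The map `S_{(k'-k)ρ} : T_{-kρ} ⊗ Al(kρ) → T_{-k'ρ} ⊗ Al(k'ρ)`, where `k ≤ k'`. -/
noncomputable def shiftMap ⦃k k' : ℕ⦄ (_ : k ≤ k') :
    Option (TwistedAl D k) → Option (TwistedAl D k') := fun o =>
  o.bind fun b => ((chain D k).shift (chain D k') (((k' : ℤ) - k) • D.rho) b.2).map
    fun J => ((), J)

/-- The shift-in map `S^in_{-kρ} : T_{-kρ} ⊗ Al(kρ) → Al(∞)`. -/
noncomputable def shiftIn (k : ℕ) : Option (TwistedAl D k) → Option (chainInf D).Al := fun o =>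
  o.bind fun b => (chain D k).shift (chainInf D) (-((k : ℤ) • D.rho)) b.2

end AlcoveModel

/-!
The crystals `T_{-kρ} ⊗ Al(kρ)` embed into each other and into `Al(∞)`, and `Al(∞)` is their union.
So the direct limit is `Al(∞)`, provided that the `f_i` do not vanish there.

*One chain.* The `i`-signature of an admissible set `J` is a word of signs. Its height at a cut is
the number of letters `+` minus the number of letters `-` to the left of the cut. The rightmost
surviving `+` is the letter before the first maximum of the height, and the leftmost surviving `-`
is the letter after the last maximum (`SignWord.isGreatest_freePlus_iff`,
`SignWord.isLeast_freeMinus_iff`). Both operators `f_i` and `e_i` move one folding position between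
two neighbours `a < m` in `I_{α_i}`, where `m` may be the right end (`RootChain.Moves`), and this
description is symmetric, so they are inverse to each other. Admissibility is preserved because
between `a` and `m` the products are multiplied by `s_i` from the left while `s_i` is a left descent
of all or none of them; the latter is the lifting property of the Bruhat order
(`CartanDatum.BruhatCover.apply_root_eq`), which rests on the fact that every real root is positive
or negative (`CartanDatum.apply_simpleRoot_mem_posCone`).

*Lex chains.* For the chain `Γ_x` of a dominant weight `x` the height is known at every cut
(`RootChain.sigHeight_eq_of_forall_lt`): it is `± N - n` or `1 ± N - n`, where `N` is the number of
levels before the cut of the positive root which the folding maps to `± α_i`. The lexicographic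
order enters only here. It is the order in which a line from `0` to a generic point near `-x`
crosses the hyperplanes, and a reflection in one of the hyperplanes preserves the crossing point
(`RootChain.cutLevel_reflect`, `RootChain.cutLevel_reflect_neg`); so the count survives each further
folding. It follows that `f_i` lowers the weight by `α_i`, that `φ_i` is the maximum of the height,
and that `φ_i - ε_i = ⟨wt, α_i^∨⟩` (`RootChain.isCrystal_lex`).

*All chains.* Shifting by a multiple of `ρ` identifies `Γ_{kρ}` with a right end of `Γ_{k'ρ}` and of
the `∞`-chain (`AlcoveModel.exists_endEmbedding`). A position to the left of such an end contributes
only letters `+`. These do not change the surviving `-`, and they add surviving `+` only to the left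
of those that were there. So the shift commutes with the `e_i`, and with `f_i` wherever `f_i` does
not vanish (`RootChain.EndEmbedding.eOp_map`, `RootChain.EndEmbedding.fOp_map`). A finite set of
positions of the `∞`-chain lies in the image of `Γ_{kρ}` for large `k`, and `φ_i` on `Al(kρ)` grows
with `k`, so `f_i` does not vanish there for large `k` (`AlcoveModel.exists_f_ne_none`). The rest
is a general statement on unions of crystals (`CrystalData.IsUnion`).
-/

/-! ### Real roots and the Weyl group -/

namespace CartanDatum

variable {I : Type u} [DecidableEq I] {A : Matrix I I ℤ} {P : Type v} [AddCommGroup P]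
  {D : CartanDatum A P}

theorem simpleReflection_apply (D : CartanDatum A P) (i : I) (x : P) :
    D.simpleReflection i x = x - D.simpleCoroot i x • D.simpleRoot i :=
  Module.reflection_apply _ _

theorem simpleCoroot_simpleRoot_self (D : CartanDatum A P) (i : I) :
    D.simpleCoroot i (D.simpleRoot i) = 2 :=
  (D.pairing i i).trans (D.gcm.diag i)

theorem simpleReflection_mul_self (D : CartanDatum A P) (i : I) :
    D.simpleReflection i * D.simpleReflection i = 1 := by
  ext x
  simp only [LinearEquiv.mul_apply, simpleReflection_apply, map_sub, map_smul,
    simpleCoroot_simpleRoot_self, LinearEquiv.coe_one, id_eq]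
  module

theorem simpleReflection_apply_apply (D : CartanDatum A P) (i : I) (x : P) :
    D.simpleReflection i (D.simpleReflection i x) = x := by
  simpa using congrArg (fun g : P ≃ₗ[ℤ] P => g x) (D.simpleReflection_mul_self i)

theorem simpleReflection_inv (D : CartanDatum A P) (i : I) :
    (D.simpleReflection i)⁻¹ = D.simpleReflection i :=
  inv_eq_of_mul_eq_one_left (D.simpleReflection_mul_self i)

theorem simpleReflection_simpleRoot (D : CartanDatum A P) (i : I) :
    D.simpleReflection i (D.simpleRoot i) = -D.simpleRoot i := by
  rw [simpleReflection_apply, simpleCoroot_simpleRoot_self]; module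

theorem simpleCoroot_simpleReflection (D : CartanDatum A P) (i : I) (x : P) :
    D.simpleCoroot i (D.simpleReflection i x) = -D.simpleCoroot i x := by
  simp only [simpleReflection_apply, map_sub, map_smul, simpleCoroot_simpleRoot_self, smul_eq_mul]
  ring

theorem simpleReflection_mem (D : CartanDatum A P) (i : I) : D.simpleReflection i ∈ D.weylGroup :=
  Subgroup.subset_closure ⟨i, rfl⟩

/-- The element of the Weyl group that a word in the simple reflections represents. -/
noncomputable def wordProd (D : CartanDatum A P) (l : List I) : P ≃ₗ[ℤ] P :=
  (l.map D.simpleReflection).prod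

@[simp] theorem wordProd_nil (D : CartanDatum A P) : D.wordProd [] = 1 := rfl

@[simp] theorem wordProd_cons (D : CartanDatum A P) (i : I) (l : List I) :
    D.wordProd (i :: l) = D.simpleReflection i * D.wordProd l := by
  simp [wordProd]

@[simp] theorem wordProd_append (D : CartanDatum A P) (l l' : List I) :
    D.wordProd (l ++ l') = D.wordProd l * D.wordProd l' := by
  simp [wordProd]

theorem wordProd_reverse (D : CartanDatum A P) (l : List I) :
    D.wordProd l.reverse = (D.wordProd l)⁻¹ := by
  induction l with
  | nil => simp
  | cons i l ih => simp [ih, simpleReflection_inv]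

theorem wordProd_mem (D : CartanDatum A P) (l : List I) : D.wordProd l ∈ D.weylGroup := by
  induction l with
  | nil => exact one_mem _
  | cons i l ih => rw [wordProd_cons]; exact mul_mem (D.simpleReflection_mem i) ih

theorem exists_wordProd_eq {g : P ≃ₗ[ℤ] P} (hg : g ∈ D.weylGroup) : ∃ l, D.wordProd l = g := by
  induction hg using Subgroup.closure_induction with
  | mem x hx => obtain ⟨i, rfl⟩ := hx; exact ⟨[i], by simp⟩
  | one => exact ⟨[], rfl⟩
  | mul x y _ _ hx hy =>
    obtain ⟨l, rfl⟩ := hx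
    obtain ⟨l', rfl⟩ := hy
    exact ⟨l ++ l', by simp⟩
  | inv x _ hx =>
    obtain ⟨l, rfl⟩ := hx
    exact ⟨l.reverse, D.wordProd_reverse l⟩

theorem length_wordProd_le (D : CartanDatum A P) (l : List I) :
    D.length (D.wordProd l) ≤ l.length :=
  Nat.sInf_le ⟨l, rfl, rfl⟩

theorem exists_reduced {g : P ≃ₗ[ℤ] P} (hg : g ∈ D.weylGroup) :
    ∃ l : List I, D.wordProd l = g ∧ l.length = D.length g := by
  obtain ⟨l, hl⟩ := exists_wordProd_eq hg
  obtain ⟨l', h1, h2⟩ := Nat.sInf_mem (s := {n | ∃ l : List I, l.length = n ∧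
    (l.map D.simpleReflection).prod = g}) ⟨l.length, l, rfl, hl⟩
  exact ⟨l', h2, h1⟩

theorem length_simpleReflection_mul_le {g : P ≃ₗ[ℤ] P} (hg : g ∈ D.weylGroup) (i : I) :
    D.length (D.simpleReflection i * g) ≤ D.length g + 1 := by
  obtain ⟨l, rfl, h⟩ := exists_reduced hg
  rw [← h, ← wordProd_cons]
  exact D.length_wordProd_le (i :: l)

theorem length_mul_wordProd_le {g : P ≃ₗ[ℤ] P} (hg : g ∈ D.weylGroup) (l : List I) :
    D.length (g * D.wordProd l) ≤ D.length g + l.length := by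
  obtain ⟨l', rfl, h⟩ := exists_reduced hg
  rw [← h, ← wordProd_append, ← List.length_append]
  exact D.length_wordProd_le _

theorem IsRealRoot.simpleReflection {b : P} {bv : Module.Dual ℤ P} (h : D.IsRealRoot b bv)
    (i : I) : D.IsRealRoot (D.simpleReflection i b)
      (bv ∘ₗ (D.simpleReflection i : P →ₗ[ℤ] P)) := by
  convert IsRealRoot.reflect i h using 1
  · exact D.simpleReflection_apply i b
  · ext x
    simp [simpleReflection_apply, mul_comm]

/-- The Weyl group acts on real roots; the coroot of `g b` is `b^∨ ∘ g⁻¹`. -/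
theorem IsRealRoot.apply {b : P} {bv : Module.Dual ℤ P} (h : D.IsRealRoot b bv)
    {g : P ≃ₗ[ℤ] P} (hg : g ∈ D.weylGroup) :
    D.IsRealRoot (g b) (bv ∘ₗ ((g⁻¹ : P ≃ₗ[ℤ] P) : P →ₗ[ℤ] P)) := by
  obtain ⟨l, rfl⟩ := exists_wordProd_eq hg
  induction l with
  | nil => simpa using h
  | cons i l ih =>
    convert (ih (wordProd_mem _ _)).simpleReflection i using 1
    · simp
    · ext x
      simp [simpleReflection_inv]

theorem IsRealRoot.exists_word {b : P} {bv : Module.Dual ℤ P} (h : D.IsRealRoot b bv) :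
    ∃ g ∈ D.weylGroup, ∃ i, b = g (D.simpleRoot i) := by
  induction h with
  | simple i => exact ⟨1, one_mem _, i, rfl⟩
  | reflect m _ ih =>
    obtain ⟨g, hg, i, rfl⟩ := ih
    exact ⟨D.simpleReflection m * g, mul_mem (D.simpleReflection_mem m) hg, i, by
      simp [simpleReflection_apply]⟩

theorem IsRealRoot.neg {b : P} {bv : Module.Dual ℤ P} (h : D.IsRealRoot b bv) :
    D.IsRealRoot (-b) (-bv) := by
  induction h with
  | simple i =>
    have := IsRealRoot.reflect i (IsRealRoot.simple (D := D) i)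
    rw [simpleCoroot_simpleRoot_self] at this
    convert this using 1 <;> module
  | @reflect m b bv _ ih =>
    convert IsRealRoot.reflect m ih using 1
    · simp only [map_neg]; module
    · simp only [LinearMap.neg_apply]; module

/-- The cone of nonnegative integral combinations of the simple roots. -/
def posCone (D : CartanDatum A P) : AddSubmonoid P :=
  AddSubmonoid.closure (Set.range D.simpleRoot)

theorem simpleRoot_mem_posCone (D : CartanDatum A P) (i : I) : D.simpleRoot i ∈ D.posCone :=
  AddSubmonoid.subset_closure ⟨i, rfl⟩

theorem zsmul_add_zsmul_mem_posCone {a b : P} (ha : a ∈ D.posCone) (hb : b ∈ D.posCone) {x y : ℤ}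
    (hx : 0 ≤ x) (hy : 0 ≤ y) : x • a + y • b ∈ D.posCone := by
  lift x to ℕ using hx
  lift y to ℕ using hy
  rw [natCast_zsmul, natCast_zsmul]
  exact add_mem (nsmul_mem ha x) (nsmul_mem hb y)

theorem PosRoot.reflection_apply (b : D.PosRoot) (x : P) :
    b.reflection x = x - b.coroot x • b.root :=
  Module.reflection_apply _ _

theorem PosRoot.reflection_mul_self (b : D.PosRoot) : b.reflection * b.reflection = 1 := by
  ext x
  simp only [LinearEquiv.mul_apply, PosRoot.reflection_apply, map_sub, map_smul,
    b.isReal.pairing_self, LinearEquiv.coe_one, id_eq]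
  module

/-- The real root `g⁻¹ α_i`. -/
theorem isRealRoot_inv_simpleRoot {g : P ≃ₗ[ℤ] P} (hg : g ∈ D.weylGroup) (i : I) :
    D.IsRealRoot (g⁻¹ (D.simpleRoot i)) (D.simpleCoroot i ∘ₗ (g : P →ₗ[ℤ] P)) := by
  simpa using (IsRealRoot.simple (D := D) i).apply (inv_mem hg)

section Fin

variable [Fintype I]

theorem coeff_unique (D : CartanDatum A P) {c c' : I → ℤ}
    (h : ∑ k, c k • D.simpleRoot k = ∑ k, c' k • D.simpleRoot k) : c = c' := by
  funext k
  have h1 : ∑ k, (c k - c' k) • D.simpleRoot k = 0 := by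
    simp only [sub_smul, Finset.sum_sub_distrib]
    rw [h, sub_self]
  have := Fintype.linearIndependent_iff.1 D.linearIndependent_root _ h1 k
  linarith

theorem cocoeff_unique (D : CartanDatum A P) {c c' : I → ℤ}
    (h : ∑ k, c k • D.simpleCoroot k = ∑ k, c' k • D.simpleCoroot k) : c = c' := by
  funext k
  have h1 : ∑ k, (c k - c' k) • D.simpleCoroot k = 0 := by
    simp only [sub_smul, Finset.sum_sub_distrib]
    rw [h, sub_self]
  have := Fintype.linearIndependent_iff.1 D.linearIndependent_coroot _ h1 k
  linarith

/-- Symmetrizability makes the coroot a function of the real root. -/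
theorem IsRealRoot.coroot_unique {b : P} {bv bv' : Module.Dual ℤ P} (h : D.IsRealRoot b bv)
    (h' : D.IsRealRoot b bv') : bv = bv' := by
  obtain ⟨d, hd0, hd⟩ := D.gcm.symmetrizable
  obtain ⟨c, c', h1, h2, ⟨q, hq, hqc⟩, -, ⟨f', hf'⟩⟩ := h.exists_coeff hd0 hd
  obtain ⟨e, e', k1, k2, ⟨p, hp, hpc⟩, -, ⟨g', hg'⟩⟩ := h'.exists_coeff hd0 hd
  have hce : c = e := D.coeff_unique (h1.symm.trans k1)
  subst hce
  rw [h2, k2, CartanDatum.eq_of_proportional hf' hg' hp hq fun k => ?_]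
  have hdk := (hd0 k).ne'
  apply mul_right_cancel₀ hdk
  rw [mul_assoc, ← hqc k, mul_assoc, ← hpc k]
  ring

theorem IsRealRoot.root_unique {b b' : P} {bv : Module.Dual ℤ P} (h : D.IsRealRoot b bv)
    (h' : D.IsRealRoot b' bv) : b = b' := by
  obtain ⟨d, hd0, hd⟩ := D.gcm.symmetrizable
  obtain ⟨c, c', h1, h2, ⟨q, hq, hqc⟩, ⟨f, hf⟩, -⟩ := h.exists_coeff hd0 hd
  obtain ⟨e, e', k1, k2, ⟨p, hp, hpc⟩, ⟨g, hg⟩, -⟩ := h'.exists_coeff hd0 hd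
  have hce : c' = e' := D.cocoeff_unique (h2.symm.trans k2)
  subst hce
  rw [h1, k1, CartanDatum.eq_of_proportional hf hg hq hp fun k => ?_]
  rw [hqc k, hpc k]

theorem simpleCoroot_rho (D : CartanDatum A P) (i : I) : D.simpleCoroot i D.rho = 1 := by
  simp [rho, D.pairing_fundWeight]

theorem mem_posCone_iff (D : CartanDatum A P) (c : I → ℤ) :
    ∑ k, c k • D.simpleRoot k ∈ D.posCone ↔ ∀ k, 0 ≤ c k := by
  constructor
  · intro h
    have : ∀ x ∈ D.posCone, ∃ e : I → ℤ, (∀ k, 0 ≤ e k) ∧ x = ∑ k, e k • D.simpleRoot k := by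
      intro x hx
      induction hx using AddSubmonoid.closure_induction with
      | mem x hx =>
        obtain ⟨i, rfl⟩ := hx
        refine ⟨Pi.single i 1, fun k => ?_, by simp [Pi.single_apply]⟩
        by_cases hk : k = i
        · subst hk; simp
        · simp [hk]
      | zero => exact ⟨0, fun _ => le_rfl, by simp⟩
      | add x y _ _ hx hy =>
        obtain ⟨e, he, rfl⟩ := hx
        obtain ⟨e', he', rfl⟩ := hy
        exact ⟨e + e', fun k => add_nonneg (he k) (he' k), by
          simp [add_smul, Finset.sum_add_distrib]⟩
    obtain ⟨e, he, hx⟩ := this _ h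
    rw [D.coeff_unique hx]
    exact he
  · intro h
    refine sum_mem fun k _ => ?_
    obtain ⟨n, hn⟩ := Int.eq_ofNat_of_zero_le (h k)
    rw [hn, natCast_zsmul]
    exact nsmul_mem (D.simpleRoot_mem_posCone k) n

theorem IsRealRoot.exists_nonneg_coeff {b : P} {bv : Module.Dual ℤ P} (h : D.IsRealRoot b bv)
    (hb : b ∈ D.posCone) : ∃ c : I → ℤ, bv = ∑ k, c k • D.simpleCoroot k ∧ (∀ k, 0 ≤ c k) ∧
      ∃ f : I → ℤ, ∑ k, f k * c k = 1 := by
  obtain ⟨d, hd0, hd⟩ := D.gcm.symmetrizable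
  obtain ⟨c, c', h1, h2, ⟨q, hq, hqc⟩, -, hf⟩ := h.exists_coeff hd0 hd
  rw [h1, mem_posCone_iff] at hb
  refine ⟨c', h2, fun k => ?_, hf⟩
  have h0 : (0 : ℚ) ≤ c' k * d k := by
    rw [← hqc k]
    have : (0 : ℚ) ≤ c k := by exact_mod_cast hb k
    positivity
  have := nonneg_of_mul_nonneg_left h0 (hd0 k)
  exact_mod_cast this

/-- The coroot of a positive real root has positive height. -/
theorem IsRealRoot.rho_pos {b : P} {bv : Module.Dual ℤ P} (h : D.IsRealRoot b bv)
    (hb : b ∈ D.posCone) : 0 < bv D.rho := by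
  obtain ⟨c', h2, hc', f', hf'⟩ := h.exists_nonneg_coeff hb
  have e : bv D.rho = ∑ k, c' k := by
    simp [h2, LinearMap.sum_apply, simpleCoroot_rho]
  rw [e]
  refine lt_of_le_of_ne (Finset.sum_nonneg fun k _ => hc' k) fun h0 => ?_
  have := (Finset.sum_eq_zero_iff_of_nonneg fun k _ => hc' k).1 h0.symm
  rw [Finset.sum_eq_zero fun k hk => by rw [this k hk, mul_zero]] at hf'
  exact zero_ne_one hf'

theorem PosRoot.coroot_fundWeight_nonneg (b : D.PosRoot) (i : I) :
    0 ≤ b.coroot (D.fundWeight i) := by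
  obtain ⟨c, h, hc, -⟩ := b.isReal.exists_nonneg_coeff b.pos
  rw [h]
  simpa [LinearMap.sum_apply, D.pairing_fundWeight] using hc i

theorem PosRoot.corootCoeff_eq (b : D.PosRoot) (i : I) :
    b.corootCoeff i = b.coroot (D.fundWeight i) := by
  conv_rhs => rw [b.coroot_eq]
  simp [LinearMap.sum_apply, D.pairing_fundWeight]

/-- Conjugating a reflection by a Weyl group element gives the reflection in the image root. -/
theorem IsRealRoot.apply_reflection {b b' : P} {bv bv' : Module.Dual ℤ P}
    (h : D.IsRealRoot b bv) (h' : D.IsRealRoot b' bv') {g : P ≃ₗ[ℤ] P} (hg : g ∈ D.weylGroup)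
    (hb : g b = b') (x : P) : g (x - bv x • b) = g x - bv' (g x) • b' := by
  subst hb
  rw [← (h.apply hg).coroot_unique h']
  simp

end Fin

end CartanDatum

/-! ### Every real root is positive or negative -/

namespace CartanDatum

/-- The coefficients `(x, y)` that occur in a rank two system with `s_i : x ↦ q y - x` and
`s_j : y ↦ p x - y`, when the two reflections are applied alternately, starting from `α_i` with
`s_j`, until a simple root is about to be reflected by itself. The flag says which reflection
comes next. -/
theorem exists_rankTwo_states {p q : ℤ} (hp : 0 ≤ p) (hq : 0 ≤ q) (h0 : p = 0 ↔ q = 0) :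
    ∃ G : Bool → ℤ → ℤ → Prop, G true 1 p ∧
      (∀ x y, G true x y → 0 ≤ x ∧ 0 ≤ y ∧ ((x = 1 ∧ y = 0) ∨ G false (q * y - x) y)) ∧
      (∀ x y, G false x y → 0 ≤ x ∧ 0 ≤ y ∧ ((x = 0 ∧ y = 1) ∨ G true x (p * x - y))) := by
  by_cases h4 : 4 ≤ p * q
  · refine ⟨fun t x y => 0 ≤ x ∧ 0 ≤ y ∧ if t then 2 * x ≤ q * y else 2 * y ≤ p * x, ?_, ?_, ?_⟩
    · simp only [if_true]
      exact ⟨by norm_num, hp, by nlinarith⟩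
    · rintro x y ⟨hx, hy, h⟩
      simp only [if_true] at h
      exact ⟨hx, hy, Or.inr ⟨by linarith, hy, by
        simp only [Bool.false_eq_true, if_false]; nlinarith⟩⟩
    · rintro x y ⟨hx, hy, h⟩
      simp only [Bool.false_eq_true, if_false] at h
      exact ⟨hx, hy, Or.inr ⟨hx, by linarith, by simp only [if_true]; nlinarith⟩⟩
  · -- In finite type the states are listed; the pairs (p, q) are (0,0), (1,1), (1,2), (2,1), (1,3),
    -- (3,1).
    have hcases : (p = 0 ∧ q = 0) ∨ (p = 1 ∧ q = 1) ∨ (p = 1 ∧ q = 2) ∨ (p = 2 ∧ q = 1) ∨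
        (p = 1 ∧ q = 3) ∨ (p = 3 ∧ q = 1) := by
      rcases hp.eq_or_lt with h | h
      · exact Or.inl ⟨h.symm, h0.1 h.symm⟩
      · have hq0 : 0 < q := lt_of_le_of_ne hq fun h' => h.ne' (h0.2 h'.symm)
        have : p ≤ 3 := by nlinarith
        have : q ≤ 3 := by nlinarith
        interval_cases p <;> interval_cases q <;> simp at h4 ⊢
    rcases hcases with ⟨rfl, rfl⟩ | ⟨rfl, rfl⟩ | ⟨rfl, rfl⟩ | ⟨rfl, rfl⟩ | ⟨rfl, rfl⟩ | ⟨rfl, rfl⟩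
    · exact ⟨fun t x y => t = true ∧ x = 1 ∧ y = 0, by simp, by simp +contextual, by simp⟩
    · exact ⟨fun t x y => (t = true ∧ x = 1 ∧ y = 1) ∨ (t = false ∧ x = 0 ∧ y = 1), by simp,
        by simp +contextual, by simp +contextual⟩
    · exact ⟨fun t x y => (t = true ∧ x = 1 ∧ y = 1) ∨ (t = false ∧ x = 1 ∧ y = 1) ∨
        (t = true ∧ x = 1 ∧ y = 0), by simp, by
          rintro x y (⟨-, rfl, rfl⟩ | ⟨h, -⟩ | ⟨-, rfl, rfl⟩) <;> simp_all, by simp +contextual⟩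
    · exact ⟨fun t x y => (t = true ∧ x = 1 ∧ y = 2) ∨ (t = false ∧ x = 1 ∧ y = 2) ∨
        (t = true ∧ x = 1 ∧ y = 0), by simp, by
          rintro x y (⟨-, rfl, rfl⟩ | ⟨h, -⟩ | ⟨-, rfl, rfl⟩) <;> simp_all, by simp +contextual⟩
    · exact ⟨fun t x y => (t = true ∧ x = 1 ∧ y = 1) ∨ (t = false ∧ x = 2 ∧ y = 1) ∨
        (t = true ∧ x = 2 ∧ y = 1) ∨ (t = false ∧ x = 1 ∧ y = 1) ∨ (t = true ∧ x = 1 ∧ y = 0),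
        by simp, by
          rintro x y (⟨-, rfl, rfl⟩ | ⟨h, -⟩ | ⟨-, rfl, rfl⟩ | ⟨h, -⟩ | ⟨-, rfl, rfl⟩) <;> simp_all,
        by rintro x y (⟨h, -⟩ | ⟨-, rfl, rfl⟩ | ⟨h, -⟩ | ⟨-, rfl, rfl⟩ | ⟨h, -⟩) <;> simp_all⟩
    · exact ⟨fun t x y => (t = true ∧ x = 1 ∧ y = 3) ∨ (t = false ∧ x = 2 ∧ y = 3) ∨
        (t = true ∧ x = 2 ∧ y = 3) ∨ (t = false ∧ x = 1 ∧ y = 3) ∨ (t = true ∧ x = 1 ∧ y = 0),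
        by simp, by
          rintro x y (⟨-, rfl, rfl⟩ | ⟨h, -⟩ | ⟨-, rfl, rfl⟩ | ⟨h, -⟩ | ⟨-, rfl, rfl⟩) <;> simp_all,
        by rintro x y (⟨h, -⟩ | ⟨-, rfl, rfl⟩ | ⟨h, -⟩ | ⟨-, rfl, rfl⟩ | ⟨h, -⟩) <;> simp_all⟩

variable {I : Type u} [DecidableEq I] {A : Matrix I I ℤ} {P : Type v} [AddCommGroup P]
  {D : CartanDatum A P} [Fintype I]

/-- If `ℓ(g s_i) ≥ ℓ(g)`, then `g α_i` is positive. The proof strips simple reflections `s_j`, `s_i`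
alternately from the right of `g`, as long as the length drops; this reduces the claim to a shorter
element and to the rank two system of `i` and `j`. -/
theorem apply_simpleRoot_mem_posCone (n : ℕ) : ∀ g ∈ D.weylGroup, D.length g = n → ∀ i,
    D.length g ≤ D.length (g * D.simpleReflection i) → g (D.simpleRoot i) ∈ D.posCone := by
  induction n using Nat.strong_induction_on with
  | _ n ih =>
  intro g hg hn i hle
  obtain ⟨l, rfl, hl⟩ := exists_reduced hg
  rcases List.eq_nil_or_concat l with rfl | ⟨l', j, rfl⟩
  · simpa using D.simpleRoot_mem_posCone i
  set v₀ := D.wordProd l' with hv₀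
  have hgv : D.wordProd (l'.concat j) = v₀ * D.simpleReflection j := by simp [hv₀]
  rw [hgv] at hg hn hle hl ⊢
  have hv₀n : D.length v₀ + 1 ≤ n := by
    have := D.length_wordProd_le l'
    rw [← hn, ← hl]
    simpa using this
  have hij : i ≠ j := by
    rintro rfl
    rw [mul_assoc, simpleReflection_mul_self, mul_one] at hle
    omega
  obtain ⟨G, hG0, hG1, hG2⟩ := exists_rankTwo_states (p := -A i j) (q := -A j i)
    (by have := D.gcm.nonpos i j hij; omega) (by have := D.gcm.nonpos j i hij.symm; omega)
    (by have := D.gcm.zero_iff i j; omega)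
  -- `t` names the simple reflection to be stripped next, `t'` the other one.
  let t : Bool → I := fun b => if b then i else j
  have hGt : ∀ b x y, G b x y → 0 ≤ x ∧ 0 ≤ y ∧
      (x • D.simpleRoot i + y • D.simpleRoot j = D.simpleRoot (t b) ∨
        ∃ x' y', G (!b) x' y' ∧ D.simpleReflection (t b) (x • D.simpleRoot i +
          y • D.simpleRoot j) = x' • D.simpleRoot i + y' • D.simpleRoot j) := by
    intro b x y h
    cases b
    · obtain ⟨h1, h2, h3⟩ := hG2 x y h
      refine ⟨h1, h2, h3.imp ?_ fun h => ⟨_, _, h, ?_⟩⟩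
      · rintro ⟨rfl, rfl⟩; simp [t]
      · simp only [t, Bool.false_eq_true, if_false, simpleReflection_apply, map_add, map_smul,
          D.pairing, D.gcm.diag]
        module
    · obtain ⟨h1, h2, h3⟩ := hG1 x y h
      refine ⟨h1, h2, h3.imp ?_ fun h => ⟨_, _, h, ?_⟩⟩
      · rintro ⟨rfl, rfl⟩; simp [t]
      · simp only [t, if_true, simpleReflection_apply, map_add, map_smul,
          D.pairing, D.gcm.diag]
        module
  have key : ∀ m, ∀ v ∈ D.weylGroup, D.length v = m → ∀ (b : Bool) (lu : List I) (x y : ℤ),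
      v₀ * D.simpleReflection j = v * D.wordProd lu →
      D.length v + lu.length ≤ n → D.length v < n → G b x y →
      D.wordProd lu (D.simpleRoot i) = x • D.simpleRoot i + y • D.simpleRoot j →
      D.length v ≤ D.length (v * D.simpleReflection (t !b)) →
      (v₀ * D.simpleReflection j) (D.simpleRoot i) ∈ D.posCone := by
    intro m
    induction m using Nat.strong_induction_on with
    | _ m ihm =>
    intro v hv hvm b lu x y hw hlen hvn hG hu hback
    obtain ⟨hx, hy, hstep⟩ := hGt b x y hG
    by_cases hend : D.length v ≤ D.length (v * D.simpleReflection (t b))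
    · have hboth : ∀ k, k = i ∨ k = j → D.length v ≤ D.length (v * D.simpleReflection k) := by
        rintro k (rfl | rfl) <;> cases b <;> simpa [t] using by assumption
      rw [hw, LinearEquiv.mul_apply, hu, map_add, map_smul, map_smul]
      exact zsmul_add_zsmul_mem_posCone (ih _ hvn v hv rfl i (hboth i (Or.inl rfl)))
        (ih _ hvn v hv rfl j (hboth j (Or.inr rfl))) hx hy
    · push Not at hend
      have hv' : v * D.simpleReflection (t b) ∈ D.weylGroup :=
        mul_mem hv (D.simpleReflection_mem _)
      have hvv : v * D.simpleReflection (t b) * D.simpleReflection (t b) = v := by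
        rw [mul_assoc, simpleReflection_mul_self, mul_one]
      rcases hstep with hs | ⟨x', y', hG', hxy⟩
      · exfalso
        rw [hs] at hu
        have hconj : D.wordProd lu * D.simpleReflection i =
            D.simpleReflection (t b) * D.wordProd lu := by
          ext z
          simp only [LinearEquiv.mul_apply, simpleReflection_apply]
          exact (IsRealRoot.simple i).apply_reflection (IsRealRoot.simple (t b))
            (wordProd_mem _ _) hu z
        have := length_mul_wordProd_le hv' lu
        rw [mul_assoc, ← hconj, ← mul_assoc, ← hw] at this
        omega
      · refine ihm _ (by omega) _ hv' rfl (!b) (t b :: lu) x' y' ?_ ?_ (by omega) hG' ?_ ?_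
        · rw [wordProd_cons, ← mul_assoc, hvv, hw]
        · simp only [List.length_cons]; omega
        · rw [wordProd_cons, LinearEquiv.mul_apply, hu, hxy]
        · rw [Bool.not_not, hvv]; exact hend.le
  refine key _ v₀ (wordProd_mem _ _) rfl true [j] 1 (-A i j) (by simp) (by simpa using hv₀n)
    (by omega) hG0 ?_ ?_
  · simp [simpleReflection_apply, D.pairing, sub_eq_add_neg]
  · simp only [Bool.not_true, t, Bool.false_eq_true, if_false]
    omega

theorem IsRealRoot.mem_posCone_or_neg {b : P} {bv : Module.Dual ℤ P} (h : D.IsRealRoot b bv) :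
    b ∈ D.posCone ∨ -b ∈ D.posCone := by
  obtain ⟨g, hg, i, rfl⟩ := h.exists_word
  rcases le_total (D.length g) (D.length (g * D.simpleReflection i)) with h1 | h1
  · exact Or.inl (apply_simpleRoot_mem_posCone _ g hg rfl i h1)
  · right
    have := apply_simpleRoot_mem_posCone _ (g * D.simpleReflection i)
      (mul_mem hg (D.simpleReflection_mem i)) rfl i
      (by rwa [mul_assoc, simpleReflection_mul_self, mul_one])
    rwa [LinearEquiv.mul_apply, simpleReflection_simpleRoot, map_neg] at this

theorem IsRealRoot.mem_posCone_iff {b : P} {bv : Module.Dual ℤ P} (h : D.IsRealRoot b bv) :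
    b ∈ D.posCone ↔ 0 < bv D.rho := by
  refine ⟨h.rho_pos, fun h0 => h.mem_posCone_or_neg.resolve_right fun h1 => ?_⟩
  have := h.neg.rho_pos h1
  rw [LinearMap.neg_apply] at this
  omega

theorem IsRealRoot.rho_ne_zero {b : P} {bv : Module.Dual ℤ P} (h : D.IsRealRoot b bv) :
    bv D.rho ≠ 0 := by
  intro h0
  rcases h.mem_posCone_or_neg with h1 | h1
  · exact (h.rho_pos h1).ne' h0
  · have := h.neg.rho_pos h1
    rw [LinearMap.neg_apply] at this
    omega

theorem PosRoot.coroot_rho_pos (b : D.PosRoot) : 0 < b.coroot D.rho := b.isReal.rho_pos b.pos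

/-- A simple reflection changes the sign of no positive real root but its own. -/
theorem IsRealRoot.eq_simpleRoot {b : P} {bv : Module.Dual ℤ P} (h : D.IsRealRoot b bv) (i : I)
    (h0 : 0 < bv D.rho) (h1 : bv (D.simpleReflection i D.rho) < 0) :
    b = D.simpleRoot i := by
  have hr := h.simpleReflection i
  have hpos := h.mem_posCone_iff.2 h0
  have hneg : -(D.simpleReflection i b) ∈ D.posCone := by
    refine hr.mem_posCone_or_neg.resolve_left fun h2 => ?_
    have := hr.rho_pos h2
    simp only [LinearMap.comp_apply, LinearEquiv.coe_coe] at this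
    omega
  obtain ⟨d, hd0, hd⟩ := D.gcm.symmetrizable
  obtain ⟨c, -, hb, -, -, ⟨f, hf⟩, -⟩ := h.exists_coeff hd0 hd
  rw [hb, D.mem_posCone_iff] at hpos
  have e : -(D.simpleReflection i b) = ∑ k, (Pi.single (M := fun _ => ℤ) i (D.simpleCoroot i b) k
      - c k) • D.simpleRoot k := by
    simp [sub_smul, Finset.sum_sub_distrib, ← hb, Pi.single_apply, simpleReflection_apply]
  rw [e, D.mem_posCone_iff] at hneg
  have hc : ∀ k, k ≠ i → c k = 0 := by
    intro k hk
    have h2 := hneg k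
    rw [Pi.single_eq_of_ne hk] at h2
    have := hpos k
    omega
  rw [Finset.sum_eq_single i (fun k _ hk => by rw [hc k hk, mul_zero]) (by simp)] at hf
  have hci : c i = 1 := Int.eq_one_of_mul_eq_one_left (hpos i) hf
  rw [hb, Finset.sum_eq_single i (fun k _ hk => by rw [hc k hk, zero_smul]) (by simp), hci,
    one_smul]

/-! ### The Bruhat order -/

/-- The strong exchange property, for the word of a Weyl group element that makes a positive root
negative. -/
theorem exists_exchange (l : List I) {b : P} {bv : Module.Dual ℤ P} (h : D.IsRealRoot b bv)
    (h0 : 0 < bv D.rho) (h1 : bv ((D.wordProd l)⁻¹ D.rho) < 0) :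
    ∃ l₁ i l₂, l = l₁ ++ i :: l₂ ∧ D.wordProd l₂ b = D.simpleRoot i := by
  induction l with
  | nil => simp at h1; omega
  | cons i l ih =>
    rcases lt_or_ge (bv ((D.wordProd l)⁻¹ D.rho)) 0 with h2 | h2
    · obtain ⟨l₁, j, l₂, rfl, h3⟩ := ih h2
      exact ⟨i :: l₁, j, l₂, rfl, h3⟩
    · have hr := h.apply (D.wordProd_mem l)
      have h3 := hr.rho_ne_zero
      refine ⟨[], i, l, rfl, hr.eq_simpleRoot i (lt_of_le_of_ne h2 h3.symm) ?_⟩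
      simpa [simpleReflection_inv] using h1

/-- The exchange property for lengths. -/
theorem length_mul_reflection_lt {g g' : P ≃ₗ[ℤ] P} (hg : g ∈ D.weylGroup) {b : P}
    {bv : Module.Dual ℤ P} (h : D.IsRealRoot b bv) (h0 : 0 < bv D.rho)
    (h1 : bv (g⁻¹ D.rho) < 0) (hg' : ∀ x, g' x = g (x - bv x • b)) :
    D.length g' < D.length g := by
  obtain ⟨l, rfl, hl⟩ := exists_reduced hg
  obtain ⟨l₁, i, l₂, rfl, h3⟩ := exists_exchange l h h0 h1
  have : g' = D.wordProd (l₁ ++ l₂) := by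
    ext x
    rw [hg', wordProd_append, wordProd_cons, wordProd_append, LinearEquiv.mul_apply,
      LinearEquiv.mul_apply, LinearEquiv.mul_apply,
      h.apply_reflection (IsRealRoot.simple i) (D.wordProd_mem l₂) h3, ← simpleReflection_apply,
      simpleReflection_apply_apply]
  rw [this, ← hl]
  refine (D.length_wordProd_le _).trans_lt ?_
  simp

theorem PosRoot.reflection_mem (b : D.PosRoot) : b.reflection ∈ D.weylGroup := by
  obtain ⟨g, hg, i, hb⟩ := b.isReal.exists_word
  have : b.reflection = g * D.simpleReflection i * g⁻¹ := by
    rw [eq_mul_inv_iff_mul_eq]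
    ext x
    rw [LinearEquiv.mul_apply, LinearEquiv.mul_apply, PosRoot.reflection_apply,
      simpleReflection_apply, (IsRealRoot.simple i).apply_reflection b.isReal hg hb.symm]
  rw [this]
  exact mul_mem (mul_mem hg (D.simpleReflection_mem i)) (inv_mem hg)

theorem simpleCoroot_apply_rho_ne_zero {g : P ≃ₗ[ℤ] P} (hg : g ∈ D.weylGroup) (i : I) :
    D.simpleCoroot i (g D.rho) ≠ 0 :=
  (isRealRoot_inv_simpleRoot hg i).rho_ne_zero

theorem length_simpleReflection_mul_of_neg {g : P ≃ₗ[ℤ] P} (hg : g ∈ D.weylGroup) {i : I}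
    (h : D.simpleCoroot i (g D.rho) < 0) :
    D.length (D.simpleReflection i * g) + 1 = D.length g := by
  have hr := (isRealRoot_inv_simpleRoot hg i).neg
  have h1 := length_mul_reflection_lt (g' := D.simpleReflection i * g) hg hr
    (by simpa using h) (by simp [simpleCoroot_rho]) (fun x => by
      simp [simpleReflection_apply])
  have h2 := length_simpleReflection_mul_le (mul_mem (D.simpleReflection_mem i) hg) i
  rw [← mul_assoc, simpleReflection_mul_self, one_mul] at h2
  omega

theorem length_simpleReflection_mul_of_pos {g : P ≃ₗ[ℤ] P} (hg : g ∈ D.weylGroup) {i : I}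
    (h : 0 < D.simpleCoroot i (g D.rho)) :
    D.length (D.simpleReflection i * g) = D.length g + 1 := by
  have := length_simpleReflection_mul_of_neg (i := i) (mul_mem (D.simpleReflection_mem i) hg)
    (by rw [LinearEquiv.mul_apply, simpleCoroot_simpleReflection]; omega)
  rw [← mul_assoc, simpleReflection_mul_self, one_mul] at this
  exact this.symm

/-- In a cover `g ⋖ g s_β`, the root `g β` is positive. -/
theorem BruhatCover.coroot_inv_rho_pos {g : P ≃ₗ[ℤ] P} {b : D.PosRoot}
    (h : D.BruhatCover g (g * b.reflection)) : 0 < b.coroot (g⁻¹ D.rho) := by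
  by_contra hn
  have h0 : b.coroot (g⁻¹ D.rho) ≠ 0 := (b.isReal.apply h.1).rho_ne_zero
  have := length_mul_reflection_lt (g' := g * b.reflection) h.1 b.isReal b.coroot_rho_pos
    (by omega) (fun x => by rw [LinearEquiv.mul_apply, PosRoot.reflection_apply])
  have := h.2.2
  omega

/-- The lifting property: if `g ⋖ g s_β`, and `s_i` is a left descent of `g s_β` but not of `g`,
then `g s_β = s_i g`, that is, `g β = α_i`. -/
theorem BruhatCover.apply_root_eq {g : P ≃ₗ[ℤ] P} {b : D.PosRoot}
    (h : D.BruhatCover g (g * b.reflection)) {i : I} (h1 : 0 < D.simpleCoroot i (g D.rho))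
    (h2 : D.simpleCoroot i ((g * b.reflection) D.rho) < 0) : g b.root = D.simpleRoot i := by
  have hpos := h.coroot_inv_rho_pos
  obtain ⟨hg, -, hlen⟩ := h
  have hg' : g * b.reflection ∈ D.weylGroup := mul_mem hg b.reflection_mem
  have hl1 := length_simpleReflection_mul_of_neg hg' h2
  obtain ⟨l, hl, hll⟩ := exists_reduced (mul_mem (D.simpleReflection_mem i) hg')
  have hw : D.wordProd (i :: l) = g * b.reflection := by
    rw [wordProd_cons, hl, ← mul_assoc, simpleReflection_mul_self, one_mul]
  have hgb : (g * b.reflection) b.root = -g b.root := by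
    rw [LinearEquiv.mul_apply, PosRoot.reflection_apply, b.isReal.pairing_self, ← map_neg]
    congr 1
    module
  have hneg : b.coroot ((D.wordProd (i :: l))⁻¹ D.rho) < 0 := by
    have hinv : b.reflection⁻¹ = b.reflection :=
      inv_eq_of_mul_eq_one_left b.reflection_mul_self
    rw [hw, mul_inv_rev, hinv, LinearEquiv.mul_apply, PosRoot.reflection_apply, map_sub, map_smul,
      b.isReal.pairing_self, smul_eq_mul]
    omega
  obtain ⟨l₁, j, l₂, hs, hj⟩ := exists_exchange (i :: l) b.isReal b.coroot_rho_pos hneg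
  cases l₁ with
  | nil =>
    simp only [List.nil_append, List.cons.injEq] at hs
    obtain ⟨rfl, rfl⟩ := hs
    have : D.simpleReflection i (D.wordProd l b.root) = -g b.root := by
      rw [← hgb, ← hw, wordProd_cons, LinearEquiv.mul_apply]
    rw [hj, simpleReflection_simpleRoot] at this
    exact (neg_injective this).symm
  | cons k l₁ =>
    exfalso
    simp only [List.cons_append, List.cons.injEq] at hs
    obtain ⟨rfl, rfl⟩ := hs
    have hsg : D.simpleReflection i * g = D.wordProd (l₁ ++ l₂) := by
      have : g = D.wordProd (i :: (l₁ ++ j :: l₂)) * b.reflection := by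
        rw [hw, mul_assoc, b.reflection_mul_self, mul_one]
      rw [this, wordProd_cons, ← mul_assoc, ← mul_assoc, simpleReflection_mul_self, one_mul]
      ext x
      rw [LinearEquiv.mul_apply, PosRoot.reflection_apply, wordProd_append, wordProd_cons,
        wordProd_append, LinearEquiv.mul_apply, LinearEquiv.mul_apply, LinearEquiv.mul_apply,
        b.isReal.apply_reflection (IsRealRoot.simple j) (D.wordProd_mem l₂) hj,
        ← simpleReflection_apply, simpleReflection_apply_apply]
    have h3 := length_simpleReflection_mul_of_pos hg h1
    have h4 := D.length_wordProd_le (l₁ ++ l₂)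
    rw [← hsg] at h4
    simp only [List.length_append, List.length_cons] at h4 hll
    omega

end CartanDatum

/-! ### Words of signs -/

namespace SignWord

open RootChain (Cancels)

theorem card_filter_lt_card_filter {K : Type v} {S : Finset K} {p : K} (hp : p ∈ S)
    {Q R : K → Prop} [DecidablePred Q] [DecidablePred R] (h : ∀ a ∈ S, Q a → R a) (hQ : ¬ Q p) (hR : R p) :
    (S.filter Q).card < (S.filter R).card := by
  refine Finset.card_lt_card (Finset.ssubset_iff_of_subset (fun a ha => ?_) |>.2
    ⟨p, by simp [hp, hR], by simp [hQ]⟩)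
  simp only [Finset.mem_filter] at ha ⊢
  exact ⟨ha.1, h a ha.1 ha.2⟩

variable {K : Type v} [LinearOrder K]

open Classical in
/-- The height of a finite word of signs at the cut `k`: the number of letters `+` minus the number
of letters `-` strictly to the left of `k`. The cut `⊤` lies to the right of the whole word. -/
noncomputable def height (S : Finset K) (plus : K → Prop) (k : WithTop K) : ℤ :=
  ∑ a ∈ S with ((a : K) : WithTop K) < k, if plus a then 1 else -1

variable {S : Finset K} {plus : K → Prop}

theorem height_congr {k k' : WithTop K} (h : ∀ a ∈ S, (a : WithTop K) < k ↔ (a : WithTop K) < k') :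
    height S plus k = height S plus k' := by
  unfold height
  rw [Finset.filter_congr h]

theorem height_eq_zero {k : WithTop K} (h : ∀ a ∈ S, ¬ (a : WithTop K) < k) :
    height S plus k = 0 := by
  unfold height
  rw [Finset.filter_false_of_mem h, Finset.sum_empty]

open Classical in
theorem height_eq_add {p : K} {k k' : WithTop K} (hp : p ∈ S) (hpk' : ¬ (p : WithTop K) < k')
    (hpk : (p : WithTop K) < k)
    (h : ∀ a ∈ S, a ≠ p → ((a : WithTop K) < k ↔ (a : WithTop K) < k')) :
    height S plus k = height S plus k' + if plus p then 1 else -1 := by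
  unfold height
  have : S.filter (fun a : K => (a : WithTop K) < k) =
      insert p (S.filter (fun a : K => (a : WithTop K) < k')) := by
    ext a
    simp only [Finset.mem_filter, Finset.mem_insert]
    by_cases ha : a = p
    · subst ha; simp [hp, hpk]
    · simp only [ha, false_or]
      exact and_congr_right fun h' => h a h' ha
  rw [this, Finset.sum_insert (by simp [hpk']), add_comm]

open Classical in
theorem exists_prev {c k : WithTop K} (h : ∃ a ∈ S, c ≤ (a : WithTop K) ∧ (a : WithTop K) < k) :
    ∃ p ∈ S, c ≤ (p : WithTop K) ∧ (p : WithTop K) < k ∧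
      height S plus k = height S plus p + if plus p then 1 else -1 := by
  obtain ⟨a, ha, hca, hak⟩ := h
  obtain ⟨p, hp, hmax⟩ := (S.filter fun a : K => (a : WithTop K) < k).exists_max_image id
    ⟨a, by simp [ha, hak]⟩
  simp only [Finset.mem_filter, id_eq, and_imp] at hp hmax
  refine ⟨p, hp.1, hca.trans (WithTop.coe_le_coe.2 (hmax a ha hak)), hp.2,
    height_eq_add hp.1 (lt_irrefl _) hp.2 fun b hb hbp => ?_⟩
  rw [WithTop.coe_lt_coe]
  exact ⟨fun h => lt_of_le_of_ne (hmax b hb h) hbp, fun h => (WithTop.coe_lt_coe.2 h).trans hp.2⟩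

theorem exists_first {c k : WithTop K} (h : ∃ a ∈ S, c ≤ (a : WithTop K) ∧ (a : WithTop K) < k) :
    ∃ p ∈ S, c ≤ (p : WithTop K) ∧ (p : WithTop K) < k ∧ height S plus c = height S plus p := by
  obtain ⟨a, ha, hca, hak⟩ := h
  obtain ⟨p, hp, hmin⟩ := (S.filter fun a : K => c ≤ (a : WithTop K)).exists_min_image id
    ⟨a, by simp [ha, hca]⟩
  simp only [Finset.mem_filter, id_eq, and_imp] at hp hmin
  refine ⟨p, hp.1, hp.2, (WithTop.coe_le_coe.2 (hmin a ha hca)).trans_lt hak,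
    height_congr fun b hb => ?_⟩
  constructor
  · exact fun h => h.trans_le hp.2
  · intro h
    by_contra hn
    exact not_le.2 (WithTop.coe_lt_coe.1 h) (hmin b hb (not_lt.1 hn))

theorem height_eq_of_forall {c k : WithTop K} (hck : c ≤ k)
    (h : ¬ ∃ a ∈ S, c ≤ (a : WithTop K) ∧ (a : WithTop K) < k) :
    height S plus c = height S plus k := by
  push Not at h
  exact height_congr fun a ha => ⟨fun h' => h'.trans_le hck,
    fun h' => lt_of_not_ge fun h'' => absurd h' (not_lt.2 (h a ha h''))⟩

open Classical in
/-- The cut `e` right after the next letter to the right of `p`, or `k` if that comes first. -/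
theorem exists_next {p : K} (hp : p ∈ S) {k : WithTop K} (hk : (p : WithTop K) < k) :
    ∃ e : WithTop K, (p : WithTop K) < e ∧ e ≤ k ∧ (e = k ∨ ∃ a ∈ S, e = (a : WithTop K)) ∧
      ∀ q, (p : WithTop K) < q → q ≤ e →
        height S plus q = height S plus p + if plus p then 1 else -1 := by
  obtain ⟨e, hpe, hek, he, hno⟩ : ∃ e : WithTop K, (p : WithTop K) < e ∧ e ≤ k ∧
      (e = k ∨ ∃ a ∈ S, e = (a : WithTop K)) ∧ ∀ b ∈ S, p < b → ¬ (b : WithTop K) < e := by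
    by_cases h : ∃ a ∈ S, p < a ∧ (a : WithTop K) < k
    · obtain ⟨a, ha, hpa, hak⟩ := h
      obtain ⟨q, hq, hmin⟩ := (S.filter fun a : K => p < a).exists_min_image id
        ⟨a, by simp [ha, hpa]⟩
      simp only [Finset.mem_filter, id_eq, and_imp] at hq hmin
      refine ⟨q, WithTop.coe_lt_coe.2 hq.2,
        ((WithTop.coe_le_coe.2 (hmin a ha hpa)).trans_lt hak).le, Or.inr ⟨q, hq.1, rfl⟩, ?_⟩
      exact fun b hb hpb h => not_le.2 (WithTop.coe_lt_coe.1 h) (hmin b hb hpb)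
    · push Not at h
      exact ⟨k, hk, le_rfl, Or.inl rfl, fun b hb hpb => not_lt.2 (h b hb hpb)⟩
  refine ⟨e, hpe, hek, he, fun q hpq hqe => ?_⟩
  refine height_eq_add hp (lt_irrefl _) hpq fun b hb hbp => ?_
  rw [WithTop.coe_lt_coe]
  refine ⟨fun h => ?_, fun h => (WithTop.coe_lt_coe.2 h).trans hpq⟩
  by_contra hn
  exact hno b hb (lt_of_le_of_ne (not_lt.1 hn) hbp.symm) (h.trans_le hqe)

/-- Between a cut of height less than `v` and a later one of height at least `v`, there is a first
letter after which the height is `v`. -/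
theorem exists_first_passage {c : WithTop K} {v : ℤ} (hc : height S plus c < v) :
    ∀ k : WithTop K, c < k → v ≤ height S plus k →
    ∃ p ∈ S, c ≤ (p : WithTop K) ∧ (p : WithTop K) < k ∧ plus p ∧ height S plus p = v - 1 ∧
      ∀ q, c ≤ q → q ≤ (p : WithTop K) → height S plus q < v := by
  classical
  intro k
  induction hn : (S.filter fun a : K => (a : WithTop K) < k).card using Nat.strong_induction_on
    generalizing k with
  | _ n ih =>
  intro hck hk
  have hex : ∃ a ∈ S, c ≤ (a : WithTop K) ∧ (a : WithTop K) < k := by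
    by_contra h
    have := height_eq_of_forall (plus := plus) hck.le h
    omega
  obtain ⟨p, hp, hcp, hpk, hH⟩ := exists_prev (plus := plus) hex
  by_cases hq : ∃ q, c ≤ q ∧ q ≤ (p : WithTop K) ∧ v ≤ height S plus q
  · obtain ⟨q, hcq, hqp, hqv⟩ := hq
    have hcq' : c < q := lt_of_le_of_ne hcq (by rintro rfl; omega)
    obtain ⟨p', h1, h2, h3, h4⟩ := ih _ (by
      rw [← hn]
      exact card_filter_lt_card_filter hp
        (fun (a : K) _ h => h.trans_le (hqp.trans hpk.le)) (not_lt.2 hqp) hpk) q rfl hcq' hqv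
    exact ⟨p', h1, h2, h3.trans_le (hqp.trans hpk.le), h4⟩
  · push Not at hq
    have hpv := hq p hcp le_rfl
    by_cases hplus : plus p
    · rw [if_pos hplus] at hH
      exact ⟨p, hp, hcp, hpk, hplus, by omega, hq⟩
    · rw [if_neg hplus] at hH
      omega

/-- Between a cut of height greater than `v` and a later one of height at most `v`, there is a last
letter before which the height is `v + 1`. -/
theorem exists_last_passage {k : WithTop K} {v : ℤ} (hk : height S plus k ≤ v) :
    ∀ c : WithTop K, c < k → v < height S plus c →
    ∃ p ∈ S, c ≤ (p : WithTop K) ∧ (p : WithTop K) < k ∧ ¬ plus p ∧ height S plus p = v + 1 ∧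
      ∀ q, (p : WithTop K) < q → q ≤ k → height S plus q ≤ v := by
  classical
  intro c
  induction hn : (S.filter fun a : K => c ≤ (a : WithTop K)).card using Nat.strong_induction_on
    generalizing c with
  | _ n ih =>
  intro hck hc
  have hex : ∃ a ∈ S, c ≤ (a : WithTop K) ∧ (a : WithTop K) < k := by
    by_contra h
    have := height_eq_of_forall (plus := plus) hck.le h
    omega
  obtain ⟨p, hp, hcp, hpk, hH⟩ := exists_first (plus := plus) hex
  by_cases hq : ∃ q, (p : WithTop K) < q ∧ q ≤ k ∧ v < height S plus q
  · obtain ⟨q, hpq, hqk, hqv⟩ := hq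
    have hqk' : q < k := lt_of_le_of_ne hqk (by rintro rfl; omega)
    obtain ⟨p', h1, h2, h3, h4⟩ := ih _ (by
      rw [← hn]
      exact card_filter_lt_card_filter hp
        (fun (a : K) _ h => (hcp.trans hpq.le).trans h) (not_le.2 hpq) hcp) q rfl hqk' hqv
    exact ⟨p', h1, (hcp.trans hpq.le).trans h2, h3, h4⟩
  · push Not at hq
    obtain ⟨e, hpe, hek, -, hne⟩ := exists_next (plus := plus) hp hpk
    have he := hne e hpe le_rfl
    have := hq e hpe hek
    by_cases hplus : plus p
    · rw [if_pos hplus] at he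
      omega
    · rw [if_neg hplus] at he
      exact ⟨p, hp, hcp, hpk, hplus, by omega, hq⟩

/-- A letter `-` at `c` and a later letter `+` at `a`, such that the height in between is less than
it was before `c` and returns to that value after `a`. These are the pairs that are cancelled. -/
def Matched (S : Finset K) (plus : K → Prop) (c a : K) : Prop :=
  c ∈ S ∧ a ∈ S ∧ c < a ∧ ¬ plus c ∧ plus a ∧ height S plus a = height S plus c - 1 ∧
    ∀ q ∈ S, c < q → q ≤ a → height S plus q < height S plus c

theorem Matched.of_cancels {c a : K} (h : Cancels (S : Set K) plus c a) : Matched S plus c a := by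
  classical
  induction h with
  | @intro c a hc ha hca hminus hplus partner hmem _ _ ihm ihp =>
  rw [Finset.mem_coe] at hc ha
  have h1 : ∀ q ∈ S, c < q → q ≤ a → height S plus q < height S plus c := by
    intro q
    induction hn : (S.filter fun a : K => a < q).card using Nat.strong_induction_on
      generalizing q with
    | _ n ih =>
    intro hq hcq hqa
    obtain ⟨p, hp, hcp, hpq, hH⟩ := exists_prev (plus := plus) (c := c) (k := q)
      ⟨c, hc, le_rfl, WithTop.coe_lt_coe.2 hcq⟩
    rw [WithTop.coe_le_coe] at hcp
    rw [WithTop.coe_lt_coe] at hpq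
    rcases hcp.eq_or_lt with rfl | hcp
    · rw [hH, if_neg hminus]; omega
    have hlt : ∀ r ∈ S, r < q → c < r → height S plus r < height S plus c := fun r hr hrq hcr =>
      ih _ (by
        rw [← hn]
        exact card_filter_lt_card_filter hr (fun (a : K) _ h => h.trans hrq) (lt_irrefl _) hrq)
        r rfl hr
          hcr (hrq.le.trans hqa)
    by_cases hpp : plus p
    · obtain ⟨g1, -, g3, -, -, g6, -⟩ := ihp p hp hcp (hpq.trans_le hqa) hpp
      have := hlt _ g1 (g3.trans hpq) (hmem p hp hcp (hpq.trans_le hqa)).1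
      rw [hH, if_pos hpp]; omega
    · have := hlt p hp hpq hcp
      rw [hH, if_neg hpp]; omega
  have h2 : ∀ q ∈ S, c < q → q ≤ a → height S plus q ≤ height S plus a := by
    intro q
    induction hn : (S.filter fun a : K => q ≤ a).card using Nat.strong_induction_on
      generalizing q with
    | _ n ih =>
    intro hq hcq hqa
    rcases hqa.eq_or_lt with rfl | hqa
    · exact le_rfl
    have hgt : ∀ r : K, r ∈ S → q ≤ r → r < a → height S plus r +
        (if plus r then 1 else -1) ≤ height S plus a := by
      intro r hr hqr hra
      obtain ⟨e, hre, hea, he, hne⟩ := exists_next (plus := plus) hr (WithTop.coe_lt_coe.2 hra)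
      have hH := hne e hre le_rfl
      obtain ⟨e', he', rfl⟩ : ∃ e' ∈ S, e = (e' : WithTop K) := by
        rcases he with rfl | h
        · exact ⟨a, ha, rfl⟩
        · exact h
      rw [WithTop.coe_lt_coe] at hre
      rw [WithTop.coe_le_coe] at hea
      rw [← hH]
      exact ih _ (by
        rw [← hn]
        exact card_filter_lt_card_filter hq (fun (a : K) _ h => (hqr.trans hre.le).trans h)
          (not_le.2 (hqr.trans_lt hre)) le_rfl) e' rfl he' (hcq.trans (hqr.trans_lt hre)) hea
    by_cases hpq : plus q
    · have := hgt q hq le_rfl hqa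
      rw [if_pos hpq] at this
      omega
    · obtain ⟨-, g2, g3, -, g5, g6, -⟩ := ihm q hq hcq hqa hpq
      have := hgt _ g2 g3.le (hmem q hq hcq hqa).2
      rw [if_pos g5] at this
      omega
  refine ⟨hc, ha, hca, hminus, hplus, ?_, h1⟩
  have h3 := h1 a ha hca le_rfl
  obtain ⟨e, hce, hea, he, hne⟩ := exists_next (plus := plus) hc (WithTop.coe_lt_coe.2 hca)
  have hH := hne e hce le_rfl
  obtain ⟨e', he', rfl⟩ : ∃ e' ∈ S, e = (e' : WithTop K) := by
    rcases he with rfl | h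
    · exact ⟨a, ha, rfl⟩
    · exact h
  have h4 := h2 e' he' (WithTop.coe_lt_coe.1 hce) (WithTop.coe_le_coe.1 hea)
  rw [hH, if_neg hminus] at h4
  omega

theorem exists_matched_right {c : K} {k : WithTop K} (hc : c ∈ S) (hm : ¬ plus c)
    (hck : (c : WithTop K) < k) (hk : height S plus c ≤ height S plus k) :
    ∃ a, Matched S plus c a ∧ (a : WithTop K) < k := by
  obtain ⟨e, hce, hek, -, he⟩ := exists_next (plus := plus) hc hck
  rw [if_neg hm] at he
  have hee := he e hce le_rfl
  obtain ⟨a, ha, hea, hak, hap, hav, hall⟩ := exists_first_passage (S := S) (plus := plus)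
    (c := e) (v := height S plus c)
    (by omega) k (lt_of_le_of_ne hek (by rintro rfl; omega)) hk
  refine ⟨a, ⟨hc, ha, WithTop.coe_lt_coe.1 (hce.trans_le hea), hm, hap, hav,
    fun q hq hcq hqa => ?_⟩, hak⟩
  rcases le_total e (q : WithTop K) with h | h
  · exact hall q h (WithTop.coe_le_coe.2 hqa)
  · have := he q (WithTop.coe_lt_coe.2 hcq) h
    omega

theorem exists_matched_left {a : K} {c : WithTop K} (ha : a ∈ S) (hp : plus a)
    (hca : c < (a : WithTop K)) (hc : height S plus a < height S plus c) :
    ∃ b, Matched S plus b a ∧ c ≤ (b : WithTop K) := by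
  obtain ⟨b, hb, hcb, hba, hbm, hbv, hall⟩ := exists_last_passage le_rfl c hca hc
  refine ⟨b, ⟨hb, ha, WithTop.coe_lt_coe.1 hba, hbm, hp, by omega, fun q _ hbq hqa => ?_⟩, hcb⟩
  have := hall q (WithTop.coe_lt_coe.2 hbq) (WithTop.coe_le_coe.2 hqa)
  omega

theorem Matched.cancels {c a : K} (h : Matched S plus c a) : Cancels (S : Set K) plus c a := by
  classical
  induction hn : (S.filter fun d : K => c ≤ d ∧ d ≤ a).card using Nat.strong_induction_on
    generalizing c a with
  | _ n ih =>
  obtain ⟨hc, ha, hca, hm, hp, hH, hall⟩ := h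
  have hex : ∀ d : K, ∃ e, d ∈ S → c < d → d < a → c < e ∧ e < a ∧
      (¬ plus d → Matched S plus d e) ∧ (plus d → Matched S plus e d) := by
    intro d
    by_cases hd : d ∈ S ∧ c < d ∧ d < a
    · obtain ⟨hd, hcd, hda⟩ := hd
      have hlt := hall d hd hcd hda.le
      by_cases hpd : plus d
      · obtain ⟨e, hde, -, -, hH'⟩ := exists_next (plus := plus) hd (WithTop.coe_lt_coe.2 hda)
        obtain ⟨e, hde, hea, he, hH'⟩ := exists_next (plus := plus) hd (WithTop.coe_lt_coe.2 hda)
        obtain ⟨e', he', rfl⟩ : ∃ e' ∈ S, e = (e' : WithTop K) := by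
          rcases he with rfl | h
          · exact ⟨a, ha, rfl⟩
          · exact h
        have h1 := hH' e' hde le_rfl
        have h2 := hall e' he' (hcd.trans (WithTop.coe_lt_coe.1 hde)) (WithTop.coe_le_coe.1 hea)
        rw [if_pos hpd] at h1
        obtain ⟨b, hb, hcb⟩ := exists_matched_left (plus := plus) (c := c) hd hpd
          (WithTop.coe_lt_coe.2 hcd) hlt
        refine ⟨b, fun _ _ _ => ⟨lt_of_le_of_ne (WithTop.coe_le_coe.1 hcb) ?_,
          hb.2.2.1.trans hda, fun h => absurd hpd h, fun _ => hb⟩⟩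
        rintro rfl
        have := hb.2.2.2.2.2.1
        omega
      · obtain ⟨b, hb, hba⟩ := exists_matched_right (plus := plus) (k := a) hd hpd
          (WithTop.coe_lt_coe.2 hda) (by omega)
        exact ⟨b, fun _ _ _ => ⟨hcd.trans hb.2.2.1, WithTop.coe_lt_coe.1 hba, fun _ => hb,
          fun h => absurd h hpd⟩⟩
    · exact ⟨d, fun h1 h2 h3 => absurd ⟨h1, h2, h3⟩ hd⟩
  choose partner hpartner using hex
  refine Cancels.intro (Finset.mem_coe.2 hc) (Finset.mem_coe.2 ha) hca hm hp partner
    (fun d hd hcd hda => ?_) (fun d hd hcd hda hpd => ?_) (fun d hd hcd hda hpd => ?_)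
  · exact ⟨(hpartner d hd hcd hda).1, (hpartner d hd hcd hda).2.1⟩
  · obtain ⟨h1, h2, h3, -⟩ := hpartner d hd hcd hda
    refine ih _ ?_ (h3 hpd) rfl
    rw [← hn]
    exact card_filter_lt_card_filter hc (fun x _ hx => ⟨hcd.le.trans hx.1, hx.2.trans h2.le⟩)
      (fun h => not_le.2 hcd h.1) ⟨le_rfl, hca.le⟩
  · obtain ⟨h1, h2, -, h3⟩ := hpartner d hd hcd hda
    refine ih _ ?_ (h3 hpd) rfl
    rw [← hn]
    exact card_filter_lt_card_filter hc (fun x _ hx => ⟨h1.le.trans hx.1, hx.2.trans hda.le⟩)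
      (fun h => not_le.2 h1 h.1) ⟨le_rfl, hca.le⟩

/-- The letters `+` that survive the cancellation. -/
def freePlus (S : Set K) (plus : K → Prop) : Set K :=
  {a | a ∈ S ∧ plus a ∧ ∀ c, ¬ Cancels S plus c a}

/-- The letters `-` that survive the cancellation. -/
def freeMinus (S : Set K) (plus : K → Prop) : Set K :=
  {c | c ∈ S ∧ ¬ plus c ∧ ∀ a, ¬ Cancels S plus c a}

/-- The surviving letters `+` are those after which the height is greater than at any earlier
cut. -/
theorem mem_freePlus_iff {a : K} (ha : a ∈ S) : a ∈ freePlus (S : Set K) plus ↔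
    plus a ∧ ∀ k, k ≤ (a : WithTop K) → height S plus k ≤ height S plus a := by
  refine (and_iff_right (Finset.mem_coe.2 ha)).trans (and_congr_right fun hp => ⟨?_, ?_⟩)
  · intro h k hk
    by_contra hlt
    obtain ⟨b, hb, -⟩ := exists_matched_left (c := k) ha hp
      (lt_of_le_of_ne hk (by rintro rfl; exact hlt le_rfl)) (not_le.1 hlt)
    exact h b hb.cancels
  · intro h c hc
    obtain ⟨-, -, h3, -, -, h6, -⟩ := Matched.of_cancels hc
    have := h c (WithTop.coe_le_coe.2 h3.le)
    omega

/-- The surviving letters `-` are those before which the height is greater than at any later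
cut. -/
theorem mem_freeMinus_iff {c : K} (hc : c ∈ S) : c ∈ freeMinus (S : Set K) plus ↔
    ¬ plus c ∧ ∀ k, (c : WithTop K) < k → height S plus k < height S plus c := by
  refine (and_iff_right (Finset.mem_coe.2 hc)).trans (and_congr_right fun hp => ⟨?_, ?_⟩)
  · intro h k hk
    by_contra hlt
    obtain ⟨b, hb, -⟩ := exists_matched_right hc hp hk (not_lt.1 hlt)
    exact h b hb.cancels
  · intro h a ha
    obtain ⟨g1, g2, h3, -, g5, h6, -⟩ := Matched.of_cancels ha
    obtain ⟨e, hae, -, -, he⟩ := exists_next (plus := plus) g2 (WithTop.coe_lt_top a)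
    have h7 := he e hae le_rfl
    rw [if_pos g5] at h7
    have := h e ((WithTop.coe_lt_coe.2 h3).trans hae)
    omega

/-- The rightmost surviving `+` is the letter before the first maximum of the height. -/
theorem isGreatest_freePlus_iff {a : K} : IsGreatest (freePlus (S : Set K) plus) a ↔
    a ∈ S ∧ plus a ∧ (∀ k, k ≤ (a : WithTop K) → height S plus k ≤ height S plus a) ∧
      ∀ k, height S plus k ≤ height S plus a + 1 := by
  constructor
  · rintro ⟨h1, h2⟩
    have ha : a ∈ S := Finset.mem_coe.1 h1.1
    have h3 := (mem_freePlus_iff ha).1 h1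
    refine ⟨ha, h3.1, h3.2, fun k => ?_⟩
    by_contra hlt
    have hak : (a : WithTop K) < k := by
      by_contra hn
      have := h3.2 k (not_lt.1 hn)
      omega
    obtain ⟨e, hae, hek, -, he⟩ := exists_next (plus := plus) ha hak
    have h7 := he e hae le_rfl
    rw [if_pos h3.1] at h7
    obtain ⟨p, hp, hep, -, hpp, hpv, hall⟩ := exists_first_passage (S := S) (plus := plus) (c := e)
      (v := height S plus a + 2) (by omega) k (lt_of_le_of_ne hek (by rintro rfl; omega))
      (by omega)
    have hap : (a : WithTop K) < p := hae.trans_le hep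
    refine not_lt.2 (h2 ((mem_freePlus_iff hp).2 ⟨hpp, fun q hq => ?_⟩)) (WithTop.coe_lt_coe.1 hap)
    rcases le_total e q with h | h
    · have := hall q h hq
      omega
    · rcases le_or_gt q (a : WithTop K) with h' | h'
      · have := h3.2 q h'
        omega
      · have := he q h' h
        rw [if_pos h3.1] at this
        omega
  · rintro ⟨ha, hp, h1, h2⟩
    refine ⟨(mem_freePlus_iff ha).2 ⟨hp, h1⟩, fun b hb => ?_⟩
    have hb' : b ∈ S := Finset.mem_coe.1 hb.1
    rw [mem_freePlus_iff hb'] at hb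
    by_contra hlt
    obtain ⟨e, hae, heb, -, he⟩ := exists_next (plus := plus) ha
      (WithTop.coe_lt_coe.2 (not_le.1 hlt))
    have h3 := he e hae le_rfl
    rw [if_pos hp] at h3
    have h4 := hb.2 e heb
    obtain ⟨e', hbe', -, -, he'⟩ := exists_next (plus := plus) hb' (WithTop.coe_lt_top b)
    have h5 := he' e' hbe' le_rfl
    rw [if_pos hb.1] at h5
    have := h2 e'
    omega

/-- The leftmost surviving `-` is the letter after the last maximum of the height. -/
theorem isLeast_freeMinus_iff {c : K} : IsLeast (freeMinus (S : Set K) plus) c ↔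
    c ∈ S ∧ ¬ plus c ∧ (∀ k, height S plus k ≤ height S plus c) ∧
      ∀ k, (c : WithTop K) < k → height S plus k < height S plus c := by
  constructor
  · rintro ⟨h1, h2⟩
    have hc : c ∈ S := Finset.mem_coe.1 h1.1
    have h3 := (mem_freeMinus_iff hc).1 h1
    refine ⟨hc, h3.1, fun k => ?_, h3.2⟩
    by_contra hlt
    have hkc : k < (c : WithTop K) := by
      by_contra hn
      rcases (not_lt.1 hn).eq_or_lt with rfl | h
      · exact hlt le_rfl
      · have := h3.2 k h
        omega
    obtain ⟨p, hp, hkp, hpc, hpm, hpv, hall⟩ := exists_last_passage (S := S)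
      (plus := plus) (k := (c : WithTop K)) le_rfl
      k hkc (not_le.1 hlt)
    refine not_lt.2 (h2 ((mem_freeMinus_iff hp).2 ⟨hpm, fun q hq => ?_⟩))
      (WithTop.coe_lt_coe.1 hpc)
    rcases le_or_gt q (c : WithTop K) with h | h
    · have := hall q hq h
      omega
    · have := h3.2 q h
      omega
  · rintro ⟨hc, hm, h1, h2⟩
    refine ⟨(mem_freeMinus_iff hc).2 ⟨hm, h2⟩, fun b hb => ?_⟩
    have hb' : b ∈ S := Finset.mem_coe.1 hb.1
    rw [mem_freeMinus_iff hb'] at hb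
    by_contra hlt
    have := hb.2 c (WithTop.coe_lt_coe.2 (not_le.1 hlt))
    have := h1 b
    omega

theorem exists_height_max (S : Finset K) (plus : K → Prop) :
    ∃ M, (∀ k, height S plus k ≤ M) ∧ ∃ k, height S plus k = M := by
  have hfin : (Set.range (height S plus)).Finite := by
    classical
    refine (S.powerset.finite_toSet.image
      fun T => ∑ a ∈ T, if plus a then (1 : ℤ) else -1).subset ?_
    rintro _ ⟨k, rfl⟩
    refine ⟨S.filter fun a : K => (a : WithTop K) < k,
      Finset.mem_coe.2 (Finset.mem_powerset.2 (Finset.filter_subset _ _)), ?_⟩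
    unfold height
    congr
  obtain ⟨M, ⟨k, rfl⟩, hM⟩ := hfin.exists_maximal ⟨_, ⊤, rfl⟩
  exact ⟨_, fun k' => by
    by_contra h
    exact h (hM ⟨k', rfl⟩ (not_le.1 h).le), k, rfl⟩

theorem exists_isGreatest_freePlus {k : WithTop K} (hk : 0 < height S plus k) :
    ∃ a, IsGreatest (freePlus (S : Set K) plus) a := by
  obtain ⟨M, hM, k', rfl⟩ := exists_height_max S plus
  have h0 := hM k
  obtain ⟨b, hb, hbk⟩ : ∃ b ∈ S, (b : WithTop K) < k' := by
    by_contra h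
    push Not at h
    have := height_eq_zero (plus := plus) fun a ha => not_lt.2 (h a ha)
    omega
  obtain ⟨c, hc, hmin⟩ := S.exists_min_image id ⟨b, hb⟩
  have hc0 : ∀ q, q ≤ (c : WithTop K) → height S plus q = 0 := fun q hq =>
    height_eq_zero fun a ha h => not_le.2 (WithTop.coe_lt_coe.1 (h.trans_le hq)) (hmin a ha)
  obtain ⟨p, hp, hcp, hpk, hpp, hpv, hall⟩ := exists_first_passage (S := S) (plus := plus) (c := c)
    (v := height S plus k') (by rw [hc0 _ le_rfl]; omega) k'
    ((WithTop.coe_le_coe.2 (hmin b hb)).trans_lt hbk) le_rfl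
  refine ⟨p, isGreatest_freePlus_iff.2 ⟨hp, hpp, fun q hq => ?_, fun q => ?_⟩⟩
  · rcases le_total q (c : WithTop K) with h | h
    · rw [hc0 q h]; omega
    · have := hall q h hq
      omega
  · have := hM q
    omega

theorem exists_isLeast_freeMinus {k : WithTop K} (hk : height S plus ⊤ < height S plus k) :
    ∃ a, IsLeast (freeMinus (S : Set K) plus) a := by
  obtain ⟨M, hM, k', rfl⟩ := exists_height_max S plus
  have h0 := hM k
  have hk' : k' < ⊤ := lt_top_iff_ne_top.2 (by rintro rfl; omega)
  obtain ⟨p, hp, hkp, -, hpm, hpv, hall⟩ := exists_last_passage (S := S) (plus := plus)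
    (v := height S plus k' - 1)
    (by omega) k' hk' (by omega)
  refine ⟨p, isLeast_freeMinus_iff.2 ⟨hp, hpm, fun q => ?_, fun q hq => ?_⟩⟩
  · have := hM q
    omega
  · have := hall q hq le_top
    omega

end SignWord

/-! ### Folded chains -/

theorem Finset.sort_insert_max {K : Type v} [LinearOrder K] {s : Finset K} {a : K}
    (h : ∀ b ∈ s, b < a) : (insert a s).sort = s.sort ++ [a] := by
  have ha : a ∉ s := fun h' => lt_irrefl _ (h a h')
  refine List.Perm.eq_of_pairwise' (r := (· ≤ ·)) (Finset.pairwise_sort _ _) ?_ ?_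
  · rw [List.pairwise_append]
    refine ⟨Finset.pairwise_sort _ _, List.pairwise_singleton _ _, fun x hx y hy => ?_⟩
    rw [List.mem_singleton] at hy
    rw [hy]
    exact (h x ((Finset.mem_sort _).1 hx)).le
  · refine (List.perm_ext_iff_of_nodup (Finset.sort_nodup _ _) ?_).2 fun x => ?_
    · rw [List.nodup_append]
      refine ⟨Finset.sort_nodup _ _, List.nodup_singleton _, fun x hx y hy => ?_⟩
      rw [List.mem_singleton] at hy
      rw [hy]
      exact (h x ((Finset.mem_sort _).1 hx)).ne
    · simp [or_comm]

/-- Adds `m` to `J`; the value `m = ⊤` stands for adding nothing. -/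
def insertTop {K : Type v} [DecidableEq K] (m : WithTop K) (J : Finset K) : Finset K :=
  WithTop.recTopCoe (C := fun _ => Finset K) J (fun b => insert b J) m

@[simp] theorem insertTop_top {K : Type v} [DecidableEq K] (J : Finset K) :
    insertTop ⊤ J = J := rfl

@[simp] theorem insertTop_coe {K : Type v} [DecidableEq K] (b : K) (J : Finset K) :
    insertTop (b : WithTop K) J = insert b J := rfl

theorem mem_insertTop {K : Type v} [DecidableEq K] {m : WithTop K} {J : Finset K} {x : K} :
    x ∈ insertTop m J ↔ (x : WithTop K) = m ∨ x ∈ J := by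
  induction m using WithTop.recTopCoe with
  | top => simp
  | coe b => simp

namespace RootChain

variable {I : Type u} [DecidableEq I] {A : Matrix I I ℤ} {P : Type v} [AddCommGroup P]
  {D : CartanDatum A P} (Γ : RootChain D)

@[simp] theorem tau_empty : Γ.tau ∅ = 1 := by simp [tau]

theorem tau_insert_max {J : Finset Γ.Idx} {j : Γ.Idx} (h : ∀ b ∈ J, b < j) :
    Γ.tau (insert j J) = Γ.tau J * (Γ.root j).reflection := by
  simp [tau, Finset.sort_insert_max h]

/-- The composition `r̂_{j_1} ⋯ r̂_{j_p}` of the affine reflections at the positions in `J`. -/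
noncomputable def tauHat (J : Finset Γ.Idx) (y : P) : P :=
  J.sort.foldr (fun j y => (Γ.root j).affineReflection (-Γ.level j) y) y

theorem weight_eq (x : P) (J : Finset Γ.Idx) : Γ.weight x J = -Γ.tauHat J (-x) := rfl

@[simp] theorem tauHat_empty (y : P) : Γ.tauHat ∅ y = y := by simp [tauHat]

theorem tauHat_insert_max {J : Finset Γ.Idx} {j : Γ.Idx} (h : ∀ b ∈ J, b < j) (y : P) :
    Γ.tauHat (insert j J) y = Γ.tauHat J ((Γ.root j).affineReflection (-Γ.level j) y) := by
  simp [tauHat, Finset.sort_insert_max h]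

theorem tauHat_eq (J : Finset Γ.Idx) (y : P) : Γ.tauHat J y = Γ.tau J y + Γ.tauHat J 0 := by
  induction J using Finset.induction_on_max generalizing y with
  | empty => simp
  | insert j J h ih =>
    rw [tauHat_insert_max _ h, tauHat_insert_max _ h, tau_insert_max _ h, ih,
      ih (CartanDatum.PosRoot.affineReflection _ _ 0)]
    simp only [CartanDatum.PosRoot.affineReflection, LinearEquiv.mul_apply,
      CartanDatum.PosRoot.reflection_apply, map_sub, map_smul, map_zero]
    module

/-- The product `r_{j_1} ⋯ r_{j_t}` over the positions in `J` to the left of the cut `k`. -/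
noncomputable def cutProd (J : Finset Γ.Idx) (k : WithTop Γ.Idx) : P ≃ₗ[ℤ] P :=
  Γ.tau (J.filter fun j : Γ.Idx => (j : WithTop Γ.Idx) < k)

theorem cutProd_coe (J : Finset Γ.Idx) (k : Γ.Idx) : Γ.cutProd J k = Γ.prefixProd J k := by
  simp only [cutProd, WithTop.coe_lt_coe]
  rfl

theorem cutProd_top (J : Finset Γ.Idx) : Γ.cutProd J ⊤ = Γ.tau J := by
  simp [cutProd, WithTop.coe_lt_top]

theorem gam_eq (J : Finset Γ.Idx) (k : Γ.Idx) : Γ.gam J k = Γ.cutProd J k (Γ.root k).root := by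
  rw [cutProd_coe]; rfl

theorem cutProd_congr {J J' : Finset Γ.Idx} {k k' : WithTop Γ.Idx}
    (h : ∀ j, (j ∈ J ∧ (j : WithTop Γ.Idx) < k) ↔ (j ∈ J' ∧ (j : WithTop Γ.Idx) < k')) :
    Γ.cutProd J k = Γ.cutProd J' k' := by
  unfold cutProd
  congr 1
  ext j
  simpa using h j

theorem gam_congr {J J' : Finset Γ.Idx} {k : Γ.Idx} (h : ∀ j, j < k → (j ∈ J ↔ j ∈ J')) :
    Γ.gam J k = Γ.gam J' k := by
  rw [gam_eq, gam_eq, Γ.cutProd_congr (J' := J') (k' := k) fun j => ?_]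
  rw [WithTop.coe_lt_coe]
  exact and_congr_left fun hj => h j hj

theorem cutProd_insert_of_not_lt (J : Finset Γ.Idx) {a : Γ.Idx} {k : WithTop Γ.Idx}
    (hk : ¬ (a : WithTop Γ.Idx) < k) : Γ.cutProd (insert a J) k = Γ.cutProd J k := by
  unfold cutProd
  rw [Finset.filter_insert, if_neg hk]

theorem gam_insert_of_le (J : Finset Γ.Idx) {a k : Γ.Idx} (hk : k ≤ a) :
    Γ.gam (insert a J) k = Γ.gam J k := by
  rw [gam_eq, gam_eq, Γ.cutProd_insert_of_not_lt J (not_lt.2 (WithTop.coe_le_coe.2 hk))]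

theorem simpleReflection_eq_iff (i : I) (x : P) :
    (D.simpleReflection i x = D.simpleRoot i ∨ D.simpleReflection i x = -D.simpleRoot i) ↔
      (x = D.simpleRoot i ∨ x = -D.simpleRoot i) := by
  constructor
  · rintro (h | h) <;> have := congrArg (D.simpleReflection i) h <;>
      simp only [CartanDatum.simpleReflection_apply_apply, map_neg,
        CartanDatum.simpleReflection_simpleRoot, neg_neg] at this <;> simp [this]
  · rintro (rfl | rfl) <;> simp [CartanDatum.simpleReflection_simpleRoot]

variable [Fintype I]

theorem tau_mem (J : Finset Γ.Idx) : Γ.tau J ∈ D.weylGroup := by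
  induction J using Finset.induction_on_max with
  | empty => simp
  | insert j J h ih =>
    rw [tau_insert_max _ h]
    exact mul_mem ih (CartanDatum.PosRoot.reflection_mem _)

theorem cutProd_mem (J : Finset Γ.Idx) (k : WithTop Γ.Idx) : Γ.cutProd J k ∈ D.weylGroup :=
  Γ.tau_mem _

theorem mul_reflection_of_apply_eq {g : P ≃ₗ[ℤ] P} (hg : g ∈ D.weylGroup) {b : D.PosRoot} {i : I}
    (h : g b.root = D.simpleRoot i) : g * b.reflection = D.simpleReflection i * g := by
  ext x
  rw [LinearEquiv.mul_apply, LinearEquiv.mul_apply, CartanDatum.PosRoot.reflection_apply,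
    CartanDatum.simpleReflection_apply,
    b.isReal.apply_reflection (CartanDatum.IsRealRoot.simple i) hg h]

theorem simpleCoroot_apply_of_apply_eq {g : P ≃ₗ[ℤ] P} (hg : g ∈ D.weylGroup) {b : D.PosRoot}
    {i : I} (h : g b.root = D.simpleRoot i) (x : P) : D.simpleCoroot i (g x) = b.coroot x := by
  have h1 := b.isReal.apply hg
  rw [h] at h1
  rw [(CartanDatum.IsRealRoot.simple i).coroot_unique h1]
  simp

theorem simpleCoroot_apply_of_apply_eq_neg {g : P ≃ₗ[ℤ] P} (hg : g ∈ D.weylGroup)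
    {b : D.PosRoot} {i : I} (h : g b.root = -D.simpleRoot i) (x : P) :
    D.simpleCoroot i (g x) = -b.coroot x := by
  have h1 := (b.isReal.apply hg).neg
  rw [h, neg_neg] at h1
  rw [(CartanDatum.IsRealRoot.simple i).coroot_unique h1]
  simp

theorem mul_reflection_of_apply_eq_neg {g : P ≃ₗ[ℤ] P} (hg : g ∈ D.weylGroup) {b : D.PosRoot}
    {i : I} (h : g b.root = -D.simpleRoot i) :
    g * b.reflection = D.simpleReflection i * g := by
  ext x
  rw [LinearEquiv.mul_apply, LinearEquiv.mul_apply, CartanDatum.PosRoot.reflection_apply,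
    CartanDatum.simpleReflection_apply, simpleCoroot_apply_of_apply_eq_neg hg h, map_sub, map_smul,
    h]
  module

/-- Folding at one more position `a` with `γ_a = ± α_i` multiplies the product by `s_i` from the
left. -/
theorem tau_insert {J : Finset Γ.Idx} {a : Γ.Idx} {i : I} (ha : a ∉ J)
    (h : a ∈ Γ.rootSet J i) : Γ.tau (insert a J) = D.simpleReflection i * Γ.tau J := by
  induction J using Finset.induction_on_max with
  | empty =>
    rw [Γ.tau_insert_max (by simp)]
    rcases h with h | h <;> rw [gam_eq, cutProd, Finset.filter_empty] at h
    · exact mul_reflection_of_apply_eq (Γ.tau_mem _) h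
    · exact mul_reflection_of_apply_eq_neg (Γ.tau_mem _) h
  | insert j J hj ih =>
    rcases lt_trichotomy a j with haj | rfl | hja
    · have hb : ∀ b ∈ insert a J, b < j := by
        simp only [Finset.mem_insert, forall_eq_or_imp]
        exact ⟨haj, hj⟩
      rw [Finset.insert_comm, Γ.tau_insert_max hb, Γ.tau_insert_max hj, ih (fun h' => ha (by
        simp [h'])), mul_assoc]
      unfold rootSet at h ⊢
      rwa [Set.mem_ofPred, Γ.gam_congr (J' := J) fun x hx => by simp [(hx.trans haj).ne]] at h
    · simp at ha
    · have hb : ∀ b ∈ insert j J, b < a := by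
        simp only [Finset.mem_insert, forall_eq_or_imp]
        exact ⟨hja, fun b hb => (hj b hb).trans hja⟩
      rw [Γ.tau_insert_max hb]
      have hf : (insert j J).filter (fun x : Γ.Idx => (x : WithTop Γ.Idx) < a) = insert j J :=
        Finset.filter_true_of_mem fun b hb' => WithTop.coe_lt_coe.2 (hb b hb')
      rcases h with h | h <;> rw [gam_eq, cutProd, hf] at h
      · exact mul_reflection_of_apply_eq (Γ.tau_mem _) h
      · exact mul_reflection_of_apply_eq_neg (Γ.tau_mem _) h

/-- Folding at one more position `a` with `γ_a = α_i` composes `r̂_{j_1} ⋯ r̂_{j_p}` with an affine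
reflection in `α_i`. -/
theorem tauHat_insert {J : Finset Γ.Idx} {a : Γ.Idx} {i : I} (ha : a ∉ J)
    (h : Γ.gam J a = D.simpleRoot i) (y : P) : Γ.tauHat (insert a J) y = Γ.tauHat J y -
      (D.simpleCoroot i (Γ.tauHat J y) - (D.simpleCoroot i (Γ.tauHat (J.filter (· < a)) 0)
        - Γ.level a)) • D.simpleRoot i := by
  have hmax : ∀ K : Finset Γ.Idx, (∀ b ∈ K, b < a) → Γ.gam K a = D.simpleRoot i → ∀ y,
      Γ.tauHat (insert a K) y = Γ.tauHat K y -
        (D.simpleCoroot i (Γ.tauHat K y) - (D.simpleCoroot i (Γ.tauHat (K.filter (· < a)) 0)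
          - Γ.level a)) • D.simpleRoot i := by
    intro K hb h y
    have hf : K.filter (· < a) = K := Finset.filter_true_of_mem hb
    have hf' : K.filter (fun x : Γ.Idx => (x : WithTop Γ.Idx) < a) = K :=
      Finset.filter_true_of_mem fun b hb' => WithTop.coe_lt_coe.2 (hb b hb')
    rw [gam_eq, cutProd, hf'] at h
    rw [Γ.tauHat_insert_max hb, hf, tauHat_eq, Γ.tauHat_eq K y, map_add,
      simpleCoroot_apply_of_apply_eq (Γ.tau_mem _) h]
    simp only [CartanDatum.PosRoot.affineReflection, map_sub, map_smul, h]
    module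
  induction J using Finset.induction_on_max generalizing y with
  | empty => exact hmax _ (by simp) h y
  | insert j J hj ih =>
    rcases lt_trichotomy a j with haj | rfl | hja
    · have hb : ∀ b ∈ insert a J, b < j := by
        simp only [Finset.mem_insert, forall_eq_or_imp]
        exact ⟨haj, hj⟩
      have hf : (insert j J).filter (· < a) = J.filter (· < a) := by
        rw [Finset.filter_insert, if_neg (not_lt.2 haj.le)]
      rw [Finset.insert_comm, Γ.tauHat_insert_max hb, Γ.tauHat_insert_max hj, hf]
      refine ih (fun h' => ha (by simp [h'])) ?_ _
      rwa [Γ.gam_congr (J' := J) fun x hx => by simp [(hx.trans haj).ne]] at h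
    · simp at ha
    · refine hmax _ ?_ h y
      simp only [Finset.mem_insert, forall_eq_or_imp]
      exact ⟨hja, fun b hb => (hj b hb).trans hja⟩

theorem cutProd_insert {J : Finset Γ.Idx} {a : Γ.Idx} {i : I} (ha : a ∉ J)
    (h : a ∈ Γ.rootSet J i) {k : WithTop Γ.Idx} (hk : (a : WithTop Γ.Idx) < k) :
    Γ.cutProd (insert a J) k = D.simpleReflection i * Γ.cutProd J k := by
  unfold cutProd
  rw [Finset.filter_insert, if_pos hk]
  refine Γ.tau_insert (fun h' => ha (Finset.mem_of_mem_filter _ h')) ?_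
  unfold rootSet at h ⊢
  rwa [Set.mem_ofPred, Γ.gam_congr (J' := J) fun x hx => ?_]
  simp [(WithTop.coe_lt_coe.2 hx).trans hk]

theorem gam_insert {J : Finset Γ.Idx} {a : Γ.Idx} {i : I} (ha : a ∉ J)
    (h : a ∈ Γ.rootSet J i) {k : Γ.Idx} (hk : a < k) :
    Γ.gam (insert a J) k = D.simpleReflection i (Γ.gam J k) := by
  rw [gam_eq, gam_eq, Γ.cutProd_insert ha h (WithTop.coe_lt_coe.2 hk), LinearEquiv.mul_apply]

theorem rootSet_insert {J : Finset Γ.Idx} {a : Γ.Idx} {i : I} (ha : a ∉ J)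
    (h : a ∈ Γ.rootSet J i) : Γ.rootSet (insert a J) i = Γ.rootSet J i := by
  ext k
  unfold rootSet
  rw [Set.mem_ofPred, Set.mem_ofPred]
  rcases lt_or_ge a k with hk | hk
  · rw [Γ.gam_insert ha h hk, simpleReflection_eq_iff]
  · rw [Γ.gam_insert_of_le J hk]

/-! ### Admissible sets and the sign of a folded chain -/

/-- The sign of the folded chain at the cut `k`: positive if `s_i` is not a left descent of
`r_{j_1} ⋯ r_{j_t}`, negative if it is. -/
noncomputable def cutSign (J : Finset Γ.Idx) (i : I) (k : WithTop Γ.Idx) : ℤ :=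
  D.simpleCoroot i (Γ.cutProd J k D.rho)

theorem cutSign_ne_zero (J : Finset Γ.Idx) (i : I) (k : WithTop Γ.Idx) : Γ.cutSign J i k ≠ 0 :=
  CartanDatum.simpleCoroot_apply_rho_ne_zero (Γ.cutProd_mem J k) i

theorem cutSign_pos_of_gam {J : Finset Γ.Idx} {i : I} {k : Γ.Idx}
    (h : Γ.gam J k = D.simpleRoot i) : 0 < Γ.cutSign J i k := by
  rw [gam_eq] at h
  rw [cutSign, simpleCoroot_apply_of_apply_eq (Γ.cutProd_mem J k) h]
  exact CartanDatum.PosRoot.coroot_rho_pos _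

theorem cutSign_neg_of_gam {J : Finset Γ.Idx} {i : I} {k : Γ.Idx}
    (h : Γ.gam J k = -D.simpleRoot i) : Γ.cutSign J i k < 0 := by
  rw [gam_eq] at h
  rw [cutSign, simpleCoroot_apply_of_apply_eq_neg (Γ.cutProd_mem J k) h]
  exact neg_neg_of_pos (CartanDatum.PosRoot.coroot_rho_pos _)

theorem gam_eq_iff_cutSign_pos {J : Finset Γ.Idx} {i : I} {k : Γ.Idx} (hk : k ∈ Γ.rootSet J i) :
    Γ.gam J k = D.simpleRoot i ↔ 0 < Γ.cutSign J i k := by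
  refine ⟨Γ.cutSign_pos_of_gam, fun h => hk.resolve_right fun h' => ?_⟩
  exact lt_asymm h (Γ.cutSign_neg_of_gam h')

/-- At a folding position in `I_{α_i}` one has `γ = α_i`, because covers go up. -/
theorem gam_eq_of_mem {J : Finset Γ.Idx} (hJ : Γ.Admissible J) {i : I} {j : Γ.Idx} (hj : j ∈ J)
    (hr : j ∈ Γ.rootSet J i) : Γ.gam J j = D.simpleRoot i := by
  refine hr.resolve_right fun h => ?_
  have h1 := (hJ j hj).coroot_inv_rho_pos
  rw [← cutProd_coe] at h1
  rw [gam_eq] at h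
  have h2 := simpleCoroot_apply_of_apply_eq_neg (Γ.cutProd_mem J j) h
    ((Γ.cutProd J j)⁻¹ D.rho)
  rw [← LinearEquiv.mul_apply, mul_inv_cancel, LinearEquiv.coe_one, id_eq,
    CartanDatum.simpleCoroot_rho] at h2
  omega

/-- Along an admissible folded chain the sign can drop from `+` to `-` only at a folding position
in `I_{α_i}`. This is the lifting property of the Bruhat order. Here `B` is an initial
segment of `J`. -/
theorem cutSign_pos_of_tau_pos {J : Finset Γ.Idx} (hJ : Γ.Admissible J) {i : I}
    {B : Finset Γ.Idx} (hB : ∀ x ∈ B, ∀ y ∈ J, y ∉ B → x < y)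
    (h : 0 < D.simpleCoroot i (Γ.tau B D.rho)) (k : WithTop Γ.Idx)
    (hBk : ∀ x ∈ B, x ∈ J ∧ (x : WithTop Γ.Idx) < k)
    (hno : ∀ y ∈ J, y ∉ B → (y : WithTop Γ.Idx) < k → y ∉ Γ.rootSet J i) :
    0 < Γ.cutSign J i k := by
  induction hn : (J.filter fun y : Γ.Idx => (y : WithTop Γ.Idx) < k).card
    using Nat.strong_induction_on generalizing k with
  | _ n ih =>
  by_cases hex : ∃ y ∈ J, y ∉ B ∧ (y : WithTop Γ.Idx) < k
  · obtain ⟨y, hyJ, hyB, hyk⟩ := hex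
    obtain ⟨j, hj, hmax⟩ := (J.filter fun y : Γ.Idx => (y : WithTop Γ.Idx) < k).exists_max_image id
      ⟨y, by simp [hyJ, hyk]⟩
    simp only [Finset.mem_filter, id_eq, and_imp] at hj hmax
    have hjB : j ∉ B := fun h' => not_lt.2 (hmax y hyJ hyk) (hB j h' y hyJ hyB)
    have h1 := ih _ (by
      rw [← hn]
      exact SignWord.card_filter_lt_card_filter hj.1 (fun (a : Γ.Idx) _ h => h.trans hj.2)
        (lt_irrefl _) hj.2)
      (j : WithTop Γ.Idx) (fun x hx => ⟨(hBk x hx).1, WithTop.coe_lt_coe.2 (hB x hx j hj.1 hjB)⟩)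
      (fun y hy hyB hyj => hno y hy hyB (hyj.trans hj.2)) rfl
    have h2 : Γ.cutProd J k = Γ.prefixProd J j * (Γ.root j).reflection := by
      rw [← cutProd_coe, cutProd, cutProd, ← Γ.tau_insert_max]
      · congr 1
        ext x
        simp only [Finset.mem_filter, Finset.mem_insert, WithTop.coe_lt_coe]
        constructor
        · rintro ⟨hx, hxk⟩
          rcases (hmax x hx hxk).eq_or_lt with h | h
          · exact Or.inl h
          · exact Or.inr ⟨hx, h⟩
        · rintro (rfl | ⟨hx, hxj⟩)
          · exact hj
          · exact ⟨hx, (WithTop.coe_lt_coe.2 hxj).trans hj.2⟩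
      · intro b hb
        exact WithTop.coe_lt_coe.1 (Finset.mem_filter.1 hb).2
    by_contra hneg
    have h3 : Γ.cutSign J i k < 0 := lt_of_le_of_ne (not_lt.1 hneg) (Γ.cutSign_ne_zero J i k)
    rw [cutSign, h2] at h3
    rw [cutSign, cutProd_coe] at h1
    exact hno j hj.1 hjB hj.2 (Or.inl ((hJ j hj.1).apply_root_eq h1 h3))
  · push Not at hex
    have : J.filter (fun y : Γ.Idx => (y : WithTop Γ.Idx) < k) = B := by
      ext x
      rw [Finset.mem_filter]
      refine ⟨fun hx => ?_, hBk x⟩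
      by_contra hxB
      exact absurd hx.2 (not_lt.2 (hex x hx.1 hxB))
    rw [cutSign, cutProd, this]
    exact h

theorem cutSign_pos_mono {J : Finset Γ.Idx} (hJ : Γ.Admissible J) {i : I} {k k' : WithTop Γ.Idx}
    (hkk' : k ≤ k') (h : 0 < Γ.cutSign J i k)
    (hno : ∀ y ∈ J, k ≤ (y : WithTop Γ.Idx) → (y : WithTop Γ.Idx) < k' → y ∉ Γ.rootSet J i) :
    0 < Γ.cutSign J i k' := by
  refine Γ.cutSign_pos_of_tau_pos hJ (B := J.filter fun j : Γ.Idx => (j : WithTop Γ.Idx) < k)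
    ?_ h k' ?_ ?_
  · intro x hx y hy hyB
    simp only [Finset.mem_filter, not_and, not_lt] at hx hyB
    exact WithTop.coe_lt_coe.1 (hx.2.trans_le (hyB hy))
  · intro x hx
    rw [Finset.mem_filter] at hx
    exact ⟨hx.1, hx.2.trans_le hkk'⟩
  · intro y hy hyB
    simp only [Finset.mem_filter, not_and, not_lt] at hyB
    exact hno y hy (hyB hy)

theorem cover_of_apply_eq {g : P ≃ₗ[ℤ] P} (hg : g ∈ D.weylGroup) {b : D.PosRoot} {i : I}
    (h : g b.root = D.simpleRoot i) : D.BruhatCover g (g * b.reflection) := by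
  refine ⟨hg, ⟨b, rfl⟩, ?_⟩
  rw [mul_reflection_of_apply_eq hg h]
  refine CartanDatum.length_simpleReflection_mul_of_pos hg ?_
  rw [simpleCoroot_apply_of_apply_eq hg h]
  exact b.coroot_rho_pos

theorem cover_simpleReflection_mul {g : P ≃ₗ[ℤ] P} {b : D.PosRoot} {i : I}
    (h : D.BruhatCover g (g * b.reflection))
    (hs : 0 < D.simpleCoroot i (g D.rho) ↔ 0 < D.simpleCoroot i ((g * b.reflection) D.rho)) :
    D.BruhatCover (D.simpleReflection i * g) (D.simpleReflection i * g * b.reflection) := by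
  have hg' : g * b.reflection ∈ D.weylGroup := mul_mem h.1 b.reflection_mem
  refine ⟨mul_mem (D.simpleReflection_mem i) h.1, ⟨b, rfl⟩, ?_⟩
  have hl := h.2.2
  have h0 := CartanDatum.simpleCoroot_apply_rho_ne_zero h.1 i
  have h0' := CartanDatum.simpleCoroot_apply_rho_ne_zero hg' i
  rw [mul_assoc]
  by_cases hp : 0 < D.simpleCoroot i (g D.rho)
  · rw [CartanDatum.length_simpleReflection_mul_of_pos h.1 hp,
      CartanDatum.length_simpleReflection_mul_of_pos hg' (hs.1 hp), hl]
  · have h1 := CartanDatum.length_simpleReflection_mul_of_neg h.1 (i := i) (by omega)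
    have h2 := CartanDatum.length_simpleReflection_mul_of_neg hg' (i := i) (by omega)
    omega

end RootChain

namespace RootChain

variable {I : Type u} [DecidableEq I] {A : Matrix I I ℤ} {P : Type v} [AddCommGroup P]
  {D : CartanDatum A P} (Γ : RootChain D)

/-! ### Signatures -/

/-- Every root occurs only finitely often in the chain. -/
def IsFinitary (Γ : RootChain D) : Prop :=
  ∀ b : D.PosRoot, {k | Γ.root k = b}.Finite

/-- Two positions `a < m` with `γ_a = γ_m = α_i` relative to the folding positions `J`, neither of
them in `J`, that are neighbours in `I_{α_i}`. For `m = ⊤` the position `a` is the last one in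
`I_{α_i}`. The operator `f_i` moves a folding position from `m` to `a`. -/
structure FoldPair (J : Finset Γ.Idx) (i : I) (a : Γ.Idx) (m : WithTop Γ.Idx) : Prop where
  notMem : a ∉ J
  gam_eq : Γ.gam J a = D.simpleRoot i
  lt : (a : WithTop Γ.Idx) < m
  notMem_right : ∀ b : Γ.Idx, m = b → b ∉ J
  gam_right : ∀ b : Γ.Idx, m = b → Γ.gam J b = D.simpleRoot i
  not_between : ∀ k ∈ Γ.rootSet J i, a < k → m ≤ k

namespace FoldPair

variable {Γ} {J : Finset Γ.Idx} {i : I} {a : Γ.Idx} {m : WithTop Γ.Idx}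

theorem mem_rootSet (h : Γ.FoldPair J i a m) : a ∈ Γ.rootSet J i := Or.inl h.gam_eq

theorem cutProd_right_of_le (_ : Γ.FoldPair J i a m) {k : WithTop Γ.Idx} (hk : k ≤ m) :
    Γ.cutProd (insertTop m J) k = Γ.cutProd J k := by
  induction m using WithTop.recTopCoe with
  | top => rfl
  | coe b => exact Γ.cutProd_insert_of_not_lt J (not_lt.2 hk)

theorem cutProd_left_of_le (_ : Γ.FoldPair J i a m) {k : WithTop Γ.Idx}
    (hk : k ≤ (a : WithTop Γ.Idx)) : Γ.cutProd (insert a J) k = Γ.cutProd J k :=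
  Γ.cutProd_insert_of_not_lt J (not_lt.2 hk)

theorem notMem_insertTop (h : Γ.FoldPair J i a m) : a ∉ insertTop m J := by
  rw [mem_insertTop]
  rintro (h' | h')
  · exact h.lt.ne h'
  · exact h.notMem h'

theorem notMem_insert (h : Γ.FoldPair J i a m) {b : Γ.Idx} (hb : m = b) : b ∉ insert a J := by
  rw [Finset.mem_insert]
  rintro (rfl | h')
  · exact h.lt.ne hb.symm
  · exact h.notMem_right b hb h'

theorem gam_right_a (h : Γ.FoldPair J i a m) : Γ.gam (insertTop m J) a = D.simpleRoot i := by
  rw [RootChain.gam_eq, h.cutProd_right_of_le h.lt.le, ← RootChain.gam_eq, h.gam_eq]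

theorem gam_left_a (h : Γ.FoldPair J i a m) : Γ.gam (insert a J) a = D.simpleRoot i := by
  rw [RootChain.gam_eq, h.cutProd_left_of_le le_rfl, ← RootChain.gam_eq, h.gam_eq]

end FoldPair

theorem neg_simpleRoot_ne (i : I) : -D.simpleRoot i ≠ D.simpleRoot i := by
  intro h
  have := congrArg (D.simpleCoroot i) h
  rw [map_neg, CartanDatum.simpleCoroot_simpleRoot_self] at this
  omega

variable [Fintype I]

theorem IsFinitary.rootSet_finite {Γ : RootChain D} (h : Γ.IsFinitary) (J : Finset Γ.Idx) (i : I) :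
    (Γ.rootSet J i).Finite := by
  have h1 : ∀ x : P, {k | (Γ.root k).root = x}.Finite := by
    intro x
    by_cases hx : ∃ b : D.PosRoot, b.root = x
    · obtain ⟨b, rfl⟩ := hx
      refine (h b).subset fun k hk => ?_
      have hk : (Γ.root k).root = b.root := hk
      have h2 := (Γ.root k).isReal
      rw [hk] at h2
      exact CartanDatum.PosRoot.ext hk (h2.coroot_unique b.isReal)
    · refine Set.finite_empty.subset fun k hk => ?_
      exact hx ⟨_, hk⟩
  refine (J.powerset.finite_toSet.biUnion fun B _ =>
    (h1 ((Γ.tau B)⁻¹ (D.simpleRoot i))).union (h1 (-(Γ.tau B)⁻¹ (D.simpleRoot i)))).subset ?_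
  intro k hk
  rw [Set.mem_iUnion₂]
  refine ⟨J.filter fun j : Γ.Idx => (j : WithTop Γ.Idx) < k,
    Finset.mem_coe.2 (Finset.mem_powerset.2 (Finset.filter_subset _ _)), ?_⟩
  have e : (Γ.root k).root = (Γ.cutProd J k)⁻¹ (Γ.gam J k) := by
    rw [gam_eq, ← LinearEquiv.mul_apply, inv_mul_cancel]; rfl
  rcases hk with hk | hk <;> rw [hk] at e
  · exact Or.inl e
  · right
    rw [map_neg] at e
    exact e

variable {Γ}

/-- The letters of the `i`-signature: the positions in `I_{α_i} \ J`. -/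
noncomputable def IsFinitary.letters (hΓ : Γ.IsFinitary) (J : Finset Γ.Idx) (i : I) :
    Finset Γ.Idx :=
  ((hΓ.rootSet_finite J i).subset (Set.sdiff_subset (t := (J : Set Γ.Idx)))).toFinset

theorem IsFinitary.mem_letters (hΓ : Γ.IsFinitary) {J : Finset Γ.Idx} {i : I} {k : Γ.Idx} :
    k ∈ hΓ.letters J i ↔ k ∈ Γ.rootSet J i ∧ k ∉ J := by
  simp [IsFinitary.letters]

/-- The height of the `i`-signature of `J` at a cut. -/
noncomputable def IsFinitary.sigHeight (hΓ : Γ.IsFinitary) (J : Finset Γ.Idx) (i : I)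
    (k : WithTop Γ.Idx) : ℤ :=
  SignWord.height (hΓ.letters J i) (fun k => Γ.gam J k = D.simpleRoot i) k

theorem IsFinitary.reducedPlus_eq (hΓ : Γ.IsFinitary) (J : Finset Γ.Idx) (i : I) :
    Γ.reducedPlus J i = SignWord.freePlus (hΓ.letters J i : Set Γ.Idx)
      (fun k => Γ.gam J k = D.simpleRoot i) := by
  simp [SignWord.freePlus, reducedPlus, IsFinitary.letters]

theorem IsFinitary.reducedMinus_eq (hΓ : Γ.IsFinitary) (J : Finset Γ.Idx) (i : I) :
    Γ.reducedMinus J i = SignWord.freeMinus (hΓ.letters J i : Set Γ.Idx)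
      (fun k => Γ.gam J k = D.simpleRoot i) := by
  simp [SignWord.freeMinus, reducedMinus, IsFinitary.letters]

variable (Γ)

namespace FoldPair

variable {Γ} {J : Finset Γ.Idx} {i : I} {a : Γ.Idx} {m : WithTop Γ.Idx}

theorem rootSet_left (h : Γ.FoldPair J i a m) : Γ.rootSet (insert a J) i = Γ.rootSet J i :=
  Γ.rootSet_insert h.notMem h.mem_rootSet

theorem rootSet_right (h : Γ.FoldPair J i a m) : Γ.rootSet (insertTop m J) i = Γ.rootSet J i := by
  induction m using WithTop.recTopCoe with
  | top => rfl
  | coe b => exact Γ.rootSet_insert (h.notMem_right b rfl) (Or.inl (h.gam_right b rfl))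

theorem cutProd_right_of_lt (h : Γ.FoldPair J i a m) {k : WithTop Γ.Idx} (hk : m < k) :
    Γ.cutProd (insertTop m J) k = D.simpleReflection i * Γ.cutProd J k := by
  induction m using WithTop.recTopCoe with
  | top => exact absurd hk (not_lt.2 le_top)
  | coe b => exact Γ.cutProd_insert (h.notMem_right b rfl) (Or.inl (h.gam_right b rfl)) hk

theorem cutProd_left_of_lt (h : Γ.FoldPair J i a m) {k : WithTop Γ.Idx}
    (hk : (a : WithTop Γ.Idx) < k) :
    Γ.cutProd (insert a J) k = D.simpleReflection i * Γ.cutProd J k :=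
  Γ.cutProd_insert h.notMem h.mem_rootSet hk

theorem cutProd_left_eq_right (h : Γ.FoldPair J i a m) {k : WithTop Γ.Idx}
    (hk : k ≤ (a : WithTop Γ.Idx) ∨ m < k) :
    Γ.cutProd (insert a J) k = Γ.cutProd (insertTop m J) k := by
  rcases hk with hk | hk
  · rw [h.cutProd_left_of_le hk, h.cutProd_right_of_le (hk.trans h.lt.le)]
  · rw [h.cutProd_left_of_lt (h.lt.trans hk), h.cutProd_right_of_lt hk]

theorem cutProd_left_eq_mul (h : Γ.FoldPair J i a m) {k : WithTop Γ.Idx}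
    (hk : (a : WithTop Γ.Idx) < k) (hkm : k ≤ m) :
    Γ.cutProd (insert a J) k = D.simpleReflection i * Γ.cutProd (insertTop m J) k := by
  rw [h.cutProd_left_of_lt hk, h.cutProd_right_of_le hkm]

theorem cutProd_right_eq_mul (h : Γ.FoldPair J i a m) {k : WithTop Γ.Idx}
    (hk : (a : WithTop Γ.Idx) < k) (hkm : k ≤ m) :
    Γ.cutProd (insertTop m J) k = D.simpleReflection i * Γ.cutProd (insert a J) k := by
  rw [h.cutProd_left_eq_mul hk hkm, ← mul_assoc, CartanDatum.simpleReflection_mul_self, one_mul]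

theorem cutSign_left (h : Γ.FoldPair J i a m) {k : WithTop Γ.Idx}
    (hk : (a : WithTop Γ.Idx) < k) (hkm : k ≤ m) :
    Γ.cutSign (insert a J) i k = -Γ.cutSign (insertTop m J) i k := by
  rw [cutSign, cutSign, h.cutProd_left_eq_mul hk hkm, LinearEquiv.mul_apply,
    CartanDatum.simpleCoroot_simpleReflection]

theorem gam_left_eq_right (h : Γ.FoldPair J i a m) {k : Γ.Idx}
    (hk : k ≤ a ∨ m < (k : WithTop Γ.Idx)) : Γ.gam (insert a J) k = Γ.gam (insertTop m J) k := by
  rw [RootChain.gam_eq, RootChain.gam_eq, h.cutProd_left_eq_right (hk.imp_left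
    WithTop.coe_le_coe.2)]

theorem gam_left_m (h : Γ.FoldPair J i a m) {b : Γ.Idx} (hb : m = b) :
    Γ.gam (insert a J) b = -D.simpleRoot i := by
  rw [RootChain.gam_eq, h.cutProd_left_of_lt (hb ▸ h.lt), LinearEquiv.mul_apply,
    ← RootChain.gam_eq, h.gam_right b hb, CartanDatum.simpleReflection_simpleRoot]

open Classical in
/-- Both signatures agree except at `a`, which is a letter `+` of one, and at `m`, which is a
letter `-` of the other. -/
theorem sigHeight_left (h : Γ.FoldPair J i a m) (hΓ : Γ.IsFinitary) (k : WithTop Γ.Idx) :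
    hΓ.sigHeight (insert a J) i k = hΓ.sigHeight (insertTop m J) i k -
      (if (a : WithTop Γ.Idx) < k then 1 else 0) - (if m < k then 1 else 0) := by
  -- the letters to the left of `k` that both signatures have
  set T : Finset Γ.Idx := (hΓ.letters (insertTop m J) i).filter
    fun x => (x : WithTop Γ.Idx) < k ∧ x ≠ a with hT
  have h1 : hΓ.sigHeight (insertTop m J) i k = (∑ x ∈ T, if Γ.gam (insertTop m J) x =
      D.simpleRoot i then 1 else -1) + if (a : WithTop Γ.Idx) < k then 1 else 0 := by
    unfold IsFinitary.sigHeight SignWord.height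
    split_ifs with hk
    · have : (hΓ.letters (insertTop m J) i).filter (fun x : Γ.Idx => (x : WithTop Γ.Idx) < k) =
          insert a T := by
        ext x
        simp only [hT, Finset.mem_filter, Finset.mem_insert]
        by_cases hx : x = a
        · subst hx
          simp [hk, hΓ.mem_letters, h.rootSet_right, h.mem_rootSet, h.notMem_insertTop]
        · simp [hx]
      rw [this, Finset.sum_insert (by simp [hT]), if_pos h.gam_right_a, add_comm]
    · rw [add_zero]
      refine Finset.sum_congr ?_ fun _ _ => rfl
      refine Finset.filter_congr fun x _ => (and_iff_left_of_imp ?_).symm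
      rintro hx rfl
      exact hk hx
  have hT' : ∀ x, x ∈ T ↔ (x ∈ Γ.rootSet J i ∧ x ∉ J ∧ x ≠ a ∧ (x : WithTop Γ.Idx) ≠ m) ∧
      (x : WithTop Γ.Idx) < k := by
    intro x
    simp only [hT, Finset.mem_filter, hΓ.mem_letters, h.rootSet_right, mem_insertTop, not_or]
    tauto
  have h2 : hΓ.sigHeight (insert a J) i k = (∑ x ∈ T, if Γ.gam (insert a J) x =
      D.simpleRoot i then 1 else -1) - if m < k then 1 else 0 := by
    unfold IsFinitary.sigHeight SignWord.height
    split_ifs with hk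
    · obtain ⟨b, rfl⟩ := WithTop.ne_top_iff_exists.1 (hk.trans_le le_top).ne
      have : (hΓ.letters (insert a J) i).filter (fun x : Γ.Idx => (x : WithTop Γ.Idx) < k) =
          insert b T := by
        ext x
        simp only [Finset.mem_insert, hT', Finset.mem_filter, hΓ.mem_letters, h.rootSet_left,
          not_or]
        by_cases hx : x = b
        · subst hx
          have hr : x ∈ Γ.rootSet J i := Or.inl (h.gam_right x rfl)
          have := h.notMem_insert (b := x) rfl
          rw [Finset.mem_insert, not_or] at this
          simp [hk, this.1, this.2, hr]
        · have : (x : WithTop Γ.Idx) ≠ b := fun h' => hx (WithTop.coe_injective h')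
          simp only [hx, this, ne_eq, not_false_eq_true, and_true, false_or]
          tauto
      rw [this, Finset.sum_insert (by simp [hT']),
        if_neg ((h.gam_left_m rfl).trans_ne (neg_simpleRoot_ne i)),
        add_comm, sub_eq_add_neg]
    · rw [sub_zero]
      refine Finset.sum_congr ?_ fun _ _ => rfl
      ext x
      simp only [Finset.mem_insert, hT', Finset.mem_filter, hΓ.mem_letters, h.rootSet_left,
        not_or]
      constructor
      · rintro ⟨⟨h1, h2, h3⟩, h4⟩
        exact ⟨⟨h1, h3, h2, fun h' => hk (h' ▸ h4)⟩, h4⟩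
      · rintro ⟨⟨h1, h2, h3, -⟩, h4⟩
        exact ⟨⟨h1, h3, h2⟩, h4⟩
  rw [h1, h2, Finset.sum_congr rfl fun x hx => ?_]
  · ring
  · rw [hT'] at hx
    rw [h.gam_left_eq_right]
    by_contra hn
    push Not at hn
    exact hx.1.2.2.2 (le_antisymm hn.2 (h.not_between x hx.1.1 hn.1))

/-- Up to the position `a`, and right of the cut `m`, the height of the signature of
`J ∪ {m}` is at most what it is after the letter `+` at `a`. -/
def IsPeak (_ : Γ.FoldPair J i a m) (hΓ : Γ.IsFinitary) : Prop :=
  (∀ k, k ≤ (a : WithTop Γ.Idx) →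
    hΓ.sigHeight (insertTop m J) i k ≤ hΓ.sigHeight (insertTop m J) i a) ∧
  ∀ k, hΓ.sigHeight (insertTop m J) i k ≤ hΓ.sigHeight (insertTop m J) i a + 1

theorem isGreatest_iff (h : Γ.FoldPair J i a m) (hΓ : Γ.IsFinitary) :
    IsGreatest (Γ.reducedPlus (insertTop m J) i) a ↔ h.IsPeak hΓ := by
  rw [hΓ.reducedPlus_eq, SignWord.isGreatest_freePlus_iff]
  refine ⟨fun h' => h'.2.2, fun h' => ⟨?_, h.gam_right_a, h'⟩⟩
  rw [hΓ.mem_letters, h.rootSet_right]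
  exact ⟨h.mem_rootSet, h.notMem_insertTop⟩

theorem sigHeight_between (h : Γ.FoldPair J i a m) (hΓ : Γ.IsFinitary) {k : WithTop Γ.Idx}
    (hak : (a : WithTop Γ.Idx) < k) (hkm : k ≤ m) :
    hΓ.sigHeight (insertTop m J) i k = hΓ.sigHeight (insertTop m J) i a + 1 := by
  have ha : a ∈ hΓ.letters (insertTop m J) i := by
    rw [hΓ.mem_letters, h.rootSet_right]
    exact ⟨h.mem_rootSet, h.notMem_insertTop⟩
  unfold IsFinitary.sigHeight
  rw [SignWord.height_eq_add ha (lt_irrefl _) hak (k' := a) fun b hb hba => ?_,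
    if_pos h.gam_right_a]
  rw [hΓ.mem_letters, h.rootSet_right] at hb
  rw [WithTop.coe_lt_coe]
  refine ⟨fun hbk => ?_, fun hba => (WithTop.coe_lt_coe.2 hba).trans hak⟩
  by_contra hn
  exact not_le.2 (hbk.trans_le hkm) (h.not_between b hb.1 (lt_of_le_of_ne (not_lt.1 hn) hba.symm))

/-- The height of the signature of `J ∪ {a}` attains its maximum at the cut `m`, and nowhere to the
right of it. -/
theorem isPeak_iff (h : Γ.FoldPair J i a m) (hΓ : Γ.IsFinitary) : h.IsPeak hΓ ↔
    (∀ k, hΓ.sigHeight (insert a J) i k ≤ hΓ.sigHeight (insert a J) i m) ∧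
      ∀ k, m < k → hΓ.sigHeight (insert a J) i k < hΓ.sigHeight (insert a J) i m := by
  have hm : hΓ.sigHeight (insert a J) i m = hΓ.sigHeight (insertTop m J) i a := by
    rw [h.sigHeight_left hΓ, if_pos h.lt, if_neg (lt_irrefl _), h.sigHeight_between hΓ h.lt le_rfl]
    omega
  rw [hm]
  unfold IsPeak
  have hlow : ∀ k, k ≤ (a : WithTop Γ.Idx) →
      hΓ.sigHeight (insert a J) i k = hΓ.sigHeight (insertTop m J) i k := by
    intro k hk
    rw [h.sigHeight_left hΓ, if_neg (not_lt.2 hk), if_neg (not_lt.2 (hk.trans h.lt.le))]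
    omega
  have hmid : ∀ k, (a : WithTop Γ.Idx) < k → k ≤ m →
      hΓ.sigHeight (insert a J) i k = hΓ.sigHeight (insertTop m J) i a := by
    intro k hk hkm
    rw [h.sigHeight_left hΓ, if_pos hk, if_neg (not_lt.2 hkm), h.sigHeight_between hΓ hk hkm]
    omega
  have hhigh : ∀ k, m < k →
      hΓ.sigHeight (insert a J) i k = hΓ.sigHeight (insertTop m J) i k - 2 := by
    intro k hk
    rw [h.sigHeight_left hΓ, if_pos (h.lt.trans hk), if_pos hk]
    omega
  constructor
  · rintro ⟨h1, h2⟩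
    have h3 : ∀ k, m < k →
        hΓ.sigHeight (insert a J) i k < hΓ.sigHeight (insertTop m J) i a := by
      intro k hk
      have := h2 k
      rw [hhigh k hk]
      omega
    refine ⟨fun k => ?_, h3⟩
    rcases le_or_gt k (a : WithTop Γ.Idx) with hk | hk
    · rw [hlow k hk]; exact h1 k hk
    · rcases le_or_gt k m with hkm | hkm
      · rw [hmid k hk hkm]
      · exact (h3 k hkm).le
  · rintro ⟨h1, h2⟩
    have h3 : ∀ k, k ≤ (a : WithTop Γ.Idx) →
        hΓ.sigHeight (insertTop m J) i k ≤ hΓ.sigHeight (insertTop m J) i a := by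
      intro k hk
      rw [← hlow k hk]; exact h1 k
    refine ⟨h3, fun k => ?_⟩
    rcases le_or_gt k (a : WithTop Γ.Idx) with hk | hk
    · have := h3 k hk
      omega
    · rcases le_or_gt k m with hkm | hkm
      · exact (h.sigHeight_between hΓ hk hkm).le
      · have := h2 k hkm
        rw [hhigh k hkm] at this
        omega

theorem isLeast_iff (h : Γ.FoldPair J i a m) (hΓ : Γ.IsFinitary) {b : Γ.Idx} (hb : m = b) :
    IsLeast (Γ.reducedMinus (insert a J) i) b ↔ h.IsPeak hΓ := by
  subst hb
  rw [hΓ.reducedMinus_eq, SignWord.isLeast_freeMinus_iff, h.isPeak_iff hΓ]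
  refine ⟨fun h' => h'.2.2, fun h' => ⟨?_, ?_, h'⟩⟩
  · rw [hΓ.mem_letters, h.rootSet_left]
    exact ⟨Or.inl (h.gam_right b rfl), h.notMem_insert rfl⟩
  · exact (h.gam_left_m rfl).trans_ne (neg_simpleRoot_ne i)

end FoldPair

end RootChain

namespace RootChain

variable {I : Type u} [DecidableEq I] {A : Matrix I I ℤ} {P : Type v} [AddCommGroup P]
  {D : CartanDatum A P} {Γ : RootChain D}

theorem ofFinset_eq {J : Finset Γ.Idx} (J' : Γ.Al) (h : J = J'.1) : Γ.ofFinset J = some J' := by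
  subst h
  exact dif_pos J'.2

variable [Fintype I]

/-! ### The crystal operators move one folding position -/

namespace FoldPair

variable {J : Finset Γ.Idx} {i : I} {a : Γ.Idx} {m : WithTop Γ.Idx}

/-- To the right of `a` and up to the cut `m` the sign of `J ∪ {m}` is positive. -/
theorem cutSign_right_pos (h : Γ.FoldPair J i a m) (hJ : Γ.Admissible (insertTop m J))
    {k : WithTop Γ.Idx} (hk : (a : WithTop Γ.Idx) ≤ k) (hkm : k ≤ m) :
    0 < Γ.cutSign (insertTop m J) i k := by
  refine Γ.cutSign_pos_mono hJ hk (Γ.cutSign_pos_of_gam h.gam_right_a) fun y hy hay hyk hr => ?_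
  rw [h.rootSet_right] at hr
  have hya : a ≠ y := by
    rintro rfl
    exact h.notMem_insertTop hy
  exact not_le.2 (hyk.trans_le hkm)
    (h.not_between y hr (lt_of_le_of_ne (WithTop.coe_le_coe.1 hay) hya))

/-- If `J ∪ {m}` is admissible, so is `J ∪ {a}`. Between `a` and `m` the products are multiplied by
`s_i`, which preserves covers there because the signs are constant. -/
theorem admissible_left (h : Γ.FoldPair J i a m) (hJ : Γ.Admissible (insertTop m J)) :
    Γ.Admissible (insert a J) := by
  intro j hj
  rw [← cutProd_coe]
  by_cases hja : j = a
  · subst hja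
    refine cover_of_apply_eq (Γ.cutProd_mem _ _) (i := i) ?_
    rw [← RootChain.gam_eq, h.gam_left_a]
  have hjJ : j ∈ J := (Finset.mem_insert.1 hj).resolve_left hja
  have hjJ' : j ∈ insertTop m J := mem_insertTop.2 (Or.inr hjJ)
  have hcov := hJ j hjJ'
  rw [← cutProd_coe] at hcov
  by_cases hout : (j : WithTop Γ.Idx) ≤ a ∨ m < (j : WithTop Γ.Idx)
  · rwa [h.cutProd_left_eq_right hout]
  push Not at hout
  rw [h.cutProd_left_eq_mul hout.1 hout.2]
  refine cover_simpleReflection_mul hcov (iff_of_true (h.cutSign_right_pos hJ hout.1.le hout.2) ?_)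
  by_contra hneg
  have h0 := CartanDatum.simpleCoroot_apply_rho_ne_zero (mul_mem (Γ.cutProd_mem (insertTop m J) j)
    (Γ.root j).reflection_mem) i
  have h1 := hcov.apply_root_eq (h.cutSign_right_pos hJ hout.1.le hout.2) (i := i) (by omega)
  rw [← RootChain.gam_eq] at h1
  have h2 : j ∈ Γ.rootSet J i := by
    rw [← h.rootSet_right]
    exact Or.inl h1
  have h3 : (j : WithTop Γ.Idx) = m :=
    le_antisymm hout.2 (h.not_between j h2 (WithTop.coe_lt_coe.1 hout.1))
  exact h.notMem_right j h3.symm hjJ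

/-- If `J ∪ {a}` is admissible and its sign at the cut `m` is negative, then `J ∪ {m}` is
admissible. -/
theorem admissible_right (h : Γ.FoldPair J i a m) (hJ : Γ.Admissible (insert a J))
    (hm : Γ.cutSign (insert a J) i m < 0) : Γ.Admissible (insertTop m J) := by
  have hno : ∀ y ∈ insert a J, (a : WithTop Γ.Idx) < y → (y : WithTop Γ.Idx) < m →
      y ∉ Γ.rootSet (insert a J) i := by
    intro y _ hay hym hr
    rw [h.rootSet_left] at hr
    exact not_le.2 hym (h.not_between y hr (WithTop.coe_lt_coe.1 hay))
  intro j hj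
  rw [← cutProd_coe]
  by_cases hjm : (j : WithTop Γ.Idx) = m
  · refine cover_of_apply_eq (Γ.cutProd_mem _ _) (i := i) ?_
    rw [h.cutProd_right_of_le hjm.le, ← RootChain.gam_eq, h.gam_right j hjm.symm]
  have hjJ : j ∈ J := (mem_insertTop.1 hj).resolve_left hjm
  have hja : j ≠ a := by rintro rfl; exact h.notMem hjJ
  have hjJ' : j ∈ insert a J := Finset.mem_insert_of_mem hjJ
  have hcov := hJ j hjJ'
  rw [← cutProd_coe] at hcov
  by_cases hout : (j : WithTop Γ.Idx) ≤ a ∨ m < (j : WithTop Γ.Idx)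
  · rwa [← h.cutProd_left_eq_right hout]
  push Not at hout
  rw [h.cutProd_right_eq_mul hout.1 hout.2]
  refine cover_simpleReflection_mul hcov (iff_of_false (fun hpos => ?_) fun hpos => ?_)
  · have := Γ.cutSign_pos_mono hJ hout.2 hpos fun y hy hjy hym =>
      hno y hy (hout.1.trans_le hjy) hym
    omega
  · have htau : Γ.tau ((insert a J).filter (· ≤ j)) = Γ.cutProd (insert a J) j *
        (Γ.root j).reflection := by
      rw [cutProd, ← Γ.tau_insert_max fun b hb => WithTop.coe_lt_coe.1 (Finset.mem_filter.1 hb).2]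
      congr 1
      ext x
      simp only [Finset.mem_filter, Finset.mem_insert, WithTop.coe_lt_coe, le_iff_eq_or_lt]
      constructor
      · rintro ⟨hx, rfl | hxj⟩
        · exact Or.inl rfl
        · exact Or.inr ⟨hx, hxj⟩
      · rintro (rfl | ⟨hx, hxj⟩)
        · exact ⟨Or.inr hjJ, Or.inl rfl⟩
        · exact ⟨hx, Or.inr hxj⟩
    rw [← htau] at hpos
    have := Γ.cutSign_pos_of_tau_pos hJ (B := (insert a J).filter (· ≤ j))
      (fun x hx y hy hyB => ?_) hpos m (fun x hx => ?_) (fun y hy hyB hym => ?_)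
    · omega
    · simp only [Finset.mem_filter, not_and, not_le] at hx hyB
      exact hx.2.trans_lt (hyB hy)
    · rw [Finset.mem_filter] at hx
      exact ⟨hx.1, (WithTop.coe_le_coe.2 hx.2).trans_lt (lt_of_le_of_ne hout.2 hjm)⟩
    · simp only [Finset.mem_filter, not_and, not_le] at hyB
      exact hno y hy (hout.1.trans (WithTop.coe_lt_coe.2 (hyB hy))) hym

end FoldPair

/-- `J'` arises from `J` by moving a folding position from `m` to `a`, where `a` is the letter `+`
just before the first maximum of the height of the `i`-signature of `J`. -/
def Moves (hΓ : Γ.IsFinitary) (i : I) (J J' : Finset Γ.Idx) : Prop :=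
  ∃ (B : Finset Γ.Idx) (a : Γ.Idx) (m : WithTop Γ.Idx) (h : Γ.FoldPair B i a m),
    h.IsPeak hΓ ∧ J = insertTop m B ∧ J' = insert a B

theorem exists_moves_of_isGreatest (hΓ : Γ.IsFinitary) {i : I} (J : Γ.Al) {a : Γ.Idx}
    (ha : IsGreatest (Γ.reducedPlus J.1 i) a) : ∃ J' : Γ.Al, Moves hΓ i J.1 J'.1 := by
  classical
  have hgam : Γ.gam J.1 a = D.simpleRoot i := ha.1.2.1
  have hmem : a ∈ Γ.rootSet J.1 i ∧ a ∉ J.1 := ha.1.1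
  obtain ⟨m, ham, hm1, hm2⟩ : ∃ m : WithTop Γ.Idx, (a : WithTop Γ.Idx) < m ∧
      (∀ b : Γ.Idx, m = b → b ∈ J.1 ∧ b ∈ Γ.rootSet J.1 i) ∧
      ∀ y ∈ J.1, y ∈ Γ.rootSet J.1 i → a < y → m ≤ y := by
    by_cases hS : (J.1.filter fun j => j ∈ Γ.rootSet J.1 i ∧ a < j).Nonempty
    · obtain ⟨b, hb, hmin⟩ := Finset.exists_min_image _ id hS
      simp only [Finset.mem_filter, id_eq, and_imp] at hb hmin
      refine ⟨b, WithTop.coe_lt_coe.2 hb.2.2, ?_, fun y h1 h2 h3 =>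
        WithTop.coe_le_coe.2 (hmin y h1 h2 h3)⟩
      rintro _ h
      rw [← WithTop.coe_injective h]
      exact ⟨hb.1, hb.2.1⟩
    · rw [Finset.not_nonempty_iff_eq_empty, Finset.filter_eq_empty_iff] at hS
      exact ⟨⊤, WithTop.coe_lt_top a, fun b hb => absurd hb.symm (WithTop.coe_ne_top),
        fun y h1 h2 h3 => absurd ⟨h2, h3⟩ (hS h1)⟩
  set B : Finset Γ.Idx := J.1.filter fun j : Γ.Idx => (j : WithTop Γ.Idx) ≠ m with hB
  have hJB : J.1 = insertTop m B := by
    ext x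
    rw [mem_insertTop, hB, Finset.mem_filter]
    by_cases hx : (x : WithTop Γ.Idx) = m
    · simp [hx, (hm1 x hx.symm).1]
    · simp [hx]
  have hcong : ∀ k : Γ.Idx, (k : WithTop Γ.Idx) ≤ m → Γ.gam B k = Γ.gam J.1 k := by
    intro k hk
    refine Γ.gam_congr fun j hj => ?_
    rw [hB, Finset.mem_filter, and_iff_left]
    exact ((WithTop.coe_lt_coe.2 hj).trans_le hk).ne
  have hPlus : ∀ k : Γ.Idx, a ≤ k → (k : WithTop Γ.Idx) < m → k ∈ Γ.rootSet J.1 i →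
      Γ.gam J.1 k = D.simpleRoot i := by
    intro k hak hkm hk
    rw [Γ.gam_eq_iff_cutSign_pos hk]
    refine Γ.cutSign_pos_mono J.2 (WithTop.coe_le_coe.2 hak) (Γ.cutSign_pos_of_gam hgam) ?_
    intro y hy hay hyk hr
    rcases (WithTop.coe_le_coe.1 hay).eq_or_lt with rfl | hay
    · exact hmem.2 hy
    · exact not_le.2 (hyk.trans hkm) (hm2 y hy hr hay)
  have hpeak := ha
  rw [hΓ.reducedPlus_eq, SignWord.isGreatest_freePlus_iff] at hpeak
  have h : Γ.FoldPair B i a m :=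
    { notMem := fun h' => hmem.2 (Finset.mem_of_mem_filter _ h')
      gam_eq := (hcong a ham.le).trans hgam
      lt := ham
      notMem_right := by
        rintro b rfl
        simp [hB]
      gam_right := fun b hb => (hcong b hb.ge).trans
        (Γ.gam_eq_of_mem J.2 (hm1 b hb).1 (hm1 b hb).2)
      not_between := by
        -- A further letter between `a` and `m` would be a `+` as well, so that the height would
        -- increase twice from `a` on.
        intro k hk hak
        by_contra hkm
        rw [not_le] at hkm
        have hkJ : k ∈ Γ.rootSet J.1 i := by
          unfold rootSet at hk ⊢
          rwa [Set.mem_ofPred, hcong k hkm.le] at hk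
        have hkJ' : k ∉ J.1 := fun h' => not_le.2 hkm (hm2 k h' hkJ hak)
        obtain ⟨e, hae, hek, he, hH⟩ := SignWord.exists_next
          (plus := fun k => Γ.gam J.1 k = D.simpleRoot i) hpeak.1 (WithTop.coe_lt_coe.2 hak)
        have h1 := hH e hae le_rfl
        rw [if_pos hgam] at h1
        obtain ⟨e, hel, rfl⟩ : ∃ a ∈ hΓ.letters J.1 i, e = (a : WithTop Γ.Idx) := by
          rcases he with rfl | he
          · exact ⟨k, hΓ.mem_letters.2 ⟨hkJ, hkJ'⟩, rfl⟩
          · exact he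
        obtain ⟨e', hee', -, -, hH'⟩ := SignWord.exists_next
          (plus := fun k => Γ.gam J.1 k = D.simpleRoot i) hel (WithTop.coe_lt_top e)
        have h2 := hH' e' hee' le_rfl
        rw [if_pos (hPlus e (WithTop.coe_lt_coe.1 hae).le (hek.trans_lt hkm)
          (hΓ.mem_letters.1 hel).1)] at h2
        have := hpeak.2.2.2 e'
        omega }
  refine ⟨⟨insert a B, h.admissible_left (hJB ▸ J.2)⟩, B, a, m, h, ?_, hJB, rfl⟩
  rw [← h.isGreatest_iff hΓ, ← hJB]
  exact ha

/-- The two cases in which `e_i J ≠ 0`: the cut `m` is the leftmost `-` of the reduced signature, or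
there is none, the final sign is negative and `m = ⊤`. -/
theorem exists_moves_to (hΓ : Γ.IsFinitary) {i : I} (J' : Γ.Al) {m : WithTop Γ.Idx}
    (hm : ∀ b : Γ.Idx, m = b → b ∈ Γ.rootSet J'.1 i ∧ b ∉ J'.1 ∧ Γ.gam J'.1 b ≠ D.simpleRoot i)
    (hneg : Γ.cutSign J'.1 i m < 0)
    (h1 : ∀ k, hΓ.sigHeight J'.1 i k ≤ hΓ.sigHeight J'.1 i m)
    (h2 : ∀ k, m < k → hΓ.sigHeight J'.1 i k < hΓ.sigHeight J'.1 i m) :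
    ∃ J : Γ.Al, Moves hΓ i J.1 J'.1 := by
  classical
  -- The sign is positive at the beginning of the chain, so that there is a folding position in
  -- `I_{α_i}` to the left of the cut `m`.
  have hS : (J'.1.filter fun j => j ∈ Γ.rootSet J'.1 i ∧ (j : WithTop Γ.Idx) < m).Nonempty := by
    by_contra hS
    rw [Finset.not_nonempty_iff_eq_empty, Finset.filter_eq_empty_iff] at hS
    have := Γ.cutSign_pos_of_tau_pos J'.2 (i := i) (B := ∅) (by simp)
      (by simp [CartanDatum.simpleCoroot_rho]) m (by simp)
      (fun y hy _ hym hr => hS hy ⟨hr, hym⟩)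
    omega
  obtain ⟨a, ha, hmax⟩ := Finset.exists_max_image _ id hS
  simp only [Finset.mem_filter, id_eq, and_imp] at ha hmax
  obtain ⟨haJ, har, ham⟩ := ha
  have hgam : Γ.gam J'.1 a = D.simpleRoot i := Γ.gam_eq_of_mem J'.2 haJ har
  set B := J'.1.erase a with hB
  have haB : a ∉ B := by simp [hB]
  have hJB : J'.1 = insert a B := (Finset.insert_erase haJ).symm
  have hgamB : Γ.gam B a = D.simpleRoot i := by
    rw [← hgam, hJB, Γ.gam_insert_of_le B le_rfl]
  have hrB : Γ.rootSet J'.1 i = Γ.rootSet B i := by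
    rw [hJB, Γ.rootSet_insert haB (Or.inl hgamB)]
  have hMinus : ∀ k : Γ.Idx, a < k → (k : WithTop Γ.Idx) < m → Γ.gam J'.1 k ≠ D.simpleRoot i := by
    intro k hak hkm h
    have := Γ.cutSign_pos_mono J'.2 hkm.le (Γ.cutSign_pos_of_gam h) fun y hy hky hym hr =>
      not_le.2 (hak.trans_le (WithTop.coe_le_coe.1 hky)) (hmax y hy hr hym)
    omega
  have h : Γ.FoldPair B i a m :=
    { notMem := haB
      gam_eq := hgamB
      lt := ham
      notMem_right := fun b hb h' => (hm b hb).2.1 (Finset.mem_of_mem_erase h')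
      gam_right := by
        rintro b rfl
        obtain ⟨hb1, -, hb3⟩ := hm b rfl
        have hb := hb1.resolve_left hb3
        rw [hJB, Γ.gam_insert haB (Or.inl hgamB) (WithTop.coe_lt_coe.1 ham)] at hb
        rw [← D.simpleReflection_apply_apply i (Γ.gam B b), hb, map_neg,
          CartanDatum.simpleReflection_simpleRoot, neg_neg]
      not_between := by
        -- The last letter between `a` and `m` would be a `-`, so that the height before it would be
        -- greater than the one at `m`.
        intro k hk hak
        by_contra hkm
        rw [not_le] at hkm
        rw [← hrB] at hk
        have hkJ : k ∉ J'.1 := fun h' => not_le.2 hak (hmax k h' hk hkm)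
        obtain ⟨p, hp, hkp, hpm, hH⟩ := SignWord.exists_prev (S := hΓ.letters J'.1 i)
          (plus := fun k => Γ.gam J'.1 k = D.simpleRoot i) (c := k) (k := m)
          ⟨k, hΓ.mem_letters.2 ⟨hk, hkJ⟩, le_rfl, hkm⟩
        rw [if_neg (hMinus p (hak.trans_le (WithTop.coe_le_coe.1 hkp)) hpm)] at hH
        have := h1 p
        unfold IsFinitary.sigHeight at this
        omega }
  refine ⟨⟨insertTop m B, h.admissible_right (hJB ▸ J'.2) (hJB ▸ hneg)⟩, B, a, m, h, ?_, rfl, hJB⟩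
  rw [h.isPeak_iff hΓ, ← hJB]
  exact ⟨h1, h2⟩

theorem fOp_eq_some_of_moves (hΓ : Γ.IsFinitary) {i : I} {J J' : Γ.Al}
    (h : Moves hΓ i J.1 J'.1) : Γ.fOp i J = some J' := by
  classical
  obtain ⟨B, a, m, h, hpeak, hJ, hJ'⟩ := h
  have hg := (h.isGreatest_iff hΓ).2 hpeak
  rw [← hJ] at hg
  have hex : ∃ a, IsGreatest (Γ.reducedPlus J.1 i) a := ⟨a, hg⟩
  have hch : hex.choose = a := hex.choose_spec.unique hg
  have haB : a ∉ B := h.notMem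
  unfold fOp
  rw [dif_pos hex]
  refine ofFinset_eq _ ?_
  simp only [hch]
  rw [hJ']
  have hle : ∀ y ∈ J.1, y ∈ Γ.rootSet J.1 i → a < y → m ≤ y := by
    intro y _ hr
    rw [hJ, h.rootSet_right] at hr
    exact h.not_between y hr
  have hmJ : ∀ b : Γ.Idx, m = b → b ∈ J.1 ∧ b ∈ Γ.rootSet J.1 i ∧ a < b := by
    intro b hb
    rw [hJ, h.rootSet_right]
    exact ⟨mem_insertTop.2 (Or.inl hb.symm), Or.inl (h.gam_right b hb),
      WithTop.coe_lt_coe.1 (hb ▸ h.lt)⟩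
  have haJ : J.1 = insertTop m B := hJ
  split_ifs with hS
  · have hmin := Finset.min'_mem _ hS
    rw [Finset.mem_filter] at hmin
    have hm := hle _ hmin.1 hmin.2.1 hmin.2.2
    obtain ⟨b, rfl⟩ := WithTop.ne_top_iff_exists.1 (hm.trans_lt (WithTop.coe_lt_top _)).ne
    have hb : Finset.min' _ hS = b := by
      refine le_antisymm (Finset.min'_le _ _ ?_) (WithTop.coe_le_coe.1 hm)
      rw [Finset.mem_filter]
      exact hmJ b rfl
    rw [hb, haJ, insertTop_coe, Finset.erase_insert (h.notMem_right b rfl)]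
  · rw [Finset.not_nonempty_iff_eq_empty, Finset.filter_eq_empty_iff] at hS
    obtain rfl : m = ⊤ := by
      by_contra hm
      obtain ⟨b, rfl⟩ := WithTop.ne_top_iff_exists.1 hm
      exact hS (hmJ b rfl).1 (hmJ b rfl).2
    rw [haJ, insertTop_top]

theorem fOp_eq_some_iff (hΓ : Γ.IsFinitary) {i : I} {J J' : Γ.Al} :
    Γ.fOp i J = some J' ↔ Moves hΓ i J.1 J'.1 := by
  refine ⟨fun h => ?_, fOp_eq_some_of_moves hΓ⟩
  by_cases hex : ∃ a, IsGreatest (Γ.reducedPlus J.1 i) a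
  · obtain ⟨a, ha⟩ := hex
    obtain ⟨J'', hJ''⟩ := exists_moves_of_isGreatest hΓ J ha
    rw [fOp_eq_some_of_moves hΓ hJ''] at h
    rw [← Option.some.inj h]
    exact hJ''
  · unfold fOp at h
    rw [dif_neg hex] at h
    exact absurd h (by simp)

theorem fOp_eq_none_iff (hΓ : Γ.IsFinitary) {i : I} {J : Γ.Al} :
    Γ.fOp i J = none ↔ ∀ k, hΓ.sigHeight J.1 i k ≤ 0 := by
  by_cases hex : ∃ a, IsGreatest (Γ.reducedPlus J.1 i) a
  · obtain ⟨a, ha⟩ := hex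
    obtain ⟨J', hJ'⟩ := exists_moves_of_isGreatest hΓ J ha
    rw [fOp_eq_some_of_moves hΓ hJ']
    obtain ⟨B, a, m, h, hpeak, hJ, -⟩ := hJ'
    refine iff_of_false (by simp) fun h' => ?_
    have h1 := h' m
    rw [hJ, h.sigHeight_between hΓ h.lt le_rfl] at h1
    -- the height at the empty left end is zero
    by_cases hl : ∃ b ∈ hΓ.letters (insertTop m B) i, b < a
    · obtain ⟨b, hb, hba⟩ := hl
      obtain ⟨c, hc, hmin⟩ := (hΓ.letters (insertTop m B) i).exists_min_image id ⟨b, hb⟩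
      have h0 : hΓ.sigHeight (insertTop m B) i c = 0 := SignWord.height_eq_zero fun x hx hxc =>
        not_le.2 (WithTop.coe_lt_coe.1 hxc) (hmin x hx)
      have := hpeak.1 c (WithTop.coe_le_coe.2 ((hmin b hb).trans hba.le))
      omega
    · push Not at hl
      have h0 : hΓ.sigHeight (insertTop m B) i a = 0 := SignWord.height_eq_zero fun x hx hxc =>
        not_le.2 (WithTop.coe_lt_coe.1 hxc) (hl x hx)
      omega
  · have hnone : Γ.fOp i J = none := by
      unfold fOp
      rw [dif_neg hex]
    refine iff_of_true hnone fun k => ?_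
    by_contra hk
    have := SignWord.exists_isGreatest_freePlus (not_le.1 hk)
    rw [← hΓ.reducedPlus_eq] at this
    exact hex this

theorem eOp_eq_some_of_moves (hΓ : Γ.IsFinitary) {i : I} {J J' : Γ.Al}
    (h : Moves hΓ i J.1 J'.1) : Γ.eOp i J' = some J := by
  classical
  obtain ⟨B, a, m, h, hpeak, hJ, hJ'⟩ := h
  have haB : a ∉ B := h.notMem
  have haJ' : a ∈ J'.1 := hJ' ▸ Finset.mem_insert_self _ _
  have har : a ∈ Γ.rootSet J'.1 i := by
    rw [hJ', h.rootSet_left]; exact h.mem_rootSet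
  have hle : ∀ y ∈ J'.1, y ∈ Γ.rootSet J'.1 i → (y : WithTop Γ.Idx) < m → y ≤ a := by
    intro y _ hr hym
    rw [hJ', h.rootSet_left] at hr
    by_contra hay
    exact not_le.2 hym (h.not_between y hr (not_le.1 hay))
  induction m using WithTop.recTopCoe with
  | coe b =>
    have hl := (h.isLeast_iff hΓ rfl).2 hpeak
    rw [← hJ'] at hl
    have hex : ∃ a, IsLeast (Γ.reducedMinus J'.1 i) a := ⟨b, hl⟩
    have hch : hex.choose = b := hex.choose_spec.unique hl
    unfold eOp
    rw [dif_pos hex]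
    refine ofFinset_eq _ ?_
    simp only [hch]
    rw [hJ]
    have hab : a < b := WithTop.coe_lt_coe.1 h.lt
    split_ifs with hS
    · have hmax : Finset.max' _ hS = a := by
        refine le_antisymm ?_ (Finset.le_max' _ _ ?_)
        · have hmem := Finset.max'_mem _ hS
          rw [Finset.mem_filter] at hmem
          exact hle _ hmem.1 hmem.2.1 (WithTop.coe_lt_coe.2 hmem.2.2)
        · rw [Finset.mem_filter]
          exact ⟨haJ', har, hab⟩
      rw [hmax, hJ', Finset.erase_insert haB, insertTop_coe]
    · refine absurd ⟨a, ?_⟩ hS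
      rw [Finset.mem_filter]
      exact ⟨haJ', har, hab⟩
  | top =>
    have hex : ¬ ∃ a, IsLeast (Γ.reducedMinus J'.1 i) a := by
      rintro ⟨c, hc⟩
      rw [hΓ.reducedMinus_eq, SignWord.isLeast_freeMinus_iff] at hc
      have h1 := hc.2.2.2 ⊤ (WithTop.coe_lt_top c)
      have h2 := ((h.isPeak_iff hΓ).1 hpeak).1 c
      rw [← hJ'] at h2
      exact absurd h1 (not_lt.2 h2)
    have hneg : D.simpleCoroot i (Γ.tau J'.1 D.rho) < 0 := by
      have h1 := h.cutSign_right_pos (hJ ▸ J.2) h.lt.le le_rfl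
      have h2 := h.cutSign_left h.lt le_rfl
      rw [← cutProd_top, hJ']
      unfold cutSign at h1 h2
      omega
    unfold eOp
    rw [dif_neg hex, if_pos hneg]
    have hS : (J'.1.filter fun j => j ∈ Γ.rootSet J'.1 i).Nonempty := ⟨a, by
      rw [Finset.mem_filter]; exact ⟨haJ', har⟩⟩
    have hmax : Finset.max' _ hS = a := by
      refine le_antisymm ?_ (Finset.le_max' _ _ ?_)
      · have hmem := Finset.max'_mem _ hS
        rw [Finset.mem_filter] at hmem
        exact hle _ hmem.1 hmem.2 (WithTop.coe_lt_top _)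
      · rw [Finset.mem_filter]
        exact ⟨haJ', har⟩
    simp only
    rw [dif_pos hS]
    refine ofFinset_eq _ ?_
    rw [hmax, hJ, hJ', Finset.erase_insert haB, insertTop_top]

theorem eOp_eq_some_iff (hΓ : Γ.IsFinitary) {i : I} {J J' : Γ.Al} :
    Γ.eOp i J' = some J ↔ Moves hΓ i J.1 J'.1 := by
  refine ⟨fun h => ?_, eOp_eq_some_of_moves hΓ⟩
  suffices hex : ∃ J₀ : Γ.Al, Moves hΓ i J₀.1 J'.1 by
    obtain ⟨J₀, hJ₀⟩ := hex
    rw [eOp_eq_some_of_moves hΓ hJ₀] at h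
    rw [← Option.some.inj h]
    exact hJ₀
  by_cases hex : ∃ a, IsLeast (Γ.reducedMinus J'.1 i) a
  · obtain ⟨b, hb⟩ := hex
    have hb0 := hb.1
    rw [hΓ.reducedMinus_eq, SignWord.isLeast_freeMinus_iff] at hb
    refine exists_moves_to hΓ J' (m := b) ?_ ?_ hb.2.2.1 hb.2.2.2
    · intro c hc
      obtain rfl := WithTop.coe_injective hc
      exact ⟨hb0.1.1, hb0.1.2, hb0.2.1⟩
    · exact Γ.cutSign_neg_of_gam (hb0.1.1.resolve_left hb0.2.1)
  · by_cases hneg : D.simpleCoroot i (Γ.tau J'.1 D.rho) < 0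
    · refine exists_moves_to hΓ J' (m := ⊤) (fun b hb => absurd hb.symm WithTop.coe_ne_top)
        (by rwa [cutSign, cutProd_top]) (fun k => ?_) (fun k hk => absurd hk (not_lt.2 le_top))
      by_contra hk
      have := SignWord.exists_isLeast_freeMinus (not_le.1 hk)
      rw [← hΓ.reducedMinus_eq] at this
      exact hex this
    · unfold eOp at h
      rw [dif_neg hex, if_neg hneg] at h
      exact absurd h (by simp)

/-- The operator `e_i` vanishes exactly if the height of the signature is maximal at the right end
and the final sign is positive. -/
theorem eOp_eq_none_iff (hΓ : Γ.IsFinitary) {i : I} {J : Γ.Al} :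
    Γ.eOp i J = none ↔ (∀ k, hΓ.sigHeight J.1 i k ≤ hΓ.sigHeight J.1 i ⊤) ∧
      0 < Γ.cutSign J.1 i ⊤ := by
  constructor
  · intro h
    have hno : ∀ J₀ : Γ.Al, ¬ Moves hΓ i J₀.1 J.1 := fun J₀ hJ₀ => by
      rw [eOp_eq_some_of_moves hΓ hJ₀] at h
      exact absurd h (by simp)
    have h1 : ∀ k, hΓ.sigHeight J.1 i k ≤ hΓ.sigHeight J.1 i ⊤ := by
      intro k
      by_contra hk
      obtain ⟨b, hb⟩ := SignWord.exists_isLeast_freeMinus (not_le.1 hk)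
      have hb0 := hb.1
      rw [← hΓ.reducedMinus_eq] at hb0
      rw [SignWord.isLeast_freeMinus_iff] at hb
      obtain ⟨J₀, hJ₀⟩ := exists_moves_to hΓ J (i := i) (m := b) (fun c hc => by
        obtain rfl := WithTop.coe_injective hc
        exact ⟨hb0.1.1, hb0.1.2, hb0.2.1⟩)
        (Γ.cutSign_neg_of_gam (hb0.1.1.resolve_left hb0.2.1)) hb.2.2.1 hb.2.2.2
      exact hno J₀ hJ₀
    refine ⟨h1, ?_⟩
    by_contra hneg
    obtain ⟨J₀, hJ₀⟩ := exists_moves_to hΓ J (i := i) (m := ⊤)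
      (fun b hb => absurd hb.symm WithTop.coe_ne_top)
      (lt_of_le_of_ne (not_lt.1 hneg) (Γ.cutSign_ne_zero _ _ _)) h1
      (fun k hk => absurd hk (not_lt.2 le_top))
    exact hno J₀ hJ₀
  · rintro ⟨h1, h2⟩
    rw [Option.eq_none_iff_forall_ne_some]
    intro J₀ hJ₀
    rw [eOp_eq_some_iff hΓ] at hJ₀
    obtain ⟨B, a, m, h, hpeak, hJ, hJ'⟩ := hJ₀
    have h3 := ((h.isPeak_iff hΓ).1 hpeak)
    rw [← hJ'] at h3
    induction m using WithTop.recTopCoe with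
    | coe b => exact absurd (h3.2 ⊤ (WithTop.coe_lt_top b)) (not_lt.2 (h1 b))
    | top =>
      have h4 := h.cutSign_right_pos (hJ ▸ J₀.2) h.lt.le le_rfl
      have h5 := h.cutSign_left h.lt le_rfl
      rw [← hJ'] at h5
      omega

theorem Moves.height_max (hΓ : Γ.IsFinitary) {i : I} {J J' : Finset Γ.Idx}
    (h : Moves hΓ i J J') {M : ℤ} (hM : ∀ k, hΓ.sigHeight J i k ≤ M)
    (hM' : ∃ k, hΓ.sigHeight J i k = M) : (∀ k, hΓ.sigHeight J' i k ≤ M - 1) ∧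
      ∃ k, hΓ.sigHeight J' i k = M - 1 := by
  obtain ⟨B, a, m, h, hpeak, rfl, rfl⟩ := h
  obtain ⟨k, hk⟩ := hM'
  have h1 := hpeak.2 k
  have h2 := hM m
  have h3 := h.sigHeight_between hΓ h.lt le_rfl
  have h4 := h.sigHeight_left hΓ m
  rw [if_pos h.lt, if_neg (lt_irrefl _)] at h4
  refine ⟨fun k => ?_, m, by omega⟩
  have := ((h.isPeak_iff hΓ).1 hpeak).1 k
  omega

end RootChain

/-! ### The order of the lex chain -/

namespace RootChain

variable {I : Type u} [LinearOrder I] {A : Matrix I I ℤ} {P : Type v}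
  [AddCommGroup P] {D : CartanDatum A P} {x : P}

/-- Let `q = (β, h)`. The affine functional `z ↦ ⟨z, y⟩ + l` is evaluated at the point where the
line from `0` to `-x`, displaced by the infinitesimal weight `∑ ε^i Λ_i`, crosses the hyperplane of
`q`, and the value is multiplied by `⟨x, β^∨⟩`. This is its finite part. -/
def sideFst (x : P) (q : D.PosRoot × ℤ) (y : Module.Dual ℤ P) (l : ℤ) : ℤ :=
  q.1.coroot x * l - y x * q.2

/-- The infinitesimal part of the value described at `sideFst`, as the list of its coefficients. -/
def sideSnd (x : P) (q : D.PosRoot × ℤ) (y : Module.Dual ℤ P) (i : I) : ℤ :=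
  q.1.coroot x * y (D.fundWeight i) - y x * q.1.coroot (D.fundWeight i)

/-- The value described at `sideFst` is negative. If `y` is the coroot of a positive root `β`, this
says that the pair `(β, l)` precedes `q` in the lex chain. -/
def IsBefore (x : P) (q : D.PosRoot × ℤ) (y : Module.Dual ℤ P) (l : ℤ) : Prop :=
  sideFst x q y l < 0 ∨ sideFst x q y l = 0 ∧
    ∃ i, (∀ j < i, sideSnd x q y j = 0) ∧ sideSnd x q y i < 0

theorem coroot_pos_of_idx (p : LexIdx D x) : 0 < p.1.1.coroot x := p.2.1.trans_lt p.2.2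

/-- The affine reflection in `q` fixes the crossing point of the hyperplane of `q`. -/
theorem isBefore_reflect {q : D.PosRoot × ℤ} {y : Module.Dual ℤ P} {l e : ℤ} :
    IsBefore x q (y - e • q.1.coroot) (l - e * q.2) ↔ IsBefore x q y l := by
  have h1 : sideFst x q (y - e • q.1.coroot) (l - e * q.2) = sideFst x q y l := by
    simp only [sideFst, LinearMap.sub_apply, LinearMap.smul_apply, smul_eq_mul]; ring
  have h2 : ∀ i, sideSnd x q (y - e • q.1.coroot) i = sideSnd x q y i := fun i => by
    simp only [sideSnd, LinearMap.sub_apply, LinearMap.smul_apply, smul_eq_mul]; ring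
  simp only [IsBefore, h1, h2]

theorem isBefore_self_iff {q : D.PosRoot × ℤ} (hq : 0 < q.1.coroot x) {l : ℤ} :
    IsBefore x q q.1.coroot l ↔ l < q.2 := by
  have h1 : sideFst x q q.1.coroot l = q.1.coroot x * (l - q.2) := by
    simp only [sideFst]; ring
  have h2 : ∀ i, sideSnd x q q.1.coroot i = 0 := fun i => by
    simp only [sideSnd]; ring
  simp only [IsBefore, h1, h2, lt_irrefl, and_false, exists_false, or_false]
  rw [mul_neg_iff]
  simp only [hq, true_and, not_lt.2 hq.le, false_and, or_false]
  omega

variable [Fintype I]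

theorem lex_lt_iff (p q : (lex D x).Idx) :
    p < q ↔ IsBefore x ((lex D x).position q) ((lex D x).root p).coroot ((lex D x).level p) := by
  obtain ⟨⟨b, h⟩, h0, hlt⟩ := p
  obtain ⟨⟨b', h'⟩, h0', hlt'⟩ := q
  simp only at h0 hlt h0' hlt'
  have hp : (0 : ℚ) < b.coroot x := by exact_mod_cast h0.trans_lt hlt
  have hp' : (0 : ℚ) < b'.coroot x := by exact_mod_cast h0'.trans_lt hlt'
  have e1 : ((h : ℚ) / (b.coroot x : ℚ) < (h' : ℚ) / (b'.coroot x : ℚ)) ↔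
      sideFst x (b', h') b.coroot h < 0 := by
    rw [div_lt_div_iff₀ hp hp', sideFst, sub_neg]
    constructor <;> intro hl
    · have hl : h * b'.coroot x < h' * b.coroot x := by exact_mod_cast hl
      linarith
    · have hl : h * b'.coroot x < h' * b.coroot x := by linarith
      exact_mod_cast hl
  have e2 : ((h : ℚ) / (b.coroot x : ℚ) = (h' : ℚ) / (b'.coroot x : ℚ)) ↔
      sideFst x (b', h') b.coroot h = 0 := by
    rw [div_eq_div_iff hp.ne' hp'.ne', sideFst, sub_eq_zero]
    constructor <;> intro hl
    · have hl : h * b'.coroot x = h' * b.coroot x := by exact_mod_cast hl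
      linarith
    · have hl : h * b'.coroot x = h' * b.coroot x := by linarith
      exact_mod_cast hl
  have e3 : ∀ i, ((b.corootCoeff i : ℚ) / (b.coroot x : ℚ) <
      (b'.corootCoeff i : ℚ) / (b'.coroot x : ℚ)) ↔ sideSnd x (b', h') b.coroot i < 0 := by
    intro i
    rw [div_lt_div_iff₀ hp hp', sideSnd, sub_neg, ← b.corootCoeff_eq, ← b'.corootCoeff_eq]
    constructor <;> intro hl
    · have hl : b.corootCoeff i * b'.coroot x < b'.corootCoeff i * b.coroot x := by
        exact_mod_cast hl
      linarith
    · have hl : b.corootCoeff i * b'.coroot x < b'.corootCoeff i * b.coroot x := by linarith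
      exact_mod_cast hl
  have e4 : ∀ i, ((b.corootCoeff i : ℚ) / (b.coroot x : ℚ) =
      (b'.corootCoeff i : ℚ) / (b'.coroot x : ℚ)) ↔ sideSnd x (b', h') b.coroot i = 0 := by
    intro i
    rw [div_eq_div_iff hp.ne' hp'.ne', sideSnd, sub_eq_zero, ← b.corootCoeff_eq,
      ← b'.corootCoeff_eq]
    constructor <;> intro hl
    · have hl : b.corootCoeff i * b'.coroot x = b'.corootCoeff i * b.coroot x := by
        exact_mod_cast hl
      linarith
    · have hl : b.corootCoeff i * b'.coroot x = b'.corootCoeff i * b.coroot x := by linarith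
      exact_mod_cast hl
  refine Iff.trans (Prod.Lex.toLex_lt_toLex) ?_
  refine or_congr e1 (and_congr e2 ?_)
  refine Iff.trans (b := ∃ i, (∀ j < i, (b.corootCoeff j : ℚ) / (b.coroot x : ℚ) =
      (b'.corootCoeff j : ℚ) / (b'.coroot x : ℚ)) ∧ (b.corootCoeff i : ℚ) / (b.coroot x : ℚ) <
      (b'.corootCoeff i : ℚ) / (b'.coroot x : ℚ)) Iff.rfl ?_
  simp only [e3, e4]
  rfl

/-- The functionals of positive roots vanish at no crossing point but that of their own
hyperplane. -/
theorem isBefore_neg_iff {q : D.PosRoot × ℤ} (hq : 0 < q.1.coroot x) {b : D.PosRoot}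
    (hb : 0 ≤ b.coroot x) (hbq : b ≠ q.1) {l : ℤ} :
    IsBefore x q (-b.coroot) (-l) ↔ ¬ IsBefore x q b.coroot l := by
  have h1 : sideFst x q (-b.coroot) (-l) = -sideFst x q b.coroot l := by
    simp only [sideFst, LinearMap.neg_apply]; ring
  have h2 : ∀ i, sideSnd x q (-b.coroot) i = -sideSnd x q b.coroot i := fun i => by
    simp only [sideSnd, LinearMap.neg_apply]; ring
  obtain ⟨i, hi, hmin⟩ : ∃ i, sideSnd x q b.coroot i ≠ 0 ∧
      ∀ j < i, sideSnd x q b.coroot j = 0 := by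
    have hne : (Finset.univ.filter fun i => sideSnd x q b.coroot i ≠ 0).Nonempty := by
      by_contra hno
      rw [Finset.not_nonempty_iff_eq_empty, Finset.filter_eq_empty_iff] at hno
      have hz : ∀ i, q.1.coroot x * b.corootCoeff i = b.coroot x * q.1.corootCoeff i := by
        intro i
        have := not_not.1 (hno (Finset.mem_univ i))
        rw [b.corootCoeff_eq, q.1.corootCoeff_eq]
        unfold sideSnd at this
        omega
      rcases hb.eq_or_lt with hb0 | hb0
      · have hzero : b.coroot = 0 := by
          rw [b.coroot_eq]
          refine Finset.sum_eq_zero fun i _ => ?_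
          have := hz i
          rw [← hb0, zero_mul, mul_eq_zero] at this
          rw [this.resolve_left hq.ne', zero_smul]
        have := b.coroot_rho_pos
        rw [hzero] at this
        exact lt_irrefl _ this
      · refine hbq (CartanDatum.PosRoot.eq_of_proportional (r := q.1.coroot x) (s := b.coroot x)
          (by exact_mod_cast hq) (by exact_mod_cast hb0) fun i => ?_)
        exact_mod_cast hz i
    obtain ⟨i, hi, hmin⟩ := Finset.exists_min_image _ id hne
    simp only [Finset.mem_filter, Finset.mem_univ, true_and, id_eq] at hi hmin
    exact ⟨i, hi, fun j hj => by
      by_contra hj0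
      exact not_le.2 hj (hmin j hj0)⟩
  have key : ∀ (s : I → ℤ), s i ≠ 0 → (∀ j < i, s j = 0) →
      ((∃ k, (∀ j < k, s j = 0) ∧ s k < 0) ↔ s i < 0) := by
    intro s hs hs0
    refine ⟨?_, fun h => ⟨i, hs0, h⟩⟩
    rintro ⟨k, hk, hk0⟩
    rcases lt_trichotomy k i with h | rfl | h
    · exact absurd (hs0 k h) hk0.ne
    · exact hk0
    · exact absurd (hk i h) hs
  simp only [IsBefore, h1, h2]
  have hk2 := key (fun j => -sideSnd x q b.coroot j) (by simpa using hi)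
    (fun j hj => by simp [hmin j hj])
  rw [key _ hi hmin, hk2]
  omega

/-- For each positive root `b`, the pairs `(b, l)` that precede `q` are those with `l` below a bound
between `0` and `⟨x, b^∨⟩`. -/
theorem exists_isBefore_bound {q : D.PosRoot × ℤ} (hq : 0 ≤ q.2 ∧ q.2 < q.1.coroot x)
    (b : D.PosRoot) (hb : 0 ≤ b.coroot x) :
    ∃ N : ℤ, 0 ≤ N ∧ N ≤ b.coroot x ∧ ∀ l, IsBefore x q b.coroot l ↔ l < N := by
  have hq0 : 0 < q.1.coroot x := hq.1.trans_lt hq.2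
  have hneg : ∀ l, l < 0 → IsBefore x q b.coroot l := by
    intro l hl
    left
    unfold sideFst
    nlinarith [mul_nonneg hb hq.1]
  have htop : ¬ IsBefore x q b.coroot (b.coroot x) := by
    have h0 : 0 ≤ sideFst x q b.coroot (b.coroot x) := by
      unfold sideFst
      nlinarith
    rintro (h | ⟨h, i, -, hi⟩)
    · omega
    · have : b.coroot x = 0 := by
        unfold sideFst at h
        have : b.coroot x * (q.1.coroot x - q.2) = 0 := by linarith
        rcases mul_eq_zero.1 this with h | h
        · exact h
        · omega
      unfold sideSnd at hi
      rw [this] at hi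
      nlinarith [b.coroot_fundWeight_nonneg i]
  have hmono : ∀ l l', l ≤ l' → IsBefore x q b.coroot l' → IsBefore x q b.coroot l := by
    intro l l' hl h
    rcases hl.eq_or_lt with rfl | hl
    · exact h
    · left
      have h1 : sideFst x q b.coroot l < sideFst x q b.coroot l' := by
        unfold sideFst
        nlinarith
      rcases h with h | ⟨h, -⟩ <;> omega
  obtain ⟨N, hN, hmin⟩ := Int.exists_least_of_bdd (P := fun l => ¬ IsBefore x q b.coroot l)
    ⟨0, fun l hl => not_lt.1 fun h => hl (hneg l h)⟩ ⟨_, htop⟩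
  refine ⟨N, not_lt.1 fun h => hN (hneg N h), hmin _ htop, fun l => ⟨fun h => ?_, fun h => ?_⟩⟩
  · by_contra hl
    exact hN (hmono N l (not_lt.1 hl) h)
  · by_contra hl
    exact not_le.2 h (hmin l hl)

/-- A weight with nonnegative values on all coroots of positive roots. -/
def IsDominant (D : CartanDatum A P) (x : P) : Prop := ∀ b : D.PosRoot, 0 ≤ b.coroot x

theorem exists_cutLevel (hx : IsDominant D x) (k : WithTop (lex D x).Idx) (b : D.PosRoot) :
    ∃ N : ℤ, 0 ≤ N ∧ N ≤ b.coroot x ∧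
      (∀ p, (lex D x).root p = b → ((p : WithTop (lex D x).Idx) < k ↔ (lex D x).level p < N)) ∧
      (k = ⊤ → N = b.coroot x) ∧
      ∀ q : (lex D x).Idx, k = q →
        ∀ l, IsBefore x ((lex D x).position q) b.coroot l ↔ l < N := by
  induction k using WithTop.recTopCoe with
  | top =>
    refine ⟨b.coroot x, hx b, le_rfl, ?_, fun _ => rfl, fun q hq => absurd hq.symm
      WithTop.coe_ne_top⟩
    rintro p rfl
    exact iff_of_true (WithTop.coe_lt_top _) p.2.2
  | coe q =>
    obtain ⟨N, h1, h2, h3⟩ :=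
      exists_isBefore_bound (x := x) (q := (lex D x).position q) q.2 b (hx b)
    refine ⟨N, h1, h2, ?_, fun h => absurd h WithTop.coe_ne_top, ?_⟩
    · rintro p rfl
      rw [WithTop.coe_lt_coe, lex_lt_iff, h3]
    · intro q' hq'
      rw [← WithTop.coe_injective hq']
      exact h3

/-- The number of levels at which the hyperplanes of the positive root `b` occur in the lex chain to
the left of the cut `k`. -/
noncomputable def cutLevel (hx : IsDominant D x) (k : WithTop (lex D x).Idx) (b : D.PosRoot) : ℤ :=
  (exists_cutLevel hx k b).choose

section CutLevel

variable (hx : IsDominant D x) (k : WithTop (lex D x).Idx) (b : D.PosRoot)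

theorem cutLevel_nonneg : 0 ≤ cutLevel hx k b := (exists_cutLevel hx k b).choose_spec.1

theorem cutLevel_le : cutLevel hx k b ≤ b.coroot x := (exists_cutLevel hx k b).choose_spec.2.1

theorem lt_cut_iff {p : (lex D x).Idx} (hp : (lex D x).root p = b) :
    (p : WithTop (lex D x).Idx) < k ↔ (lex D x).level p < cutLevel hx k b :=
  (exists_cutLevel hx k b).choose_spec.2.2.1 p hp

theorem cutLevel_top : cutLevel hx ⊤ b = b.coroot x :=
  (exists_cutLevel hx ⊤ b).choose_spec.2.2.2.1 rfl

theorem isBefore_iff_lt_cutLevel (q : (lex D x).Idx) (l : ℤ) :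
    IsBefore x ((lex D x).position q) b.coroot l ↔ l < cutLevel hx q b :=
  (exists_cutLevel hx q b).choose_spec.2.2.2.2 q rfl l

end CutLevel

theorem cutLevel_self (hx : IsDominant D x) (q : (lex D x).Idx) :
    cutLevel hx q ((lex D x).root q) = (lex D x).level q :=
  _root_.eq_of_forall_lt_iff fun l => by
    rw [← isBefore_iff_lt_cutLevel]
    exact isBefore_self_iff (q := (lex D x).position q) (coroot_pos_of_idx q)

/-- A reflection that preserves the sign of a root preserves the number of its levels before the
reflecting hyperplane, up to the shift by the affine reflection. -/
theorem cutLevel_reflect (hx : IsDominant D x) (q : (lex D x).Idx) {b b' : D.PosRoot} {e : ℤ}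
    (h : b'.coroot = b.coroot - e • ((lex D x).root q).coroot) :
    cutLevel hx q b' = cutLevel hx q b - e * (lex D x).level q :=
  _root_.eq_of_forall_lt_iff fun l => by
    have : IsBefore x ((lex D x).position q) (b.coroot - e • ((lex D x).root q).coroot)
        (l + e * (lex D x).level q - e * (lex D x).level q) ↔ _ := isBefore_reflect
    rw [← isBefore_iff_lt_cutLevel, h, lt_sub_iff_add_lt, ← isBefore_iff_lt_cutLevel, ← this,
      add_sub_cancel_right]

/-- A reflection that changes the sign of a root exchanges the levels before and after the
reflecting hyperplane. -/
theorem cutLevel_reflect_neg (hx : IsDominant D x) (q : (lex D x).Idx) {b b' : D.PosRoot} {e : ℤ}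
    (hb : b ≠ (lex D x).root q) (h : b'.coroot = e • ((lex D x).root q).coroot - b.coroot) :
    cutLevel hx q b' = e * (lex D x).level q - cutLevel hx q b + 1 :=
  _root_.eq_of_forall_lt_iff fun l => by
    have h1 : IsBefore x ((lex D x).position q) (-b.coroot - (-e) • ((lex D x).root q).coroot)
        (-(e * (lex D x).level q - l) - (-e) * (lex D x).level q) ↔ _ := isBefore_reflect
    have h2 : -b.coroot - (-e) • ((lex D x).root q).coroot = b'.coroot := by rw [h]; module
    have h3 : -(e * (lex D x).level q - l) - (-e) * (lex D x).level q = l := by ring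
    rw [h2, h3] at h1
    rw [← isBefore_iff_lt_cutLevel, h1, isBefore_neg_iff (q := (lex D x).position q)
      (coroot_pos_of_idx q) (hx b) hb, isBefore_iff_lt_cutLevel hx]
    omega

end RootChain

/-! ### The heights of a signature count levels -/

namespace RootChain

section General

variable {I : Type u} [DecidableEq I] {A : Matrix I I ℤ} {P : Type v} [AddCommGroup P]
  {D : CartanDatum A P} {Γ : RootChain D}

theorem gam_eq_tau {J : Finset Γ.Idx} {a : Γ.Idx} (h : ∀ j ∈ J, j < a) :
    Γ.gam J a = Γ.tau J (Γ.root a).root := by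
  rw [gam_eq, cutProd, Finset.filter_true_of_mem fun j hj => WithTop.coe_lt_coe.2 (h j hj)]

/-- The positions of the positive root `b` to the left of the cut `k`. -/
noncomputable def IsFinitary.before (hΓ : Γ.IsFinitary) (b : D.PosRoot) (k : WithTop Γ.Idx) :
    Finset Γ.Idx :=
  (hΓ b).toFinset.filter fun a : Γ.Idx => (a : WithTop Γ.Idx) < k

theorem IsFinitary.mem_before (hΓ : Γ.IsFinitary) {b : D.PosRoot} {k : WithTop Γ.Idx} {a : Γ.Idx} :
    a ∈ hΓ.before b k ↔ Γ.root a = b ∧ (a : WithTop Γ.Idx) < k := by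
  simp [IsFinitary.before]

open Classical in
theorem ite_gam_eq {J : Finset Γ.Idx} {a : Γ.Idx} (ha : ∀ j ∈ J, j < a)
    {i : I} {ε : ℤ} (hε : ε = 1 ∨ ε = -1)
    (h : Γ.tau J (Γ.root a).root = ε • D.simpleRoot i) :
    (if Γ.gam J a = D.simpleRoot i then (1 : ℤ) else -1) = ε := by
  rw [gam_eq_tau ha, h]
  rcases hε with rfl | rfl
  · rw [one_smul, if_pos rfl]
  · rw [neg_one_smul, if_neg (neg_simpleRoot_ne i)]

variable [Fintype I]

theorem _root_.CartanDatum.PosRoot.ext_root {b b' : D.PosRoot} (h : b.root = b'.root) : b = b' := by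
  have h1 := b'.isReal
  rw [← h] at h1
  exact CartanDatum.PosRoot.ext h (b.isReal.coroot_unique h1)

theorem _root_.CartanDatum.PosRoot.ext_coroot {b b' : D.PosRoot} (h : b.coroot = b'.coroot) :
    b = b' := by
  have h1 := b'.isReal
  rw [← h] at h1
  exact CartanDatum.PosRoot.ext (b.isReal.root_unique h1) h

theorem exists_posRoot_apply_eq {g : P ≃ₗ[ℤ] P} (hg : g ∈ D.weylGroup) (i : I) :
    ∃ (b : D.PosRoot) (ε : ℤ), (ε = 1 ∨ ε = -1) ∧ g b.root = ε • D.simpleRoot i := by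
  have h := (CartanDatum.IsRealRoot.simple (D := D) i).apply (inv_mem hg)
  rcases h.mem_posCone_or_neg with h1 | h1
  · exact ⟨⟨_, _, h, h1⟩, 1, Or.inl rfl, by simp⟩
  · exact ⟨⟨_, _, h.neg, h1⟩, -1, Or.inr rfl, by simp⟩

theorem simpleCoroot_apply_of_apply_eq_smul {g : P ≃ₗ[ℤ] P} (hg : g ∈ D.weylGroup)
    {b : D.PosRoot} {i : I} {ε : ℤ} (hε : ε = 1 ∨ ε = -1) (h : g b.root = ε • D.simpleRoot i)
    (x : P) : D.simpleCoroot i (g x) = ε * b.coroot x := by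
  rcases hε with rfl | rfl
  · rw [one_smul] at h
    rw [simpleCoroot_apply_of_apply_eq hg h, one_mul]
  · rw [neg_one_smul] at h
    rw [simpleCoroot_apply_of_apply_eq_neg hg h, neg_one_mul]

theorem mem_rootSet_iff_of_apply_eq {J : Finset Γ.Idx} {a : Γ.Idx} (ha : ∀ j ∈ J, j < a)
    {b : D.PosRoot} {i : I} {ε : ℤ} (hε : ε = 1 ∨ ε = -1)
    (h : Γ.tau J b.root = ε • D.simpleRoot i) :
    a ∈ Γ.rootSet J i ↔ Γ.root a = b := by
  have key : Γ.root a = b ↔ Γ.gam J a = ε • D.simpleRoot i := by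
    rw [gam_eq_tau ha, ← h, (Γ.tau J).injective.eq_iff]
    exact ⟨fun h => by rw [h], CartanDatum.PosRoot.ext_root⟩
  refine ⟨fun hr => ?_, fun hr => ?_⟩
  · -- otherwise `- b` would be the positive root at `a`
    have hneg : Γ.gam J a ≠ -(ε • D.simpleRoot i) := by
      rw [gam_eq_tau ha, ← h, ← map_neg]
      intro h'
      have h2 := (Γ.tau J).injective h'
      have h3 := b.isReal.neg
      rw [← h2] at h3
      have h4 := (Γ.root a).isReal.coroot_unique h3
      have h5 := (Γ.root a).coroot_rho_pos
      have h6 := b.coroot_rho_pos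
      rw [h4, LinearMap.neg_apply] at h5
      omega
    rw [key]
    rcases hε with rfl | rfl
    · rw [one_smul] at hneg ⊢
      exact hr.resolve_right hneg
    · rw [neg_one_smul] at hneg ⊢
      rw [neg_neg] at hneg
      exact hr.resolve_left hneg
  · have h1 := key.1 hr
    rcases hε with rfl | rfl
    · left; rw [h1, one_smul]
    · right; rw [h1, neg_one_smul]

theorem sigHeight_empty (hΓ : Γ.IsFinitary) {b : D.PosRoot} {i : I} (h : b.root = D.simpleRoot i)
    (k : WithTop Γ.Idx) : hΓ.sigHeight ∅ i k = (hΓ.before b k).card := by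
  classical
  have h' : Γ.tau ∅ b.root = (1 : ℤ) • D.simpleRoot i := by simp [h]
  have hS : (hΓ.letters ∅ i).filter (fun a : Γ.Idx => (a : WithTop Γ.Idx) < k) = hΓ.before b k := by
    ext a
    rw [Finset.mem_filter, hΓ.mem_letters, hΓ.mem_before,
      mem_rootSet_iff_of_apply_eq (by simp) (Or.inl rfl) h']
    simp
  unfold IsFinitary.sigHeight SignWord.height
  rw [hS, Finset.card_eq_sum_ones, Nat.cast_sum]
  refine Finset.sum_congr rfl fun a ha => ?_
  rw [hΓ.mem_before] at ha
  rw [← ha.1] at h'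
  simpa using ite_gam_eq (by simp) (Or.inl rfl) h'

open Classical in
/-- The letters to the right of the last folding position `j` belong to a single positive root and
have the same sign. -/
theorem sigHeight_insert_max (hΓ : Γ.IsFinitary) {J : Finset Γ.Idx} {j : Γ.Idx}
    (hJ : ∀ a ∈ J, a < j) {k : WithTop Γ.Idx} (hk : (j : WithTop Γ.Idx) < k) {b : D.PosRoot} {i : I}
    {ε : ℤ} (hε : ε = 1 ∨ ε = -1) (h : Γ.tau (insert j J) b.root = ε • D.simpleRoot i) :
    hΓ.sigHeight (insert j J) i k = hΓ.sigHeight J i j +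
      ε * ((hΓ.before b k).card - (hΓ.before b j).card - if Γ.root j = b then 1 else 0) := by
  set S := hΓ.letters (insert j J) i with hS
  set T : Finset Γ.Idx := (hΓ.before b k).filter fun a => j < a with hT
  have hlt : ∀ a, j < a → ∀ c ∈ insert j J, c < a := by
    intro a ha c hc
    rcases Finset.mem_insert.1 hc with rfl | hc
    · exact ha
    · exact (hJ c hc).trans ha
  have hsplit : S.filter (fun a : Γ.Idx => (a : WithTop Γ.Idx) < k) =
      (hΓ.letters J i).filter (fun a : Γ.Idx => (a : WithTop Γ.Idx) < j) ∪ T := by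
    ext a
    simp only [hS, hT, Finset.mem_union, Finset.mem_filter, hΓ.mem_letters, hΓ.mem_before]
    rcases lt_trichotomy a j with hlt' | rfl | hgt
    · have h1 : a ∈ Γ.rootSet (insert j J) i ↔ a ∈ Γ.rootSet J i := by
        unfold rootSet
        rw [Set.mem_ofPred, Set.mem_ofPred, Γ.gam_insert_of_le J hlt'.le]
      simp [h1, hlt', hlt'.ne, not_lt.2 hlt'.le, (WithTop.coe_lt_coe.2 hlt').trans hk]
    · simp
    · rw [mem_rootSet_iff_of_apply_eq (hlt a hgt) hε h]
      have h2 : a ∉ J := fun ha => lt_asymm hgt (hJ a ha)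
      simp [hgt, hgt.ne', not_lt.2 hgt.le, h2]
  have hdisj : Disjoint ((hΓ.letters J i).filter fun a : Γ.Idx => (a : WithTop Γ.Idx) < j) T := by
    rw [Finset.disjoint_left]
    intro a ha haT
    simp only [hT, Finset.mem_filter, WithTop.coe_lt_coe] at ha haT
    exact lt_asymm ha.2 haT.2
  have hcard : (T.card : ℤ) =
      (hΓ.before b k).card - (hΓ.before b j).card - if Γ.root j = b then 1 else 0 := by
    have h1 : hΓ.before b k = T ∪ (hΓ.before b j ∪ if Γ.root j = b then {j} else ∅) := by
      ext a
      simp only [hT, Finset.mem_union, Finset.mem_filter, hΓ.mem_before, WithTop.coe_lt_coe]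
      rcases lt_trichotomy a j with hlt' | rfl | hgt
      · have : (a : WithTop Γ.Idx) < k := (WithTop.coe_lt_coe.2 hlt').trans hk
        split_ifs <;> simp [hlt', hlt'.ne, not_lt.2 hlt'.le, this]
      · split_ifs with h <;> simp [h, hk]
      · split_ifs <;> simp [hgt, hgt.ne', not_lt.2 hgt.le]
    have h2 : (hΓ.before b k).card =
        T.card + ((hΓ.before b j).card + if Γ.root j = b then 1 else 0) := by
      rw [h1, Finset.card_union_of_disjoint, Finset.card_union_of_disjoint]
      · split_ifs <;> simp
      · split_ifs
        · simp [hΓ.mem_before]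
        · simp
      · rw [Finset.disjoint_left]
        intro a ha ha'
        have hja : j < a := (Finset.mem_filter.1 ha).2
        rcases Finset.mem_union.1 ha' with h3 | h3
        · exact lt_asymm hja (WithTop.coe_lt_coe.1 (hΓ.mem_before.1 h3).2)
        · split_ifs at h3
          · exact hja.ne' (Finset.mem_singleton.1 h3)
          · simp at h3
    rw [h2]
    push_cast
    ring
  unfold IsFinitary.sigHeight SignWord.height
  rw [hsplit, Finset.sum_union hdisj]
  refine congrArg₂ (· + ·) (Finset.sum_congr rfl fun a ha => ?_) ?_
  · rw [Finset.mem_filter] at ha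
    beta_reduce
    rw [Γ.gam_insert_of_le J (WithTop.coe_lt_coe.1 ha.2).le]
  · rw [← hcard, mul_comm, ← nsmul_eq_mul, ← Finset.sum_const]
    refine Finset.sum_congr rfl fun a ha => ?_
    simp only [hT, Finset.mem_filter, hΓ.mem_before] at ha
    refine ite_gam_eq (hlt a ha.2) hε ?_
    rw [ha.1.1, h]

/-- The height at a cut depends only on the folding positions to its left. -/
theorem sigHeight_filter (hΓ : Γ.IsFinitary) (J : Finset Γ.Idx) (i : I) (k : WithTop Γ.Idx) :
    hΓ.sigHeight (J.filter fun j : Γ.Idx => (j : WithTop Γ.Idx) < k) i k = hΓ.sigHeight J i k := by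
  have hg : ∀ a : Γ.Idx, (a : WithTop Γ.Idx) < k →
      Γ.gam (J.filter fun j : Γ.Idx => (j : WithTop Γ.Idx) < k) a = Γ.gam J a := by
    intro a ha
    refine Γ.gam_congr fun j hj => ?_
    simp [(WithTop.coe_lt_coe.2 hj).trans ha]
  unfold IsFinitary.sigHeight SignWord.height
  refine Finset.sum_congr ?_ fun a ha => ?_
  · ext a
    simp only [Finset.mem_filter, hΓ.mem_letters]
    refine and_congr_left fun ha => ?_
    unfold rootSet
    simp only [Set.mem_ofPred, hg a ha, ha, and_true]
  · rw [Finset.mem_filter] at ha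
    beta_reduce
    rw [hg a ha.2]

end General

variable {I : Type u} [Fintype I] [LinearOrder I] {A : Matrix I I ℤ} {P : Type v}
  [AddCommGroup P] {D : CartanDatum A P} {x : P}

theorem isFinitary_lex : (lex D x).IsFinitary := by
  intro b
  refine Set.Finite.of_finite_image (f := (lex D x).level)
    ((Set.finite_Ico 0 (b.coroot x)).subset ?_) ?_
  · rintro _ ⟨p, rfl, rfl⟩
    exact p.2
  · intro p hp q hq h
    exact Subtype.ext (Prod.ext (hp.trans hq.symm) h)

theorem card_before (hx : IsDominant D x) (b : D.PosRoot) (k : WithTop (lex D x).Idx) :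
    ((isFinitary_lex.before b k).card : ℤ) = cutLevel hx k b := by
  have h0 := cutLevel_nonneg hx k b
  have h1 : (isFinitary_lex.before b k).image (lex D x).level = Finset.Ico 0 (cutLevel hx k b) := by
    ext l
    simp only [Finset.mem_image, isFinitary_lex.mem_before, Finset.mem_Ico]
    constructor
    · rintro ⟨p, ⟨hp, hpk⟩, rfl⟩
      exact ⟨p.2.1, (lt_cut_iff hx k b hp).1 hpk⟩
    · rintro ⟨hl0, hl⟩
      let p : (lex D x).Idx := ⟨(b, l), hl0, hl.trans_le (cutLevel_le hx k b)⟩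
      exact ⟨p, ⟨rfl, (lt_cut_iff hx k b (p := p) rfl).2 hl⟩, rfl⟩
  have h2 : (isFinitary_lex.before b k).card = (cutLevel hx k b).toNat := by
    rw [← Finset.card_image_of_injOn (f := (lex D x).level), h1, Int.card_Ico, sub_zero]
    intro p hp q hq h
    exact Subtype.ext (Prod.ext ((isFinitary_lex.mem_before.1 hp).1.trans
      (isFinitary_lex.mem_before.1 hq).1.symm) h)
  omega

/-- The height of the `i`-signature at a cut `k` to the right of all folding positions. Let
`τ(J) b = ε α_i`, let `N` be the number of levels of `b` before `k`, and let `n` be the pairing of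
`α_i^∨` with the translation part of `r̂_{j_1} ⋯ r̂_{j_p}`. The height is `N - n` if `ε = 1` and
`1 - N - n` if `ε = -1`; the equation, multiplied by two, covers both cases. -/
theorem sigHeight_eq_of_forall_lt (hx : IsDominant D x) (i : I) (J : Finset (lex D x).Idx) :
    ∀ (k : WithTop (lex D x).Idx), (∀ j ∈ J, (j : WithTop (lex D x).Idx) < k) →
    ∀ (b : D.PosRoot) (ε : ℤ), (ε = 1 ∨ ε = -1) → (lex D x).tau J b.root = ε • D.simpleRoot i →
    2 * isFinitary_lex.sigHeight J i k =
      2 * ε * cutLevel hx k b + (1 - ε) - 2 * D.simpleCoroot i ((lex D x).tauHat J 0) := by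
  classical
  induction J using Finset.induction_on_max with
  | empty =>
    intro k _ b ε hε h
    simp only [tau_empty, LinearEquiv.coe_one, id] at h
    rcases hε with rfl | rfl
    · rw [one_smul] at h
      rw [sigHeight_empty isFinitary_lex h, card_before hx]
      simp
    · exfalso
      rw [neg_one_smul] at h
      have h1 := (CartanDatum.IsRealRoot.simple (D := D) i).neg
      rw [← h] at h1
      have h2 := b.coroot_rho_pos
      rw [b.isReal.coroot_unique h1, LinearMap.neg_apply, CartanDatum.simpleCoroot_rho] at h2
      omega
  | insert j J hJ ih =>
    intro k hk b' ε' hε' h'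
    have hjk := hk j (Finset.mem_insert_self j J)
    obtain ⟨b, ε, hε, h⟩ := exists_posRoot_apply_eq ((lex D x).tau_mem J) i
    have hih := ih j (fun a ha => WithTop.coe_lt_coe.2 (hJ a ha)) b ε hε h
    have hy := simpleCoroot_apply_of_apply_eq_smul ((lex D x).tau_mem J) hε h
    have hy' := simpleCoroot_apply_of_apply_eq_smul ((lex D x).tau_mem _) hε' h'
    rw [sigHeight_insert_max isFinitary_lex hJ hjk hε' h', card_before hx, card_before hx]
    set q := (lex D x).root j with hq
    set c := D.simpleCoroot i ((lex D x).tau J q.root) with hc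
    have hn : D.simpleCoroot i ((lex D x).tauHat (insert j J) 0) =
        D.simpleCoroot i ((lex D x).tauHat J 0) - (lex D x).level j * c := by
      rw [tauHat_insert_max _ hJ, tauHat_eq, CartanDatum.PosRoot.affineReflection, map_zero,
        zero_sub, zero_sub, neg_neg, map_neg, map_smul, map_add, map_neg, map_smul, smul_eq_mul]
      ring
    -- the functionals `⟨τ(J)(·), α_i^∨⟩` before and after the folding position `j`
    have hrel : ε' • b'.coroot = ε • b.coroot - c • q.coroot := by
      ext z
      simp only [LinearMap.smul_apply, LinearMap.sub_apply, smul_eq_mul]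
      rw [← hy', ← hy, tau_insert_max _ hJ, LinearEquiv.mul_apply,
        CartanDatum.PosRoot.reflection_apply, map_sub, map_smul, map_sub, map_smul, smul_eq_mul,
        mul_comm]
    have hcb : c = ε * b.coroot q.root := hy _
    have hcb' : ε' * b'.coroot q.root = -c := by
      have := LinearMap.congr_fun hrel q.root
      simp only [LinearMap.smul_apply, LinearMap.sub_apply, smul_eq_mul, q.isReal.pairing_self]
        at this
      rw [this, hcb]
      ring
    have hbq : b = q → ε' = -ε ∧ b' = q := by
      intro hb
      rw [hb, q.isReal.pairing_self] at hcb
      have h2 : b'.coroot = (-ε * ε') • q.coroot := by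
        have h3 : (ε' * ε') • b'.coroot = (-ε * ε') • q.coroot := by
          rw [mul_smul, hrel, hb, hcb]
          module
        rcases hε' with rfl | rfl <;> simpa using h3
      have h4 := b'.coroot_rho_pos
      have h5 := q.coroot_rho_pos
      have h6 : ε' = -ε := by
        rcases hε with rfl | rfl <;> rcases hε' with rfl | rfl <;> try rfl
        all_goals
          rw [h2] at h4
          simp only [LinearMap.smul_apply, smul_eq_mul] at h4
          omega
      refine ⟨h6, CartanDatum.PosRoot.ext_coroot ?_⟩
      rw [h2, h6]
      rcases hε with rfl | rfl <;> simp
    have hb'q : b' = q → b = q := by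
      intro hb
      rw [hb, q.isReal.pairing_self] at hcb'
      have h2 : b.coroot = (-ε * ε') • q.coroot := by
        have h3 : (ε * ε) • b.coroot = (-ε * ε') • q.coroot := by
          rw [mul_smul, eq_add_of_sub_eq hrel.symm, hb, ← neg_eq_iff_eq_neg.2 hcb']
          module
        rcases hε with rfl | rfl <;> simpa using h3
      have h4 := b.coroot_rho_pos
      have h5 := q.coroot_rho_pos
      refine CartanDatum.PosRoot.ext_coroot ?_
      rcases hε with rfl | rfl <;> rcases hε' with rfl | rfl
      · rw [h2] at h4
        simp only [LinearMap.smul_apply, smul_eq_mul] at h4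
        omega
      · simpa using h2
      · simpa using h2
      · rw [h2] at h4
        simp only [LinearMap.smul_apply, smul_eq_mul] at h4
        omega
    rw [hn]
    -- If `b` is the root of the folding position itself, so is `b'`, and the position `j` is a level
    -- of it; otherwise the numbers of levels before `j` are related by the reflection at `j`.
    by_cases hbq0 : b = q
    · obtain ⟨h1, h2⟩ := hbq hbq0
      rw [if_pos h2.symm]
      have h3 := cutLevel_self hx j
      rw [← hq] at h3
      rw [hbq0, h3] at hih
      rw [hbq0, q.isReal.pairing_self] at hcb
      rw [h2, h3]
      rcases hε with rfl | rfl
      · subst h1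
        rw [hcb]
        linarith
      · subst h1
        rw [hcb]
        linarith
    · rw [if_neg fun h0 => hbq0 (hb'q h0.symm)]
      rcases hε with rfl | rfl <;> rcases hε' with rfl | rfl
      · have := cutLevel_reflect hx j (b := b) (b' := b') (e := c) (by simpa using hrel)
        linarith
      · have := cutLevel_reflect_neg hx j (b := b) (b' := b') (e := c) hbq0
          (by rw [← neg_inj, show -b'.coroot = b.coroot - c • q.coroot by simpa using hrel]; module)
        linarith
      · have := cutLevel_reflect_neg hx j (b := b) (b' := b') (e := -c) hbq0
          (by rw [show b'.coroot = _ by simpa using hrel]; module)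
        linarith
      · have := cutLevel_reflect hx j (b := b) (b' := b') (e := -c)
          (by
            rw [← neg_inj, show -b'.coroot = -b.coroot - c • q.coroot by simpa using hrel]
            module)
        linarith

end RootChain

/-! ### String lengths -/

namespace CrystalData

theorem iterate_bind_none {B : Type w} (g : B → Option B) (k : ℕ) :
    (fun o : Option B => o.bind g)^[k] none = none := by
  induction k with
  | zero => rfl
  | succ k ih => rw [Function.iterate_succ_apply]; exact ih

theorem iterate_bind_ne_none_iff {B : Type w} {g : B → Option B} {n : B → ℕ}
    (h0 : ∀ b, g b = none ↔ n b = 0) (h1 : ∀ b b', g b = some b' → n b = n b' + 1) (k : ℕ) (b : B) :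
    (fun o : Option B => o.bind g)^[k] (some b) ≠ none ↔ k ≤ n b := by
  induction k generalizing b with
  | zero => simp
  | succ k ih =>
    rw [Function.iterate_succ_apply, Option.bind_some]
    cases hb : g b with
    | none => rw [iterate_bind_none, (h0 b).1 hb]; simp
    | some b' => rw [ih, h1 b b' hb]; omega

/-- A function that drops by one along `g` and vanishes exactly at the ends of the strings is the
string length. -/
theorem stringLength_eq {B : Type w} {g : B → Option B} {n : B → ℕ}
    (h0 : ∀ b, g b = none ↔ n b = 0) (h1 : ∀ b b', g b = some b' → n b = n b' + 1) (b : B) :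
    stringLength g b = n b := by
  have : {k | (fun o : Option B => o.bind g)^[k] (some b) ≠ none} = Set.Iic (n b) := by
    ext k
    exact iterate_bind_ne_none_iff h0 h1 k b
  rw [stringLength, this, csSup_Iic]

end CrystalData

/-! ### The crystal of a lex chain -/

namespace RootChain

section General

variable {I : Type u} [DecidableEq I] {A : Matrix I I ℤ} {P : Type v} [AddCommGroup P]
  {D : CartanDatum A P} {Γ : RootChain D}

variable (Γ) in
theorem weight_eq_sub (x : P) (J : Finset Γ.Idx) :
    Γ.weight x J = Γ.tau J x - Γ.tauHat J 0 := by
  rw [weight_eq, tauHat_eq, map_neg]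
  abel

theorem admissible_empty (Γ : RootChain D) : Γ.Admissible ∅ := by simp [Admissible]

variable [Fintype I]

/-- The maximal height of the `i`-signature of `J`. -/
noncomputable def IsFinitary.maxHeight (hΓ : Γ.IsFinitary) (J : Finset Γ.Idx) (i : I) : ℤ :=
  (SignWord.exists_height_max (hΓ.letters J i) fun k => Γ.gam J k = D.simpleRoot i).choose

variable (hΓ : Γ.IsFinitary) (J : Finset Γ.Idx) (i : I)

theorem IsFinitary.sigHeight_le_maxHeight (k : WithTop Γ.Idx) :
    hΓ.sigHeight J i k ≤ hΓ.maxHeight J i :=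
  (SignWord.exists_height_max (hΓ.letters J i)
    fun k => Γ.gam J k = D.simpleRoot i).choose_spec.1 k

theorem IsFinitary.exists_sigHeight_eq_maxHeight :
    ∃ k, hΓ.sigHeight J i k = hΓ.maxHeight J i :=
  (SignWord.exists_height_max (hΓ.letters J i)
    fun k => Γ.gam J k = D.simpleRoot i).choose_spec.2

theorem IsFinitary.maxHeight_nonneg : 0 ≤ hΓ.maxHeight J i := by
  rw [← SignWord.height_eq_zero (plus := fun k => Γ.gam J k = D.simpleRoot i)
    (k := (hΓ.letters J i).min) fun a ha => not_lt.2 (Finset.min_le ha)]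
  exact hΓ.sigHeight_le_maxHeight J i _

variable {hΓ J i}

theorem Moves.maxHeight {J' : Finset Γ.Idx} (h : Moves hΓ i J J') :
    hΓ.maxHeight J i = hΓ.maxHeight J' i + 1 := by
  obtain ⟨h1, k, hk⟩ := h.height_max hΓ (hΓ.sigHeight_le_maxHeight J i)
    (hΓ.exists_sigHeight_eq_maxHeight J i)
  obtain ⟨k', hk'⟩ := hΓ.exists_sigHeight_eq_maxHeight J' i
  have h2 := h1 k'
  have h3 := hΓ.sigHeight_le_maxHeight J' i k
  omega

theorem fOp_eq_none_iff_maxHeight (hΓ : Γ.IsFinitary) {J : Γ.Al} :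
    Γ.fOp i J = none ↔ hΓ.maxHeight J.1 i = 0 := by
  rw [fOp_eq_none_iff hΓ]
  refine ⟨fun h => le_antisymm ?_ (hΓ.maxHeight_nonneg J.1 i), fun h k => ?_⟩
  · obtain ⟨k, hk⟩ := hΓ.exists_sigHeight_eq_maxHeight J.1 i
    rw [← hk]
    exact h k
  · rw [← h]
    exact hΓ.sigHeight_le_maxHeight J.1 i k

theorem stringLength_fOp (hΓ : Γ.IsFinitary) (i : I) (J : Γ.Al) :
    (CrystalData.stringLength (Γ.fOp i) J : ℤ) = hΓ.maxHeight J.1 i := by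
  rw [CrystalData.stringLength_eq (n := fun J => (hΓ.maxHeight J.1 i).toNat)]
  · exact Int.toNat_of_nonneg (hΓ.maxHeight_nonneg J.1 i)
  · intro J
    rw [fOp_eq_none_iff_maxHeight hΓ]
    have := hΓ.maxHeight_nonneg J.1 i
    omega
  · intro J J' h
    have h1 := ((fOp_eq_some_iff hΓ).1 h).maxHeight
    have h2 := hΓ.maxHeight_nonneg J'.1 i
    omega

end General

variable {I : Type u} [Fintype I] [LinearOrder I] {A : Matrix I I ℤ} {P : Type v}
  [AddCommGroup P] {D : CartanDatum A P} {x : P}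

/-- The height of the whole signature is the weight, corrected by one if the final sign is
negative. -/
theorem sigHeight_top (hx : IsDominant D x) (J : Finset (lex D x).Idx) (i : I) :
    isFinitary_lex.sigHeight J i ⊤ = D.simpleCoroot i ((lex D x).weight x J) +
      if (lex D x).cutSign J i ⊤ < 0 then 1 else 0 := by
  obtain ⟨b, ε, hε, h⟩ := exists_posRoot_apply_eq ((lex D x).tau_mem J) i
  have h1 := sigHeight_eq_of_forall_lt hx i J ⊤ (fun j _ => WithTop.coe_lt_top j) b ε hε h
  have hy := simpleCoroot_apply_of_apply_eq_smul ((lex D x).tau_mem J) hε h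
  have h2 := b.coroot_rho_pos
  rw [cutLevel_top] at h1
  rw [cutSign, cutProd_top, weight_eq_sub, map_sub, hy, hy]
  rcases hε with rfl | rfl
  · rw [if_neg (by omega)]
    linarith
  · rw [if_pos (by omega)]
    linarith

theorem sigHeight_of_gam_eq (hx : IsDominant D x) {J : Finset (lex D x).Idx} {i : I}
    {k : (lex D x).Idx} (h : (lex D x).gam J k = D.simpleRoot i) :
    isFinitary_lex.sigHeight J i k = (lex D x).level k -
      D.simpleCoroot i ((lex D x).tauHat (J.filter (· < k)) 0) := by
  have h0 : J.filter (fun j : (lex D x).Idx => (j : WithTop (lex D x).Idx) < k) =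
      J.filter (· < k) := by simp only [WithTop.coe_lt_coe]
  have h1 := sigHeight_eq_of_forall_lt hx i (J.filter (· < k)) k
    (fun j hj => WithTop.coe_lt_coe.2 (Finset.mem_filter.1 hj).2) ((lex D x).root k) 1 (Or.inl rfl)
    (by rw [one_smul, ← h]; rfl)
  rw [← h0, sigHeight_filter, h0, cutLevel_self] at h1
  linarith

/-- The operator `f_i` lowers the weight by `α_i`. -/
theorem Moves.weight (hx : IsDominant D x) {i : I} {J J' : Finset (lex D x).Idx}
    (hJ : (lex D x).Admissible J) (h : Moves isFinitary_lex i J J') :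
    (lex D x).weight x J' = (lex D x).weight x J - D.simpleRoot i := by
  obtain ⟨B, a, m, h, -, rfl, rfl⟩ := h
  have h1 := h.sigHeight_between isFinitary_lex h.lt le_rfl
  rw [sigHeight_of_gam_eq hx h.gam_right_a] at h1
  have hfilt : ∀ k : (lex D x).Idx, (k : WithTop (lex D x).Idx) ≤ m →
      (insertTop m B).filter (· < k) = B.filter (· < k) := by
    intro k hk
    ext y
    simp only [Finset.mem_filter, mem_insertTop]
    refine and_congr_left fun hy => or_iff_right fun h' => ?_
    exact not_lt.2 hk (h' ▸ WithTop.coe_lt_coe.2 hy)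
  rw [hfilt a h.lt.le] at h1
  rw [weight_eq, weight_eq, tauHat_insert _ h.notMem h.gam_eq]
  induction m using WithTop.recTopCoe with
  | top =>
    have h2 := h.cutSign_right_pos hJ h.lt.le le_rfl
    rw [sigHeight_top hx, if_neg (not_lt.2 h2.le), insertTop_top, weight_eq, map_neg] at h1
    rw [insertTop_top]
    have h3 : D.simpleCoroot i ((lex D x).tauHat B (-x)) -
        (D.simpleCoroot i ((lex D x).tauHat (B.filter (· < a)) 0) - (lex D x).level a) = -1 := by
      linarith
    rw [h3]
    module
  | coe b =>
    have hb := h.gam_right b rfl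
    have hb' : (lex D x).gam (insertTop (b : WithTop (lex D x).Idx) B) b = D.simpleRoot i := by
      rw [insertTop_coe, gam_insert_of_le _ _ le_rfl, hb]
    rw [sigHeight_of_gam_eq hx hb', hfilt b le_rfl] at h1
    rw [insertTop_coe, tauHat_insert _ (h.notMem_right b rfl) hb]
    have h3 : (lex D x).level b = (lex D x).level a -
      D.simpleCoroot i ((lex D x).tauHat (B.filter (· < a)) 0) + 1 +
      D.simpleCoroot i ((lex D x).tauHat (B.filter (· < b)) 0) := by linarith
    rw [h3]
    module

theorem eOp_eq_none_iff_maxHeight (hx : IsDominant D x) {i : I} {J : (lex D x).Al} :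
    (lex D x).eOp i J = none ↔
      isFinitary_lex.maxHeight J.1 i = D.simpleCoroot i ((lex D x).weight x J.1) := by
  rw [eOp_eq_none_iff isFinitary_lex]
  have h1 := sigHeight_top hx J.1 i
  have h2 := isFinitary_lex.sigHeight_le_maxHeight J.1 i ⊤
  constructor
  · rintro ⟨h3, h4⟩
    rw [if_neg (not_lt.2 h4.le)] at h1
    obtain ⟨k, hk⟩ := isFinitary_lex.exists_sigHeight_eq_maxHeight J.1 i
    have := h3 k
    omega
  · intro h
    split_ifs at h1 with h3
    · omega
    · refine ⟨fun k => ?_, lt_of_le_of_ne (not_lt.1 h3) ((lex D x).cutSign_ne_zero J.1 i ⊤).symm⟩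
      have := isFinitary_lex.sigHeight_le_maxHeight J.1 i k
      omega

theorem stringLength_eOp (hx : IsDominant D x) (i : I) (J : (lex D x).Al) :
    (CrystalData.stringLength ((lex D x).eOp i) J : ℤ) =
      isFinitary_lex.maxHeight J.1 i - D.simpleCoroot i ((lex D x).weight x J.1) := by
  have hnn : ∀ J : (lex D x).Al, 0 ≤ isFinitary_lex.maxHeight J.1 i -
      D.simpleCoroot i ((lex D x).weight x J.1) := by
    intro J
    have h1 := sigHeight_top hx J.1 i
    have h2 := isFinitary_lex.sigHeight_le_maxHeight J.1 i ⊤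
    split_ifs at h1 <;> omega
  rw [CrystalData.stringLength_eq (n := fun J => (isFinitary_lex.maxHeight J.1 i -
      D.simpleCoroot i ((lex D x).weight x J.1)).toNat)]
  · exact Int.toNat_of_nonneg (hnn J)
  · intro J
    rw [eOp_eq_none_iff_maxHeight hx]
    have := hnn J
    omega
  · intro J J' h
    have hm := (eOp_eq_some_iff isFinitary_lex).1 h
    have h1 := hm.maxHeight
    have h2 := hm.weight hx J'.2
    have h3 := hnn J'
    rw [h2, map_sub, CartanDatum.simpleCoroot_simpleRoot_self]
    omega

/-- The alcove model of a lex chain is an abstract crystal. -/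
theorem isCrystal_lex (hx : IsDominant D x) : ((lex D x).crystal x).IsCrystal := by
  have hep : ∀ i J, ((lex D x).crystal x).ep i J = ((isFinitary_lex.maxHeight J.1 i -
      D.simpleCoroot i ((lex D x).weight x J.1) : ℤ) : WithBot ℤ) :=
    fun i J => congrArg _ (stringLength_eOp hx i J)
  have hph : ∀ i J, ((lex D x).crystal x).ph i J =
      ((isFinitary_lex.maxHeight J.1 i : ℤ) : WithBot ℤ) :=
    fun i J => congrArg _ (stringLength_fOp isFinitary_lex i J)
  have hf : ∀ i J J', ((lex D x).crystal x).f i J = some J' ↔ Moves isFinitary_lex i J.1 J'.1 :=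
    fun i J J' => fOp_eq_some_iff isFinitary_lex
  have he : ∀ i J J', ((lex D x).crystal x).e i J = some J' ↔ Moves isFinitary_lex i J'.1 J.1 :=
    fun i J J' => eOp_eq_some_iff isFinitary_lex
  have hwt : ∀ i (J J' : (lex D x).Al), Moves isFinitary_lex i J.1 J'.1 →
      (lex D x).weight x J'.1 = (lex D x).weight x J.1 - D.simpleRoot i :=
    fun i J J' h => h.weight hx J.2
  have hwt' : ∀ i (J J' : (lex D x).Al), Moves isFinitary_lex i J.1 J'.1 →
      D.simpleCoroot i ((lex D x).weight x J'.1) =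
        D.simpleCoroot i ((lex D x).weight x J.1) - 2 := fun i J J' h => by
    rw [hwt i J J' h, map_sub, CartanDatum.simpleCoroot_simpleRoot_self]
  refine ⟨⟨⟨∅, admissible_empty _⟩⟩, fun i J => ?_, fun i J J' h => ?_, fun i J J' h => ?_,
    fun i J J' h => ?_, fun i J J' h => ?_, fun i J J' h => ?_, fun i J J' h => ?_,
    fun i J J' => ?_, fun i J h => ?_⟩
  · rw [hep, hph, ← WithBot.coe_add]
    exact congrArg _ (sub_add_cancel _ _).symm
  · rw [he] at h
    rw [hep, hep, h.maxHeight, hwt' i _ _ h, ← WithBot.coe_one, ← WithBot.coe_add]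
    congr 1; ring
  · rw [he] at h
    rw [hph, hph, h.maxHeight, ← WithBot.coe_one, ← WithBot.coe_add]
  · rw [he] at h
    exact (sub_eq_iff_eq_add.1 (hwt i _ _ h).symm)
  · rw [hf] at h
    rw [hep, hep, h.maxHeight, hwt' i _ _ h, ← WithBot.coe_one, ← WithBot.coe_add]
    congr 1; ring
  · rw [hf] at h
    rw [hph, hph, h.maxHeight, ← WithBot.coe_one, ← WithBot.coe_add]
  · rw [hf] at h
    exact hwt i _ _ h
  · rw [hf, he]
  · exact absurd h WithBot.coe_ne_bot

end RootChain

namespace CrystalData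

variable {I : Type u} [DecidableEq I] {A : Matrix I I ℤ} {P : Type v} [AddCommGroup P]
  {D : CartanDatum A P} {B : Type w} {C : CrystalData D B}

section Twist

variable (x : P) (i : I) (b : Unit × B)

theorem T_tensor_e : ((T D x).tensor C).e i b = (C.e i b.2).map fun y => ((), y) :=
  if_neg (t := (none : Option Unit).map fun u => (u, b.2)) (show ¬ C.ph i b.2 < ⊥ from not_lt_bot)

theorem T_tensor_f (h : C.ph i b.2 ≠ ⊥) :
    ((T D x).tensor C).f i b = (C.f i b.2).map fun y => ((), y) :=
  if_neg (by rwa [T, le_bot_iff])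

theorem T_tensor_ep : ((T D x).tensor C).ep i b = C.ep i b.2 := by
  simp [tensor, T]

theorem T_tensor_ph :
    ((T D x).tensor C).ph i b = C.ph i b.2 + (D.simpleCoroot i x : ℤ) := by
  simp [tensor, T]

theorem T_tensor_wt : ((T D x).tensor C).wt b = x + C.wt b.2 := rfl

end Twist

/-- Tensoring with `T_x` on the left shifts the weight by `x`. -/
theorem IsCrystal.T_tensor (hC : C.IsCrystal) (hph : ∀ i b, C.ph i b ≠ ⊥) (x : P) :
    ((T D x).tensor C).IsCrystal := by
  have he : ∀ i (b b' : Unit × B), ((T D x).tensor C).e i b = some b' ↔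
      C.e i b.2 = some b'.2 := by
    rintro i b ⟨⟨⟩, y⟩
    rw [T_tensor_e]
    simp
  have hf : ∀ i (b b' : Unit × B), ((T D x).tensor C).f i b = some b' ↔
      C.f i b.2 = some b'.2 := by
    rintro i b ⟨⟨⟩, y⟩
    rw [T_tensor_f x i b (hph i _)]
    simp
  refine ⟨?_, fun i b => ?_, fun i b b' h => ?_, fun i b b' h => ?_, fun i b b' h => ?_,
    fun i b b' h => ?_, fun i b b' h => ?_, fun i b b' h => ?_, fun i b b' => ?_, fun i b h => ?_⟩
  · obtain ⟨b⟩ := hC.nonempty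
    exact ⟨((), b)⟩
  · rw [T_tensor_ep, T_tensor_ph, T_tensor_wt, hC.ph_eq, map_add, add_comm (D.simpleCoroot i x),
      WithBot.coe_add, add_assoc]
  · rw [T_tensor_ep, T_tensor_ep]
    exact hC.ep_e i _ _ ((he i b b').1 h)
  · rw [T_tensor_ph, T_tensor_ph, hC.ph_e i _ _ ((he i b b').1 h), add_right_comm]
  · rw [T_tensor_wt, T_tensor_wt, hC.wt_e i _ _ ((he i b b').1 h), add_assoc]
  · rw [T_tensor_ep, T_tensor_ep]
    exact hC.ep_f i _ _ ((hf i b b').1 h)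
  · rw [T_tensor_ph, T_tensor_ph, hC.ph_f i _ _ ((hf i b b').1 h), add_right_comm]
  · rw [T_tensor_wt, T_tensor_wt, hC.wt_f i _ _ ((hf i b b').1 h), add_sub_assoc]
  · rw [hf, he, hC.f_iff_e]
  · rw [T_tensor_ph, WithBot.add_eq_bot] at h
    exact absurd (h.resolve_right WithBot.coe_ne_bot) (hph i _)

end CrystalData

/-! ### Embeddings of chains -/

namespace RootChain

variable {I : Type u} [DecidableEq I] {A : Matrix I I ℤ} {P : Type v} [AddCommGroup P]
  {D : CartanDatum A P}

/-- An identification of the chain `Γ` with a right end of the chain `Γ'` that shifts the levels by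
the weight `y`. -/
structure EndEmbedding (Γ Γ' : RootChain D) (y : P) where
  toFun : Γ.Idx ↪o Γ'.Idx
  root_eq : ∀ p, Γ'.root (toFun p) = Γ.root p
  level_eq : ∀ p, Γ'.level (toFun p) = Γ.level p + (Γ.root p).coroot y
  mem_range : ∀ p k, toFun p ≤ k → k ∈ Set.range toFun

theorem map_eraseMax {K K' : Type v} [LinearOrder K] [LinearOrder K'] (φ : K ↪o K')
    (J S : Finset K) :
    (if hS : (S.map φ.toEmbedding).Nonempty then
      (J.map φ.toEmbedding).erase ((S.map φ.toEmbedding).max' hS) else J.map φ.toEmbedding) =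
    (if hS : S.Nonempty then J.erase (S.max' hS) else J).map φ.toEmbedding := by
  by_cases hS : S.Nonempty
  · rw [dif_pos hS, dif_pos (hS.map), Finset.map_erase]
    congr 1
    refine (Finset.max'_eq_iff _ _ _).2 ⟨Finset.mem_map_of_mem _ (S.max'_mem hS), ?_⟩
    intro b hb
    obtain ⟨c, hc, rfl⟩ := Finset.mem_map.1 hb
    exact φ.monotone (S.le_max' c hc)
  · rw [dif_neg hS, dif_neg (by rwa [Finset.map_nonempty])]

theorem map_eraseMin {K K' : Type v} [LinearOrder K] [LinearOrder K'] (φ : K ↪o K')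
    (J S : Finset K) :
    (if hS : (S.map φ.toEmbedding).Nonempty then
      (J.map φ.toEmbedding).erase ((S.map φ.toEmbedding).min' hS) else J.map φ.toEmbedding) =
    (if hS : S.Nonempty then J.erase (S.min' hS) else J).map φ.toEmbedding := by
  by_cases hS : S.Nonempty
  · rw [dif_pos hS, dif_pos (hS.map), Finset.map_erase]
    congr 1
    refine (Finset.min'_eq_iff _ _ _).2 ⟨Finset.mem_map_of_mem _ (S.min'_mem hS), ?_⟩
    intro b hb
    obtain ⟨c, hc, rfl⟩ := Finset.mem_map.1 hb
    exact φ.monotone (S.min'_le c hc)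
  · rw [dif_neg hS, dif_neg (by rwa [Finset.map_nonempty])]

namespace EndEmbedding

variable {Γ Γ' : RootChain D} {y : P} (E : EndEmbedding Γ Γ' y)

/-- The image of a set of positions. -/
def map (J : Finset Γ.Idx) : Finset Γ'.Idx := J.map E.toFun.toEmbedding

theorem mem_map {J : Finset Γ.Idx} {k : Γ'.Idx} : k ∈ E.map J ↔ ∃ j ∈ J, E.toFun j = k := by
  simp [map]

@[simp] theorem apply_mem_map {J : Finset Γ.Idx} {k : Γ.Idx} : E.toFun k ∈ E.map J ↔ k ∈ J := by
  simp [map]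

theorem map_insert (a : Γ.Idx) (J : Finset Γ.Idx) :
    E.map (insert a J) = insert (E.toFun a) (E.map J) := by
  simp [map, Finset.map_insert]

theorem tauHat_map (J : Finset Γ.Idx) (z : P) :
    Γ'.tauHat (E.map J) z = Γ.tauHat J (z + y) - y := by
  induction J using Finset.induction_on_max generalizing z with
  | empty => simp [map]
  | insert j J h ih =>
    have h' : ∀ b ∈ E.map J, b < E.toFun j := by
      intro b hb
      obtain ⟨c, hc, rfl⟩ := E.mem_map.1 hb
      exact E.toFun.lt_iff_lt.2 (h c hc)
    rw [map_insert, tauHat_insert_max _ h', tauHat_insert_max _ h, ih]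
    congr 2
    simp only [CartanDatum.PosRoot.affineReflection, E.root_eq, E.level_eq, map_add]
    module

theorem tau_map (J : Finset Γ.Idx) : Γ'.tau (E.map J) = Γ.tau J := by
  induction J using Finset.induction_on_max with
  | empty => simp [map]
  | insert j J h ih =>
    have h' : ∀ b ∈ E.map J, b < E.toFun j := by
      intro b hb
      obtain ⟨c, hc, rfl⟩ := E.mem_map.1 hb
      exact E.toFun.lt_iff_lt.2 (h c hc)
    rw [map_insert, tau_insert_max _ h', tau_insert_max _ h, ih, E.root_eq]

theorem weight_map (x : P) (J : Finset Γ.Idx) :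
    Γ'.weight (x + y) (E.map J) = Γ.weight x J + y := by
  rw [weight_eq, weight_eq, E.tauHat_map, neg_add, neg_add_cancel_right]
  abel

theorem prefixProd_map (J : Finset Γ.Idx) (k : Γ.Idx) :
    Γ'.prefixProd (E.map J) (E.toFun k) = Γ.prefixProd J k := by
  have h : (E.map J).filter (· < E.toFun k) = E.map (J.filter (· < k)) := by
    ext a
    simp only [Finset.mem_filter, E.mem_map]
    constructor
    · rintro ⟨⟨j, hj, rfl⟩, hlt⟩
      exact ⟨j, ⟨hj, E.toFun.lt_iff_lt.1 hlt⟩, rfl⟩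
    · rintro ⟨j, ⟨hj, hlt⟩, rfl⟩
      exact ⟨⟨j, hj, rfl⟩, E.toFun.lt_iff_lt.2 hlt⟩
  change Γ'.tau _ = Γ.tau _
  rw [h, E.tau_map]

theorem admissible_map_iff (J : Finset Γ.Idx) : Γ'.Admissible (E.map J) ↔ Γ.Admissible J := by
  constructor
  · intro h j hj
    have := h (E.toFun j) (E.apply_mem_map.2 hj)
    rwa [E.prefixProd_map, E.root_eq] at this
  · intro h k hk
    obtain ⟨j, hj, rfl⟩ := E.mem_map.1 hk
    rw [E.prefixProd_map, E.root_eq]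
    exact h j hj

theorem gam_map (J : Finset Γ.Idx) (k : Γ.Idx) : Γ'.gam (E.map J) (E.toFun k) = Γ.gam J k := by
  rw [gam, gam, E.prefixProd_map, E.root_eq]

theorem gam_map_of_notMem (J : Finset Γ.Idx) {k : Γ'.Idx} (hk : k ∉ Set.range E.toFun) :
    Γ'.gam (E.map J) k = (Γ'.root k).root := by
  have h : (E.map J).filter (· < k) = ∅ := by
    rw [Finset.filter_eq_empty_iff]
    intro a ha hlt
    obtain ⟨j, -, rfl⟩ := E.mem_map.1 ha
    exact hk (E.mem_range j k hlt.le)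
  change Γ'.tau _ _ = _
  rw [h]
  simp

theorem apply_mem_rootSet_map {J : Finset Γ.Idx} {i : I} {k : Γ.Idx} :
    E.toFun k ∈ Γ'.rootSet (E.map J) i ↔ k ∈ Γ.rootSet J i := by
  unfold rootSet
  rw [Set.mem_ofPred, Set.mem_ofPred, E.gam_map]

theorem filter_map {J : Finset Γ.Idx} {p : Γ'.Idx → Prop} {q : Γ.Idx → Prop} [DecidablePred p]
    [DecidablePred q] (h : ∀ j, p (E.toFun j) ↔ q j) :
    (E.map J).filter p = (J.filter q).map E.toFun.toEmbedding := by
  ext k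
  simp only [Finset.mem_filter, E.mem_map, Finset.mem_map, RelEmbedding.coe_toEmbedding]
  constructor
  · rintro ⟨⟨j, hj, rfl⟩, h1⟩
    exact ⟨j, ⟨hj, (h j).1 h1⟩, rfl⟩
  · rintro ⟨j, ⟨hj, h1⟩, rfl⟩
    exact ⟨⟨j, hj, rfl⟩, (h j).2 h1⟩

theorem apply_mem_letters_map {J : Finset Γ.Idx} {i : I} {k : Γ.Idx} :
    E.toFun k ∈ Γ'.rootSet (E.map J) i \ (E.map J : Set Γ'.Idx) ↔
      k ∈ Γ.rootSet J i \ (J : Set Γ.Idx) := by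
  simp only [Set.mem_sdiff, E.apply_mem_rootSet_map, Finset.mem_coe, E.apply_mem_map]

/-- The image of an admissible set. -/
def mapAl (J : Γ.Al) : Γ'.Al := ⟨E.map J.1, (E.admissible_map_iff J.1).2 J.2⟩

theorem mapAl_injective : Function.Injective E.mapAl := fun _ _ h =>
  Subtype.ext (Finset.map_injective _ (congrArg Subtype.val h))

theorem ofFinset_map (J : Finset Γ.Idx) :
    Γ'.ofFinset (E.map J) = (Γ.ofFinset J).map E.mapAl := by
  unfold ofFinset
  by_cases h : Γ.Admissible J
  · rw [dif_pos h, dif_pos ((E.admissible_map_iff J).2 h)]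
    rfl
  · rw [dif_neg h, dif_neg fun h' => h ((E.admissible_map_iff J).1 h')]
    rfl

theorem position_image_map (J : Finset Γ.Idx) : Γ'.position '' (E.map J : Set Γ'.Idx) =
    (fun p : D.PosRoot × ℤ => (p.1, p.2 + p.1.coroot y)) '' (Γ.position '' (J : Set Γ.Idx)) := by
  rw [map, Finset.coe_map, Set.image_image, Set.image_image]
  refine Set.image_congr fun p _ => ?_
  exact Prod.ext (E.root_eq p) (E.level_eq p)

theorem cancels_of_cancels_map {J : Finset Γ.Idx} {i : I} {c' a' : Γ'.Idx}
    (h : Cancels (Γ'.rootSet (E.map J) i \ (E.map J : Set Γ'.Idx))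
      (fun k => Γ'.gam (E.map J) k = D.simpleRoot i) c' a') :
    ∀ c a, E.toFun c = c' → E.toFun a = a' → Cancels (Γ.rootSet J i \ (J : Set Γ.Idx))
      (fun k => Γ.gam J k = D.simpleRoot i) c a := by
  induction h with
  | @intro c' a' hc ha hca hminus hplus partner mem_partner cancels_minus cancels_plus ih1 ih2 =>
    rintro c a rfl rfl
    have hex : ∀ d, ∃ d', d ∈ Γ.rootSet J i \ (J : Set Γ.Idx) → c < d → d < a →
        E.toFun d' = partner (E.toFun d) := by
      intro d
      by_cases hd : d ∈ Γ.rootSet J i \ (J : Set Γ.Idx) ∧ c < d ∧ d < a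
      · obtain ⟨d', hd'⟩ := E.mem_range c _ (mem_partner (E.toFun d)
          (E.apply_mem_letters_map.2 hd.1) (E.toFun.lt_iff_lt.2 hd.2.1)
          (E.toFun.lt_iff_lt.2 hd.2.2)).1.le
        exact ⟨d', fun _ _ _ => hd'⟩
      · exact ⟨d, fun h1 h2 h3 => absurd ⟨h1, h2, h3⟩ hd⟩
    choose p hp using hex
    rw [E.gam_map] at hminus hplus
    refine Cancels.intro (E.apply_mem_letters_map.1 hc) (E.apply_mem_letters_map.1 ha)
      (E.toFun.lt_iff_lt.1 hca) hminus hplus p ?_ ?_ ?_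
    · intro d hd h1 h2
      have := mem_partner (E.toFun d) (E.apply_mem_letters_map.2 hd) (E.toFun.lt_iff_lt.2 h1)
        (E.toFun.lt_iff_lt.2 h2)
      rwa [← hp d hd h1 h2, E.toFun.lt_iff_lt, E.toFun.lt_iff_lt] at this
    · intro d hd h1 h2 hm
      exact ih1 (E.toFun d) (E.apply_mem_letters_map.2 hd) (E.toFun.lt_iff_lt.2 h1)
        (E.toFun.lt_iff_lt.2 h2) (by rwa [E.gam_map]) _ _ rfl (hp d hd h1 h2)
    · intro d hd h1 h2 hm
      exact ih2 (E.toFun d) (E.apply_mem_letters_map.2 hd) (E.toFun.lt_iff_lt.2 h1)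
        (E.toFun.lt_iff_lt.2 h2) (by rwa [E.gam_map]) _ _ (hp d hd h1 h2) rfl

theorem cancels_map {J : Finset Γ.Idx} {i : I} {c a : Γ.Idx}
    (h : Cancels (Γ.rootSet J i \ (J : Set Γ.Idx)) (fun k => Γ.gam J k = D.simpleRoot i) c a) :
    Cancels (Γ'.rootSet (E.map J) i \ (E.map J : Set Γ'.Idx))
      (fun k => Γ'.gam (E.map J) k = D.simpleRoot i) (E.toFun c) (E.toFun a) := by
  induction h with
  | @intro c a hc ha hca hminus hplus partner mem_partner cancels_minus cancels_plus ih1 ih2 =>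
    have hex : ∀ d', ∃ q, ∀ d, E.toFun d = d' → q = E.toFun (partner d) := by
      intro d'
      by_cases hd : ∃ d, E.toFun d = d'
      · obtain ⟨d, rfl⟩ := hd
        exact ⟨_, fun d₂ h => by rw [E.toFun.injective h]⟩
      · exact ⟨d', fun d h => absurd ⟨d, h⟩ hd⟩
    choose p hp using hex
    rw [← E.gam_map] at hminus hplus
    refine Cancels.intro (E.apply_mem_letters_map.2 hc) (E.apply_mem_letters_map.2 ha)
      (E.toFun.lt_iff_lt.2 hca) hminus hplus p ?_ ?_ ?_
    · intro d' hd h1 h2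
      obtain ⟨d, rfl⟩ := E.mem_range c d' h1.le
      rw [hp _ d rfl, E.toFun.lt_iff_lt, E.toFun.lt_iff_lt]
      exact mem_partner d (E.apply_mem_letters_map.1 hd) (E.toFun.lt_iff_lt.1 h1)
        (E.toFun.lt_iff_lt.1 h2)
    · intro d' hd h1 h2 hm
      obtain ⟨d, rfl⟩ := E.mem_range c d' h1.le
      rw [hp _ d rfl]
      exact ih1 d (E.apply_mem_letters_map.1 hd) (E.toFun.lt_iff_lt.1 h1)
        (E.toFun.lt_iff_lt.1 h2) (by rwa [E.gam_map] at hm)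
    · intro d' hd h1 h2 hm
      obtain ⟨d, rfl⟩ := E.mem_range c d' h1.le
      rw [hp _ d rfl]
      exact ih2 d (E.apply_mem_letters_map.1 hd) (E.toFun.lt_iff_lt.1 h1)
        (E.toFun.lt_iff_lt.1 h2) (by rwa [E.gam_map] at hm)

theorem cancels_map_iff {J : Finset Γ.Idx} {i : I} {c a : Γ.Idx} :
    Cancels (Γ'.rootSet (E.map J) i \ (E.map J : Set Γ'.Idx))
      (fun k => Γ'.gam (E.map J) k = D.simpleRoot i) (E.toFun c) (E.toFun a) ↔
    Cancels (Γ.rootSet J i \ (J : Set Γ.Idx)) (fun k => Γ.gam J k = D.simpleRoot i) c a :=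
  ⟨fun h => E.cancels_of_cancels_map h c a rfl rfl, E.cancels_map⟩

theorem shift_eq (hinj : Function.Injective Γ'.position) (J : Γ.Al) :
    Γ.shift Γ' y J = some (E.mapAl J) := by
  have hex : ∃ J' : Γ'.Al, Γ'.position '' (J'.1 : Set Γ'.Idx) =
      (fun p : D.PosRoot × ℤ => (p.1, p.2 + p.1.coroot y)) '' (Γ.position '' (J.1 : Set Γ.Idx)) :=
    ⟨E.mapAl J, E.position_image_map J.1⟩
  rw [shift, dif_pos hex]
  congr 1
  refine Subtype.ext (Finset.coe_injective (hinj.image_injective ?_))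
  rw [hex.choose_spec]
  exact (E.position_image_map J.1).symm

variable [Fintype I]

/-- The letters outside the range are of sign `+`. -/
theorem gam_map_eq_of_notMem {J : Finset Γ.Idx} {i : I} {k : Γ'.Idx} (hk : k ∉ Set.range E.toFun)
    (hr : k ∈ Γ'.rootSet (E.map J) i) : Γ'.gam (E.map J) k = D.simpleRoot i := by
  refine hr.resolve_right fun h => ?_
  rw [E.gam_map_of_notMem J hk] at h
  have h1 := (CartanDatum.IsRealRoot.simple (D := D) i).neg
  rw [← h] at h1
  have h2 := (Γ'.root k).coroot_rho_pos
  rw [(Γ'.root k).isReal.coroot_unique h1, LinearMap.neg_apply, CartanDatum.simpleCoroot_rho] at h2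
  omega

theorem mem_range_of_minus {J : Finset Γ.Idx} {i : I} {c : Γ'.Idx}
    (hc : c ∈ Γ'.rootSet (E.map J) i \ (E.map J : Set Γ'.Idx))
    (hm : Γ'.gam (E.map J) c ≠ D.simpleRoot i) :
    c ∈ Set.range E.toFun := by
  by_contra h
  exact hm (E.gam_map_eq_of_notMem h hc.1)

theorem reducedMinus_map (J : Finset Γ.Idx) (i : I) :
    Γ'.reducedMinus (E.map J) i = E.toFun '' Γ.reducedMinus J i := by
  ext c'
  constructor
  · rintro ⟨h1, h2, h3⟩
    obtain ⟨c, rfl⟩ := E.mem_range_of_minus h1 h2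
    rw [E.gam_map] at h2
    exact ⟨c, ⟨E.apply_mem_letters_map.1 h1, h2, fun a ha => h3 _ (E.cancels_map ha)⟩, rfl⟩
  · rintro ⟨c, ⟨h1, h2, h3⟩, rfl⟩
    refine ⟨E.apply_mem_letters_map.2 h1, by rwa [E.gam_map], fun a' ha => ?_⟩
    have hlt : E.toFun c < a' := by cases ha; assumption
    obtain ⟨a, rfl⟩ := E.mem_range c a' hlt.le
    exact h3 a (E.cancels_map_iff.1 ha)

theorem apply_mem_reducedPlus_map {J : Finset Γ.Idx} {i : I} {a : Γ.Idx} :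
    E.toFun a ∈ Γ'.reducedPlus (E.map J) i ↔ a ∈ Γ.reducedPlus J i := by
  constructor
  · rintro ⟨h1, h2, h3⟩
    rw [E.gam_map] at h2
    exact ⟨E.apply_mem_letters_map.1 h1, h2, fun c hc => h3 _ (E.cancels_map hc)⟩
  · rintro ⟨h1, h2, h3⟩
    refine ⟨E.apply_mem_letters_map.2 h1, by rwa [E.gam_map], fun c' hc => ?_⟩
    have hc' : c' ∈ Set.range E.toFun := by
      cases hc with
      | intro hc ha hca hminus hplus partner _ _ _ => exact E.mem_range_of_minus hc hminus
    obtain ⟨c, rfl⟩ := hc'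
    exact h3 c (E.cancels_map_iff.1 hc)

theorem isGreatest_reducedPlus_map {J : Finset Γ.Idx} {i : I} {a : Γ.Idx}
    (h : IsGreatest (Γ.reducedPlus J i) a) :
    IsGreatest (Γ'.reducedPlus (E.map J) i) (E.toFun a) := by
  refine ⟨E.apply_mem_reducedPlus_map.2 h.1, fun k hk => ?_⟩
  by_contra hlt
  obtain ⟨b, rfl⟩ := E.mem_range a k (not_le.1 hlt).le
  exact hlt (E.toFun.monotone (h.2 (E.apply_mem_reducedPlus_map.1 hk)))

theorem isLeast_reducedMinus_map_iff {J : Finset Γ.Idx} {i : I} {k : Γ'.Idx} :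
    IsLeast (Γ'.reducedMinus (E.map J) i) k ↔
      ∃ a, E.toFun a = k ∧ IsLeast (Γ.reducedMinus J i) a := by
  rw [E.reducedMinus_map]
  constructor
  · rintro ⟨⟨a, ha, rfl⟩, h⟩
    exact ⟨a, rfl, ha, fun b hb => E.toFun.le_iff_le.1 (h ⟨b, hb, rfl⟩)⟩
  · rintro ⟨a, rfl, ha, h⟩
    refine ⟨⟨a, ha, rfl⟩, ?_⟩
    rintro _ ⟨b, hb, rfl⟩
    exact E.toFun.monotone (h hb)

theorem fOp_map {i : I} {J J' : Γ.Al} (h : Γ.fOp i J = some J') :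
    Γ'.fOp i (E.mapAl J) = some (E.mapAl J') := by
  classical
  by_cases hex : ∃ a, IsGreatest (Γ.reducedPlus J.1 i) a
  · have hex' : ∃ a, IsGreatest (Γ'.reducedPlus (E.mapAl J).1 i) a :=
      ⟨_, E.isGreatest_reducedPlus_map hex.choose_spec⟩
    have hch : hex'.choose = E.toFun hex.choose :=
      hex'.choose_spec.unique (E.isGreatest_reducedPlus_map hex.choose_spec)
    rw [← Option.map_some, ← h]
    unfold fOp
    rw [dif_pos hex, dif_pos hex', ← E.ofFinset_map]
    simp only [hch]
    congr 1
    rw [E.map_insert]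
    congr 1
    refine Eq.trans ?_ (map_eraseMin E.toFun J.1
      (J.1.filter fun j => j ∈ Γ.rootSet J.1 i ∧ hex.choose < j))
    have hS : (E.mapAl J).1.filter (fun j => j ∈ Γ'.rootSet (E.mapAl J).1 i ∧
        E.toFun hex.choose < j) =
        (J.1.filter fun j => j ∈ Γ.rootSet J.1 i ∧ hex.choose < j).map E.toFun.toEmbedding :=
      E.filter_map fun j => and_congr E.apply_mem_rootSet_map E.toFun.lt_iff_lt
    simp only [hS]
    rfl
  · unfold fOp at h
    rw [dif_neg hex] at h
    exact absurd h (by simp)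

theorem eOp_map (i : I) (J : Γ.Al) :
    Γ'.eOp i (E.mapAl J) = (Γ.eOp i J).map E.mapAl := by
  classical
  unfold eOp
  by_cases hex : ∃ a, IsLeast (Γ.reducedMinus J.1 i) a
  · have hl := E.isLeast_reducedMinus_map_iff.2 ⟨_, rfl, hex.choose_spec⟩
    have hex' : ∃ a, IsLeast (Γ'.reducedMinus (E.mapAl J).1 i) a := ⟨_, hl⟩
    have hch : hex'.choose = E.toFun hex.choose := hex'.choose_spec.unique hl
    rw [dif_pos hex, dif_pos hex', ← E.ofFinset_map]
    simp only [hch]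
    congr 1
    rw [E.map_insert]
    congr 1
    refine Eq.trans ?_ (map_eraseMax E.toFun J.1
      (J.1.filter fun j => j ∈ Γ.rootSet J.1 i ∧ j < hex.choose))
    have hS : (E.mapAl J).1.filter (fun j => j ∈ Γ'.rootSet (E.mapAl J).1 i ∧
        j < E.toFun hex.choose) =
        (J.1.filter fun j => j ∈ Γ.rootSet J.1 i ∧ j < hex.choose).map E.toFun.toEmbedding :=
      E.filter_map fun j => and_congr E.apply_mem_rootSet_map E.toFun.lt_iff_lt
    simp only [hS]
    rfl
  · have hex' : ¬ ∃ a, IsLeast (Γ'.reducedMinus (E.mapAl J).1 i) a := by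
      rintro ⟨k, hk⟩
      obtain ⟨a, -, ha⟩ := E.isLeast_reducedMinus_map_iff.1 hk
      exact hex ⟨a, ha⟩
    have htau : Γ'.tau (E.mapAl J).1 = Γ.tau J.1 := E.tau_map J.1
    rw [dif_neg hex, dif_neg hex', htau]
    by_cases hneg : D.simpleCoroot i (Γ.tau J.1 D.rho) < 0
    · rw [if_pos hneg, if_pos hneg]
      have hS : (E.mapAl J).1.filter (fun j => j ∈ Γ'.rootSet (E.mapAl J).1 i) =
          (J.1.filter fun j => j ∈ Γ.rootSet J.1 i).map E.toFun.toEmbedding :=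
        E.filter_map fun j => E.apply_mem_rootSet_map
      simp only [hS]
      have hm := map_eraseMax E.toFun J.1 (J.1.filter fun j => j ∈ Γ.rootSet J.1 i)
      by_cases hne : (J.1.filter fun j => j ∈ Γ.rootSet J.1 i).Nonempty
      · rw [dif_pos hne, dif_pos hne.map] at hm
        rw [dif_pos hne, dif_pos hne.map, ← E.ofFinset_map]
        exact congrArg _ hm
      · rw [dif_neg hne, dif_neg (by rwa [Finset.map_nonempty])]
        rfl
    · rw [if_neg hneg, if_neg hneg]
      rfl

theorem stringLength_eOp_map (i : I) (J : Γ.Al) :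
    CrystalData.stringLength (Γ'.eOp i) (E.mapAl J) = CrystalData.stringLength (Γ.eOp i) J := by
  have h : ∀ (n : ℕ) (o : Option Γ.Al), (fun o : Option Γ'.Al => o.bind (Γ'.eOp i))^[n]
      (o.map E.mapAl) = ((fun o : Option Γ.Al => o.bind (Γ.eOp i))^[n] o).map E.mapAl := by
    intro n
    induction n with
    | zero => intro o; rfl
    | succ n ih =>
      intro o
      rw [Function.iterate_succ_apply, Function.iterate_succ_apply, ← ih]
      congr 1
      cases o with
      | none => rfl
      | some J => exact E.eOp_map i J
  unfold CrystalData.stringLength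
  congr 1
  ext n
  have := h n (some J)
  rw [Option.map_some] at this
  rw [Set.mem_ofPred, Set.mem_ofPred, this, Ne, Option.map_eq_none_iff]

end EndEmbedding

end RootChain

/-! ### Direct limits of crystals -/

namespace CrystalData

variable {I : Type u} [DecidableEq I] {A : Matrix I I ℤ} {P : Type v} [AddCommGroup P]
  {D : CartanDatum A P}

/-- A map of crystals without zero values. It preserves the crystal functions, commutes with the
`e_i`, and commutes with `f_i` where `f_i` does not vanish. -/
structure IsStrict {B : Type w} {B' : Type w'} (C : CrystalData D B) (C' : CrystalData D B')
    (θ : B → B') : Prop where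
  wt_eq : ∀ b, C'.wt (θ b) = C.wt b
  ep_eq : ∀ i b, C'.ep i (θ b) = C.ep i b
  ph_eq : ∀ i b, C'.ph i (θ b) = C.ph i b
  map_e : ∀ i b, C'.e i (θ b) = (C.e i b).map θ
  map_f : ∀ i b b', C.f i b = some b' → C'.f i (θ b) = some (θ b')

theorem IsStrict.isMorphism {B : Type w} {B' : Type w'} {C : CrystalData D B}
    {C' : CrystalData D B'} {θ : B → B'} (h : IsStrict C C' θ) :
    IsMorphism C C' (Option.map θ) := by
  refine ⟨rfl, ?_, ?_, ?_, ?_, ?_⟩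
  · rintro b _ ⟨⟩
    exact h.wt_eq b
  · rintro i b _ ⟨⟩
    exact h.ep_eq i b
  · rintro i b _ ⟨⟩
    exact h.ph_eq i b
  · intro i b _ _
    exact (h.map_e i b).symm
  · intro i b hb _
    cases hf : C.f i b with
    | none => rw [hf] at hb; exact absurd rfl hb
    | some b' => exact (h.map_f i b b' hf).symm

section Limit

variable {B : ℕ → Type w} {C : ∀ k, CrystalData D (B k)}
  {Ψ : ∀ ⦃j k : ℕ⦄, j ≤ k → Option (B j) → Option (B k)} {B' : Type w'} {C' : CrystalData D B'}

/-- A cocone that exhibits the crystal `C'` as the union of the crystals `C k`. Every element of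
`C'` has, for each `i`, a representative on which `f_i` does not vanish; hence the `f_i` of `C'` are
determined by those of the `C k`. -/
structure IsUnion (C : ∀ k, CrystalData D (B k))
    (Ψ : ∀ ⦃j k : ℕ⦄, j ≤ k → Option (B j) → Option (B k)) (C' : CrystalData D B')
    (θ : ∀ k, B k → B') : Prop where
  map_zero : ∀ ⦃j k : ℕ⦄ (h : j ≤ k), Ψ h none = none
  map_some : ∀ ⦃j k : ℕ⦄ (h : j ≤ k) (b : B j), ∃ b', Ψ h (some b) = some b' ∧ θ k b' = θ j b
  injective : ∀ k, Function.Injective (θ k)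
  surjective : ∀ b' : B', ∃ k b, θ k b = b'
  isStrict : ∀ k, IsStrict (C k) C' (θ k)
  isCrystal : ∀ k, (C k).IsCrystal
  ph_ne_bot : ∀ i b', C'.ph i b' ≠ ⊥
  exists_f : ∀ i (b' : B'), ∃ k b, θ k b = b' ∧ (C k).f i b ≠ none

variable {θ : ∀ k, B k → B'}

theorem IsUnion.isCrystal_union (h : IsUnion C Ψ C' θ) : C'.IsCrystal := by
  have he : ∀ i x x', C'.e i x = some x' →
      ∃ k b b', θ k b = x ∧ θ k b' = x' ∧ (C k).e i b = some b' := by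
    intro i x x' hx
    obtain ⟨k, b, rfl⟩ := h.surjective x
    rw [(h.isStrict k).map_e, Option.map_eq_some_iff] at hx
    obtain ⟨b', hb', rfl⟩ := hx
    exact ⟨k, b, b', rfl, rfl, hb'⟩
  have hf : ∀ i x x', C'.f i x = some x' →
      ∃ k b b', θ k b = x ∧ θ k b' = x' ∧ (C k).f i b = some b' := by
    intro i x x' hx
    obtain ⟨k, b, rfl, hb⟩ := h.exists_f i x
    obtain ⟨b', hb'⟩ := Option.ne_none_iff_exists'.1 hb
    rw [(h.isStrict k).map_f i b b' hb'] at hx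
    exact ⟨k, b, b', rfl, Option.some.inj hx, hb'⟩
  refine ⟨?_, fun i x => ?_, fun i x x' hx => ?_, fun i x x' hx => ?_, fun i x x' hx => ?_,
    fun i x x' hx => ?_, fun i x x' hx => ?_, fun i x x' hx => ?_, fun i x x' => ⟨fun hx => ?_,
    fun hx => ?_⟩, fun i x hx => absurd hx (h.ph_ne_bot i x)⟩
  · obtain ⟨b⟩ := (h.isCrystal 0).nonempty
    exact ⟨θ 0 b⟩
  · obtain ⟨k, b, rfl⟩ := h.surjective x
    rw [(h.isStrict k).ph_eq, (h.isStrict k).ep_eq, (h.isStrict k).wt_eq]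
    exact (h.isCrystal k).ph_eq i b
  · obtain ⟨k, b, b', rfl, rfl, hb⟩ := he i x x' hx
    rw [(h.isStrict k).ep_eq, (h.isStrict k).ep_eq]
    exact (h.isCrystal k).ep_e i b b' hb
  · obtain ⟨k, b, b', rfl, rfl, hb⟩ := he i x x' hx
    rw [(h.isStrict k).ph_eq, (h.isStrict k).ph_eq]
    exact (h.isCrystal k).ph_e i b b' hb
  · obtain ⟨k, b, b', rfl, rfl, hb⟩ := he i x x' hx
    rw [(h.isStrict k).wt_eq, (h.isStrict k).wt_eq]
    exact (h.isCrystal k).wt_e i b b' hb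
  · obtain ⟨k, b, b', rfl, rfl, hb⟩ := hf i x x' hx
    rw [(h.isStrict k).ep_eq, (h.isStrict k).ep_eq]
    exact (h.isCrystal k).ep_f i b b' hb
  · obtain ⟨k, b, b', rfl, rfl, hb⟩ := hf i x x' hx
    rw [(h.isStrict k).ph_eq, (h.isStrict k).ph_eq]
    exact (h.isCrystal k).ph_f i b b' hb
  · obtain ⟨k, b, b', rfl, rfl, hb⟩ := hf i x x' hx
    rw [(h.isStrict k).wt_eq, (h.isStrict k).wt_eq]
    exact (h.isCrystal k).wt_f i b b' hb
  · obtain ⟨k, b, b', rfl, rfl, hb⟩ := hf i x x' hx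
    rw [(h.isStrict k).map_e, ((h.isCrystal k).f_iff_e i b b').1 hb, Option.map_some]
  · obtain ⟨k, b, b', rfl, rfl, hb⟩ := he i x' x hx
    exact (h.isStrict k).map_f i b' b (((h.isCrystal k).f_iff_e i b' b).2 hb)

theorem IsUnion.map_val (h : IsUnion C Ψ C' θ) ⦃j k : ℕ⦄ (hjk : j ≤ k) (o : Option (B j)) :
    (Ψ hjk o).map (θ k) = o.map (θ j) := by
  cases o with
  | none => rw [h.map_zero]; rfl
  | some b =>
    obtain ⟨b', h1, h2⟩ := h.map_some hjk b
    rw [h1, Option.map_some, Option.map_some, h2]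

/-- The map from the pointed limit to `B' ⊔ {0}`. -/
def IsUnion.pointedMap (h : IsUnion C Ψ C' θ) : PointedLimit Ψ → Option B' :=
  Quot.lift (fun x => x.2.map (θ x.1)) (by
    rintro ⟨j, o⟩ ⟨k, o'⟩ ⟨hjk, hΨ⟩
    simp only at hjk hΨ
    subst hΨ
    exact (h.map_val hjk o).symm)

theorem IsUnion.pointedMap_mk (h : IsUnion C Ψ C' θ) (j : ℕ) (o : Option (B j)) :
    h.pointedMap (PointedLimit.mk Ψ j o) = o.map (θ j) := rfl

theorem mk_eq_mk (Ψ : ∀ ⦃j k : ℕ⦄, j ≤ k → Option (B j) → Option (B k)) {j k : ℕ} (hjk : j ≤ k)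
    (o : Option (B j)) : PointedLimit.mk Ψ j o = PointedLimit.mk Ψ k (Ψ hjk o) :=
  Quot.sound ⟨hjk, rfl⟩

theorem IsUnion.pointedMap_injective (h : IsUnion C Ψ C' θ) :
    Function.Injective h.pointedMap := by
  intro x y hxy
  induction x using Quot.ind with | mk x => ?_
  induction y using Quot.ind with | mk y => ?_
  obtain ⟨j, o⟩ := x
  obtain ⟨k, o'⟩ := y
  change PointedLimit.mk Ψ j o = PointedLimit.mk Ψ k o'
  rw [mk_eq_mk Ψ (le_max_left j k), mk_eq_mk Ψ (le_max_right j k)]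
  congr 1
  refine Option.map_injective (h.injective (max j k)) ?_
  rw [h.map_val, h.map_val]
  exact hxy

theorem IsUnion.pointedMap_ne_none (h : IsUnion C Ψ C' θ) (x : Limit Ψ) :
    h.pointedMap x.1 ≠ none := fun h0 =>
  x.2 0 (h.pointedMap_injective (by rw [h0, h.pointedMap_mk]; rfl))

/-- The map from the direct limit to `B'`. -/
noncomputable def IsUnion.limitMap (h : IsUnion C Ψ C' θ) (x : Limit Ψ) : B' :=
  (Option.ne_none_iff_exists'.1 (h.pointedMap_ne_none x)).choose

theorem IsUnion.some_limitMap (h : IsUnion C Ψ C' θ) (x : Limit Ψ) :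
    some (h.limitMap x) = h.pointedMap x.1 :=
  (Option.ne_none_iff_exists'.1 (h.pointedMap_ne_none x)).choose_spec.symm

theorem IsUnion.limitMap_injective (h : IsUnion C Ψ C' θ) : Function.Injective h.limitMap :=
  fun x y hxy => Subtype.ext (h.pointedMap_injective (by
    rw [← h.some_limitMap, ← h.some_limitMap, hxy]))

/-- The map from the direct limit, extended by zero, is the given one on each `B k`. -/
theorem IsUnion.map_toLimit (h : IsUnion C Ψ C' θ) (j : ℕ) (o : Option (B j)) :
    (toLimit Ψ j o).map h.limitMap = o.map (θ j) := by
  unfold toLimit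
  split_ifs with h0
  · exact (h.some_limitMap ⟨_, h0⟩).trans (h.pointedMap_mk j o)
  · rw [Option.map_none]
    push Not at h0
    obtain ⟨k, hk⟩ := h0
    rw [← h.pointedMap_mk, hk, h.pointedMap_mk, Option.map_none]

theorem IsUnion.limitMap_of_toLimit (h : IsUnion C Ψ C' θ) {j : ℕ} {b : B j} {x : Limit Ψ}
    (hx : toLimit Ψ j (some b) = some x) : h.limitMap x = θ j b := by
  have := h.map_toLimit j (some b)
  rw [hx] at this
  exact Option.some.inj this

theorem IsUnion.toLimit_of_eq (h : IsUnion C Ψ C' θ) {j : ℕ} {b : B j} {x : Limit Ψ}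
    (hx : θ j b = h.limitMap x) : toLimit Ψ j (some b) = some x := by
  refine Option.map_injective h.limitMap_injective ?_
  rw [h.map_toLimit, Option.map_some, Option.map_some, hx]

theorem IsUnion.limitMap_surjective (h : IsUnion C Ψ C' θ) : Function.Surjective h.limitMap := by
  intro b'
  obtain ⟨k, b, rfl⟩ := h.surjective b'
  have := h.map_toLimit k (some b)
  rw [Option.map_some, Option.map_eq_some_iff] at this
  obtain ⟨x, -, hx⟩ := this
  exact ⟨x, hx⟩

theorem IsUnion.map_limit_e (h : IsUnion C Ψ C' θ) (i : I) (x : Limit Ψ) :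
    ((limit C Ψ).e i x).map h.limitMap = C'.e i (h.limitMap x) := by
  simp only [limit]
  split_ifs with hex
  · rw [h.map_toLimit, ← (h.isStrict _).map_e, h.limitMap_of_toLimit hex.choose_spec.1]
  · obtain ⟨⟨k, b⟩, hb⟩ := exists_rep Ψ x
    have h0 : (C k).e i b = none := by
      by_contra h0
      exact hex ⟨⟨k, b⟩, hb, h0⟩
    rw [h.limitMap_of_toLimit hb, (h.isStrict k).map_e, h0]
    rfl

theorem IsUnion.map_limit_f (h : IsUnion C Ψ C' θ) (i : I) (x : Limit Ψ) :
    ((limit C Ψ).f i x).map h.limitMap = C'.f i (h.limitMap x) := by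
  have hex : ∃ p : Σ j, B j, toLimit Ψ p.1 (some p.2) = some x ∧ (C p.1).f i p.2 ≠ none := by
    obtain ⟨k, b, hb, hf⟩ := h.exists_f i (h.limitMap x)
    exact ⟨⟨k, b⟩, h.toLimit_of_eq hb, hf⟩
  simp only [limit]
  rw [dif_pos hex, h.map_toLimit, h.limitMap_of_toLimit hex.choose_spec.1]
  obtain ⟨b', hb'⟩ := Option.ne_none_iff_exists'.1 hex.choose_spec.2
  rw [(h.isStrict _).map_f _ _ _ hb', hb', Option.map_some]

theorem IsUnion.isStrict_limitMap (h : IsUnion C Ψ C' θ) :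
    IsStrict (limit C Ψ) C' h.limitMap where
  wt_eq x := by
    rw [h.limitMap_of_toLimit (exists_rep Ψ x).choose_spec]
    exact (h.isStrict _).wt_eq _
  ep_eq i x := by
    rw [h.limitMap_of_toLimit (exists_rep Ψ x).choose_spec]
    exact (h.isStrict _).ep_eq i _
  ph_eq i x := by
    rw [h.limitMap_of_toLimit (exists_rep Ψ x).choose_spec]
    exact (h.isStrict _).ph_eq i _
  map_e i x := (h.map_limit_e i x).symm
  map_f i x x' hx := by rw [← h.map_limit_f, hx, Option.map_some]

theorem IsUnion.isCrystal_limit (h : IsUnion C Ψ C' θ) : (limit C Ψ).IsCrystal := by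
  have hC' := h.isCrystal_union
  have hs := h.isStrict_limitMap
  have he : ∀ i x x', (limit C Ψ).e i x = some x' ↔
      C'.e i (h.limitMap x) = some (h.limitMap x') := fun i x x' => by
    rw [← h.map_limit_e, ← Option.map_some, (Option.map_injective h.limitMap_injective).eq_iff]
  have hf : ∀ i x x', (limit C Ψ).f i x = some x' ↔
      C'.f i (h.limitMap x) = some (h.limitMap x') := fun i x x' => by
    rw [← h.map_limit_f, ← Option.map_some, (Option.map_injective h.limitMap_injective).eq_iff]
  refine ⟨?_, fun i x => ?_, fun i x x' hx => ?_, fun i x x' hx => ?_, fun i x x' hx => ?_,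
    fun i x x' hx => ?_, fun i x x' hx => ?_, fun i x x' hx => ?_, fun i x x' => ?_,
    fun i x hx => ?_⟩
  · obtain ⟨b'⟩ := hC'.nonempty
    obtain ⟨x, -⟩ := h.limitMap_surjective b'
    exact ⟨x⟩
  · rw [← hs.ph_eq, ← hs.ep_eq, ← hs.wt_eq]
    exact hC'.ph_eq i _
  · rw [← hs.ep_eq, ← hs.ep_eq]
    exact hC'.ep_e i _ _ ((he i x x').1 hx)
  · rw [← hs.ph_eq, ← hs.ph_eq]
    exact hC'.ph_e i _ _ ((he i x x').1 hx)
  · rw [← hs.wt_eq, ← hs.wt_eq]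
    exact hC'.wt_e i _ _ ((he i x x').1 hx)
  · rw [← hs.ep_eq, ← hs.ep_eq]
    exact hC'.ep_f i _ _ ((hf i x x').1 hx)
  · rw [← hs.ph_eq, ← hs.ph_eq]
    exact hC'.ph_f i _ _ ((hf i x x').1 hx)
  · rw [← hs.wt_eq, ← hs.wt_eq]
    exact hC'.wt_f i _ _ ((hf i x x').1 hx)
  · rw [he, hf]
    exact hC'.f_iff_e i _ _
  · rw [← hs.ph_eq] at hx
    exact absurd hx (h.ph_ne_bot i _)

/-- The direct limit is isomorphic to the union, by a unique compatible map. -/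
theorem IsUnion.exists_isomorphism (h : IsUnion C Ψ C' θ) :
    ∃ S : Option (Limit Ψ) → Option B', (∀ k x, S (toLimit Ψ k x) = x.map (θ k)) ∧
      (∀ S' : Option (Limit Ψ) → Option B', (∀ k x, S' (toLimit Ψ k x) = x.map (θ k)) → S' = S) ∧
      IsIsomorphism (limit C Ψ) C' S := by
  refine ⟨Option.map h.limitMap, h.map_toLimit, fun S' hS' => ?_, h.isStrict_limitMap.isMorphism,
    Option.map_injective h.limitMap_injective, ?_⟩
  rotate_left
  · rintro (_ | b')
    · exact ⟨none, rfl⟩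
    · obtain ⟨x, hx⟩ := h.limitMap_surjective b'
      exact ⟨some x, congrArg some hx⟩
  funext o
  cases o with
  | none =>
    have h0 : toLimit Ψ 0 none = none := dif_neg fun h0 => h0 0 rfl
    rw [← h0, hS', h.map_toLimit]
  | some x =>
    obtain ⟨⟨k, b⟩, hb⟩ := exists_rep Ψ x
    rw [← hb, hS', h.map_toLimit]

end Limit

end CrystalData

/-! ### The alcove models of the multiples of `ρ` inside the infinite model -/

namespace RootChain

variable {I : Type u} [LinearOrder I] {A : Matrix I I ℤ} {P : Type v}
  [AddCommGroup P] {D : CartanDatum A P} {x : P}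

theorem isBefore_smul {d : ℤ} (hd : 0 < d) {q : D.PosRoot × ℤ} {y : Module.Dual ℤ P} {l : ℤ} :
    IsBefore (d • x) q y l ↔ IsBefore x q y l := by
  have h1 : sideFst (d • x) q y l = d * sideFst x q y l := by
    simp only [sideFst, map_smul, smul_eq_mul]; ring
  have h2 : ∀ i, sideSnd (d • x) q y i = d * sideSnd x q y i := fun i => by
    simp only [sideSnd, map_smul, smul_eq_mul]; ring
  have h3 : ∀ z : ℤ, d * z < 0 ↔ z < 0 := fun z => by
    rw [mul_neg_iff]
    simp [hd, not_lt.2 hd.le]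
  simp only [IsBefore, h1, h2, h3, mul_eq_zero, hd.ne', false_or]

theorem isBefore_shift (d : ℤ) {q : D.PosRoot × ℤ} {y : Module.Dual ℤ P} {l : ℤ} :
    IsBefore x (q.1, q.2 + q.1.coroot (d • x)) y (l + y (d • x)) ↔ IsBefore x q y l := by
  have h1 : sideFst x (q.1, q.2 + q.1.coroot (d • x)) y (l + y (d • x)) = sideFst x q y l := by
    simp only [sideFst, map_smul, smul_eq_mul]; ring
  have h2 : ∀ i, sideSnd x (q.1, q.2 + q.1.coroot (d • x)) y i = sideSnd x q y i := fun i => rfl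
  simp only [IsBefore, h1, h2]

end RootChain

namespace AlcoveModel

open RootChain

variable {I : Type u} [Fintype I] [LinearOrder I] {A : Matrix I I ℤ} {P : Type v}
  [AddCommGroup P] (D : CartanDatum A P)

theorem coroot_smul_rho (b : D.PosRoot) (d : ℤ) : b.coroot (d • D.rho) = d * b.coroot D.rho := by
  rw [map_smul, smul_eq_mul]

theorem isDominant_smul_rho (k : ℕ) : IsDominant D ((k : ℤ) • D.rho) := fun b => by
  rw [coroot_smul_rho]
  exact mul_nonneg (Int.natCast_nonneg k) b.coroot_rho_pos.le

theorem position_chain_injective (k : ℕ) : Function.Injective (chain D k).position :=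
  fun _ _ h => Subtype.ext h

theorem level_chain (k : ℕ) (p : (chain D k).Idx) :
    0 ≤ (chain D k).level p ∧ (chain D k).level p < k * ((chain D k).root p).coroot D.rho := by
  rw [← coroot_smul_rho]
  exact p.2

theorem exists_position_chain (k : ℕ) (b : D.PosRoot) (l : ℤ) (h0 : 0 ≤ l)
    (h1 : l < k * b.coroot D.rho) : ∃ p, (chain D k).position p = (b, l) := by
  rw [← coroot_smul_rho] at h1
  exact ⟨⟨(b, l), h0, h1⟩, rfl⟩

theorem chain_lt_iff (k : ℕ) (p q : (chain D k).Idx) :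
    p < q ↔ IsBefore D.rho ((chain D k).position q) ((chain D k).root p).coroot
      ((chain D k).level p) := by
  have hk : (0 : ℤ) < k := by
    have h1 := coroot_pos_of_idx p
    rw [coroot_smul_rho] at h1
    exact (pos_iff_pos_of_mul_pos h1).2 p.1.1.coroot_rho_pos
  rw [lex_lt_iff, isBefore_smul hk]

theorem level_chainInf (p : (chainInf D).Idx) : (chainInf D).level p < 0 := by
  obtain ⟨⟨n, hn⟩, r⟩ := p
  obtain ⟨h0, h1⟩ := r.2
  change r.1.2 + n * r.1.1.coroot D.rho < 0
  have hn : n < 0 := hn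
  nlinarith

theorem position_chainInf_injective : Function.Injective (chainInf D).position := by
  rintro ⟨⟨n, hn⟩, ⟨⟨b, h⟩, h0, h1⟩⟩ ⟨⟨n', hn'⟩, ⟨⟨b', h'⟩, h0', h1'⟩⟩ heq
  obtain ⟨hb, hl⟩ := Prod.ext_iff.1 heq
  change b = b' at hb
  change h + n * b.coroot D.rho = h' + n' * b'.coroot D.rho at hl
  subst hb
  simp only at h0 h1 h0' h1'
  have hnn : n = n' := by
    rcases lt_trichotomy n n' with h2 | h2 | h2
    · nlinarith
    · exact h2
    · nlinarith
  subst hnn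
  obtain rfl : h = h' := by linarith
  rfl

theorem exists_position_chainInf (b : D.PosRoot) (l : ℤ) (h : l < 0) :
    ∃ p, (chainInf D).position p = (b, l) := by
  have hb := b.coroot_rho_pos
  refine ⟨toLex (⟨l / b.coroot D.rho, Int.ediv_neg_of_neg_of_pos h hb⟩,
    ⟨(b, l % b.coroot D.rho), Int.emod_nonneg _ hb.ne', Int.emod_lt_of_pos _ hb⟩), ?_⟩
  refine Prod.ext rfl ?_
  change l % b.coroot D.rho + l / b.coroot D.rho * b.coroot D.rho = l
  rw [mul_comm, Int.emod_add_mul_ediv]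

theorem chainInf_lt_iff (p q : (chainInf D).Idx) :
    p < q ↔ IsBefore D.rho ((chainInf D).position q) ((chainInf D).root p).coroot
      ((chainInf D).level p) := by
  obtain ⟨n, r⟩ := p
  obtain ⟨n', r'⟩ := q
  refine Iff.trans (Prod.Lex.toLex_lt_toLex (x := (n, r)) (y := (n', r'))) ?_
  simp only
  have hF : sideFst D.rho ((lex D D.rho).infinite D.rho |>.position (toLex (n', r')))
      r.1.1.coroot (r.1.2 + n.1 * r.1.1.coroot D.rho) =
      r'.1.1.coroot D.rho * r.1.2 - r.1.1.coroot D.rho * r'.1.2 +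
        r.1.1.coroot D.rho * r'.1.1.coroot D.rho * (n.1 - n'.1) := by
    change r'.1.1.coroot D.rho * (r.1.2 + n.1 * r.1.1.coroot D.rho) -
      r.1.1.coroot D.rho * (r'.1.2 + n'.1 * r'.1.1.coroot D.rho) = _
    ring
  obtain ⟨h0, h1⟩ := r.2
  obtain ⟨h0', h1'⟩ := r'.2
  have hm := r.1.1.coroot_rho_pos
  have hm' := r'.1.1.coroot_rho_pos
  rcases lt_trichotomy n n' with hn | rfl | hn
  · refine iff_of_true (Or.inl hn) (Or.inl ?_)
    refine hF.trans_lt ?_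
    have hn' : n.1 + 1 ≤ n'.1 := hn
    nlinarith [mul_pos hm hm', mul_nonneg hm.le h0']
  · simp only [lt_irrefl, true_and, false_or]
    rw [lex_lt_iff, ← isBefore_shift n.1, coroot_smul_rho, map_smul, smul_eq_mul]
    rfl
  · refine iff_of_false (by simp [hn.not_gt, hn.ne']) ?_
    have hn' : n'.1 + 1 ≤ n.1 := hn
    have hpos : 0 < sideFst D.rho ((lex D D.rho).infinite D.rho |>.position (toLex (n', r')))
        r.1.1.coroot (r.1.2 + n.1 * r.1.1.coroot D.rho) := by
      rw [hF]
      nlinarith [mul_pos hm hm', mul_nonneg hm'.le h0]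
    rintro (h | ⟨h, -⟩)
    · exact lt_asymm hpos h
    · exact hpos.ne' h

variable {D}

/-- A chain with the order of the lex chains that contains all positions of `Γ_{kρ}`, shifted by
`d ρ`, and no positions with larger levels, has the shifted `Γ_{kρ}` as a right end. -/
theorem exists_endEmbedding {Γ : RootChain D} (k : ℕ) (d : ℤ)
    (hlt : ∀ p q, p < q ↔ IsBefore D.rho (Γ.position q) (Γ.root p).coroot (Γ.level p))
    (hinj : Function.Injective Γ.position)
    (hmem : ∀ (b : D.PosRoot) (l : ℤ), d * b.coroot D.rho ≤ l → l < (k + d) * b.coroot D.rho →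
      ∃ p, Γ.position p = (b, l))
    (hbound : ∀ p, Γ.level p < (k + d) * (Γ.root p).coroot D.rho) :
    Nonempty (EndEmbedding (chain D k) Γ (d • D.rho)) := by
  have hex : ∀ p : (chain D k).Idx, ∃ p', Γ.position p' = ((chain D k).root p,
      (chain D k).level p + ((chain D k).root p).coroot (d • D.rho)) := by
    intro p
    obtain ⟨h0, h1⟩ := level_chain D k p
    refine hmem _ _ ?_ ?_ <;> rw [coroot_smul_rho]
    · linarith
    · linarith
  choose φ hφ using hex
  have hroot : ∀ p, Γ.root (φ p) = (chain D k).root p := fun p => congrArg Prod.fst (hφ p)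
  have hlevel : ∀ p, Γ.level (φ p) =
      (chain D k).level p + ((chain D k).root p).coroot (d • D.rho) :=
    fun p => congrArg Prod.snd (hφ p)
  have hmono : StrictMono φ := by
    intro p q hpq
    rw [chain_lt_iff] at hpq
    rw [hlt, hφ, hroot, hlevel]
    exact (isBefore_shift d (q := (chain D k).position q)).2 hpq
  refine ⟨⟨OrderEmbedding.ofStrictMono φ hmono, hroot, hlevel, fun p q hpq => ?_⟩⟩
  change φ p ≤ q at hpq
  have hle : d * (Γ.root q).coroot D.rho ≤ Γ.level q := by
    by_contra hl
    refine not_lt.2 hpq ((hlt _ _).2 (Or.inl ?_))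
    rw [hφ, sideFst, coroot_smul_rho]
    have h1 := (level_chain D k p).1
    have h2 := ((chain D k).root p).coroot_rho_pos
    have h3 := (Γ.root q).coroot_rho_pos
    simp only
    nlinarith [mul_nonneg h3.le h1, mul_pos h2 (sub_pos.2 (not_le.1 hl))]
  obtain ⟨p', hp'⟩ := exists_position_chain D k (Γ.root q) (Γ.level q - d * (Γ.root q).coroot D.rho)
    (by linarith) (by linarith [hbound q])
  obtain ⟨hr, hl⟩ := Prod.ext_iff.1 hp'
  change (chain D k).root p' = _ at hr
  change (chain D k).level p' = _ at hl
  refine ⟨p', hinj ?_⟩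
  change Γ.position (φ p') = _
  rw [hφ, hr, hl, coroot_smul_rho, sub_add_cancel]
  rfl

variable (D)

/-- The chain `Γ_{kρ}` as a right end of `Γ_{k'ρ}`. -/
noncomputable def chainEmbedding {k k' : ℕ} (h : k ≤ k') :
    EndEmbedding (chain D k) (chain D k') (((k' : ℤ) - k) • D.rho) :=
  (exists_endEmbedding k ((k' : ℤ) - k) (chain_lt_iff D k') (position_chain_injective D k')
    (fun b l h0 h1 => exists_position_chain D k' b l
      ((mul_nonneg (by omega) b.coroot_rho_pos.le).trans h0) (by
        rwa [add_sub_cancel] at h1))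
    (fun p => by rw [add_sub_cancel]; exact (level_chain D k' p).2)).some

/-- The chain `Γ_{kρ}` as a right end of the infinite chain. -/
noncomputable def chainInfEmbedding (k : ℕ) :
    EndEmbedding (chain D k) (chainInf D) (-((k : ℤ) • D.rho)) :=
  (show Nonempty _ by
    rw [← neg_smul]
    exact exists_endEmbedding k (-(k : ℤ)) (chainInf_lt_iff D) (position_chainInf_injective D)
      (fun b l _ h1 => exists_position_chainInf D b l (by simpa using h1))
      (fun p => by simpa using level_chainInf D p)).some

/-- The shift map on nonzero elements. -/
noncomputable def twistedMap {k k' : ℕ} (h : k ≤ k') (b : TwistedAl D k) : TwistedAl D k' :=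
  ((), (chainEmbedding D h).mapAl b.2)

/-- The shift-in map on nonzero elements. -/
noncomputable def toInf (k : ℕ) (b : TwistedAl D k) : (chainInf D).Al :=
  (chainInfEmbedding D k).mapAl b.2

theorem shiftMap_eq {k k' : ℕ} (h : k ≤ k') : shiftMap D h = Option.map (twistedMap D h) := by
  funext o
  cases o with
  | none => rfl
  | some b =>
    change (((chain D k).shift (chain D k') _ b.2).map _) = some _
    rw [(chainEmbedding D h).shift_eq (position_chain_injective D k')]
    rfl

theorem shiftIn_eq (k : ℕ) : shiftIn D k = Option.map (toInf D k) := by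
  funext o
  cases o with
  | none => rfl
  | some b => exact (chainInfEmbedding D k).shift_eq (position_chainInf_injective D) b.2

theorem toInf_injective (k : ℕ) : Function.Injective (toInf D k) := fun _ _ h =>
  Prod.ext rfl ((chainInfEmbedding D k).mapAl_injective h)

theorem toInf_twistedMap {k k' : ℕ} (h : k ≤ k') (b : TwistedAl D k) :
    toInf D k' (twistedMap D h b) = toInf D k b := by
  refine Subtype.ext (Finset.coe_injective ((position_chainInf_injective D).image_injective ?_))
  refine ((chainInfEmbedding D k').position_image_map _).trans
    (Eq.trans ?_ ((chainInfEmbedding D k).position_image_map _).symm)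
  rw [show (twistedMap D h b).2.1 = (chainEmbedding D h).map b.2.1 from rfl,
    (chainEmbedding D h).position_image_map, Set.image_image]
  refine Set.image_congr fun p _ => Prod.ext rfl ?_
  simp only [map_neg, coroot_smul_rho]
  ring

theorem isCrystal_chain (k : ℕ) : ((chain D k).crystal ((k : ℤ) • D.rho)).IsCrystal :=
  isCrystal_lex (isDominant_smul_rho D k)

theorem isCrystal_twistedCrystal (k : ℕ) : (twistedCrystal D k).IsCrystal :=
  (isCrystal_chain D k).T_tensor (fun _ _ => WithBot.coe_ne_bot) _

theorem twistedCrystal_wt (k : ℕ) (b : TwistedAl D k) : (twistedCrystal D k).wt b =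
    (chain D k).weight ((k : ℤ) • D.rho) b.2.1 - (k : ℤ) • D.rho := by
  rw [CrystalData.T_tensor_wt, neg_add_eq_sub]
  rfl

theorem isStrict_twistedMap {k k' : ℕ} (h : k ≤ k') :
    CrystalData.IsStrict (twistedCrystal D k) (twistedCrystal D k') (twistedMap D h) := by
  have hwt : ∀ b, (twistedCrystal D k').wt (twistedMap D h b) = (twistedCrystal D k).wt b := by
    intro b
    rw [twistedCrystal_wt, twistedCrystal_wt]
    have h1 := (chainEmbedding D h).weight_map ((k : ℤ) • D.rho) b.2.1
    rw [show (k : ℤ) • D.rho + ((k' : ℤ) - k) • D.rho = (k' : ℤ) • D.rho by module] at h1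
    change (chain D k').weight _ ((chainEmbedding D h).map b.2.1) - _ = _
    rw [h1]
    module
  have hep : ∀ i b, (twistedCrystal D k').ep i (twistedMap D h b) =
      (twistedCrystal D k).ep i b := by
    intro i b
    rw [CrystalData.T_tensor_ep, CrystalData.T_tensor_ep]
    exact congrArg (fun n : ℕ => ((n : ℤ) : WithBot ℤ))
      ((chainEmbedding D h).stringLength_eOp_map i b.2)
  refine ⟨hwt, hep, fun i b => ?_, fun i b => ?_, fun i b b' hb => ?_⟩
  · rw [(isCrystal_twistedCrystal D k').ph_eq, (isCrystal_twistedCrystal D k).ph_eq, hwt, hep]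
  · rw [CrystalData.T_tensor_e, CrystalData.T_tensor_e, Option.map_map]
    change Option.map _ ((chain D k').eOp i ((chainEmbedding D h).mapAl b.2)) = _
    rw [(chainEmbedding D h).eOp_map, Option.map_map]
    rfl
  · rw [CrystalData.T_tensor_f _ _ _ WithBot.coe_ne_bot] at hb ⊢
    obtain ⟨J, hJ, rfl⟩ := Option.map_eq_some_iff.1 hb
    change Option.map _ ((chain D k').fOp i ((chainEmbedding D h).mapAl b.2)) = _
    rw [(chainEmbedding D h).fOp_map hJ]
    rfl

theorem isStrict_toInf (k : ℕ) :
    CrystalData.IsStrict (twistedCrystal D k) (crystalInf D) (toInf D k) := by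
  have hwt : ∀ b, (crystalInf D).wt (toInf D k b) = (twistedCrystal D k).wt b := by
    intro b
    rw [twistedCrystal_wt]
    have h1 := (chainInfEmbedding D k).weight_map ((k : ℤ) • D.rho) b.2.1
    rw [add_neg_cancel, ← sub_eq_add_neg] at h1
    exact h1
  have hsl : ∀ i (b : TwistedAl D k),
      CrystalData.stringLength ((chainInf D).eOp i) (toInf D k b) =
      CrystalData.stringLength ((chain D k).eOp i) b.2 :=
    fun i b => (chainInfEmbedding D k).stringLength_eOp_map i b.2
  have hep : ∀ i b, (crystalInf D).ep i (toInf D k b) = (twistedCrystal D k).ep i b := by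
    intro i b
    rw [CrystalData.T_tensor_ep]
    exact congrArg (fun n : ℕ => ((n : ℤ) : WithBot ℤ)) (hsl i b)
  refine ⟨hwt, hep, fun i b => ?_, fun i b => ?_, fun i b b' hb => ?_⟩
  · rw [(isCrystal_twistedCrystal D k).ph_eq, ← hwt, ← hep]
    exact WithBot.coe_add _ _
  · rw [CrystalData.T_tensor_e, Option.map_map]
    exact (chainInfEmbedding D k).eOp_map i b.2
  · rw [CrystalData.T_tensor_f _ _ _ WithBot.coe_ne_bot] at hb
    obtain ⟨J, hJ, rfl⟩ := Option.map_eq_some_iff.1 hb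
    exact (chainInfEmbedding D k).fOp_map hJ

/-- A finite set of positions of the infinite chain lies in the image of `Γ_{kρ}` for large `k`. -/
theorem exists_toInf_eq (J : (chainInf D).Al) : ∃ k b, toInf D k b = J := by
  classical
  obtain ⟨k, hk⟩ : ∃ k : ℕ, ∀ j ∈ J.1, -(chainInf D).level j ≤ k := by
    obtain ⟨M, hM⟩ := (J.1.image fun j => -(chainInf D).level j).bddAbove
    refine ⟨M.toNat, fun j hj => ?_⟩
    have := hM (Finset.mem_coe.2 (Finset.mem_image_of_mem _ hj))
    omega
  set E := chainInfEmbedding D k with hE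
  have hrange : ∀ j ∈ J.1, ∃ p, E.toFun p = j := by
    intro j hj
    have h1 := hk j hj
    have h2 := ((chainInf D).root j).coroot_rho_pos
    have h3 := level_chainInf D j
    obtain ⟨p, hp⟩ := exists_position_chain D k ((chainInf D).root j)
      ((chainInf D).level j + k * ((chainInf D).root j).coroot D.rho)
      (by nlinarith) (by linarith)
    obtain ⟨hr, hl⟩ := Prod.ext_iff.1 hp
    change (chain D k).root p = _ at hr
    change (chain D k).level p = _ at hl
    refine ⟨p, position_chainInf_injective D (Prod.ext ?_ ?_)⟩
    · exact (E.root_eq p).trans hr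
    · refine (E.level_eq p).trans ?_
      rw [hl, hr, map_neg, coroot_smul_rho]
      exact add_neg_cancel_right _ _
  have hmap : E.map (J.1.preimage E.toFun E.toFun.injective.injOn) = J.1 := by
    ext j
    simp only [E.mem_map, Finset.mem_preimage]
    constructor
    · rintro ⟨p, hp, rfl⟩
      exact hp
    · intro hj
      obtain ⟨p, rfl⟩ := hrange j hj
      exact ⟨p, hj, rfl⟩
  have hadm : (chain D k).Admissible (J.1.preimage E.toFun E.toFun.injective.injOn) := by
    rw [← E.admissible_map_iff, hmap]
    exact J.2
  exact ⟨k, ((), ⟨_, hadm⟩), Subtype.ext hmap⟩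

theorem twistedCrystal_f_ne_none {k : ℕ} {i : I} {b : TwistedAl D k}
    (h : 0 < D.simpleCoroot i ((twistedCrystal D k).wt b) + k) :
    (twistedCrystal D k).f i b ≠ none := by
  rw [CrystalData.T_tensor_f _ _ _ WithBot.coe_ne_bot, Ne, Option.map_eq_none_iff]
  intro h0
  have h1 := (fOp_eq_none_iff_maxHeight isFinitary_lex).1 h0
  have h2 : _ = _ - D.simpleCoroot i ((chain D k).weight ((k : ℤ) • D.rho) b.2.1) :=
    stringLength_eOp (isDominant_smul_rho D k) i b.2
  rw [twistedCrystal_wt, map_sub, map_smul, CartanDatum.simpleCoroot_rho, smul_eq_mul, mul_one]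
    at h
  omega

/-- The operators `f_i` do not vanish on `Al(∞)`: in `Al(kρ)`, the value of `φ_i` grows with `k`. -/
theorem exists_f_ne_none (i : I) (J : (chainInf D).Al) :
    ∃ k b, toInf D k b = J ∧ (twistedCrystal D k).f i b ≠ none := by
  obtain ⟨k, b, rfl⟩ := exists_toInf_eq D J
  set w := D.simpleCoroot i ((twistedCrystal D k).wt b) with hw
  have hk : k ≤ max k ((-w).toNat + 1) := le_max_left _ _
  refine ⟨max k ((-w).toNat + 1), twistedMap D hk b, toInf_twistedMap D hk b,
    twistedCrystal_f_ne_none D ?_⟩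
  rw [(isStrict_twistedMap D hk).wt_eq, ← hw]
  have := le_max_right k ((-w).toNat + 1)
  omega

theorem isUnion_crystalInf :
    CrystalData.IsUnion (twistedCrystal D) (shiftMap D) (crystalInf D) (toInf D) where
  map_zero _ _ _ := rfl
  map_some j k h b := ⟨twistedMap D h b, by rw [shiftMap_eq]; rfl, toInf_twistedMap D h b⟩
  injective := toInf_injective D
  surjective := exists_toInf_eq D
  isStrict := isStrict_toInf D
  isCrystal := isCrystal_twistedCrystal D
  ph_ne_bot _ _ := WithBot.coe_ne_bot
  exists_f := exists_f_ne_none D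

theorem twistedMap_injective {k k' : ℕ} (h : k ≤ k') : Function.Injective (twistedMap D h) :=
  fun b b' hb => toInf_injective D k (by rw [← toInf_twistedMap D h, hb, toInf_twistedMap])

theorem isDirectedSystem :
    CrystalData.IsDirectedSystem (twistedCrystal D) (shiftMap D) where
  isCrystal := isCrystal_twistedCrystal D
  isMorphism j k h := by
    rw [shiftMap_eq]
    exact (isStrict_twistedMap D h).isMorphism
  map_id j x := by
    rw [shiftMap_eq]
    cases x with
    | none => rfl
    | some b => exact congrArg some (toInf_injective D j (toInf_twistedMap D _ b))
  map_comp i j k h h' x := by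
    rw [shiftMap_eq, shiftMap_eq, shiftMap_eq]
    cases x with
    | none => rfl
    | some b =>
      refine congrArg some (toInf_injective D k ?_)
      rw [toInf_twistedMap, toInf_twistedMap, toInf_twistedMap]

end AlcoveModel

theorem mainTheorem5 {I : Type u} [Fintype I] [LinearOrder I] {A : Matrix I I ℤ} {P : Type v}
    [AddCommGroup P] [Module.Free ℤ P] [Module.Finite ℤ P] (D : CartanDatum A P) :
    CrystalData.IsDirectedSystem (AlcoveModel.twistedCrystal D) (AlcoveModel.shiftMap D) ∧
    (∀ ⦃k k' : ℕ⦄ (h : k ≤ k'), CrystalData.IsEmbedding (AlcoveModel.twistedCrystal D k)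
      (AlcoveModel.twistedCrystal D k') (AlcoveModel.shiftMap D h)) ∧
    (CrystalData.limit (AlcoveModel.twistedCrystal D) (AlcoveModel.shiftMap D)).IsCrystal ∧
    (AlcoveModel.crystalInf D).IsCrystal ∧
    ∃ S : Option (CrystalData.Limit (AlcoveModel.shiftMap D)) →
        Option (AlcoveModel.chainInf D).Al,
      (∀ k x, S (CrystalData.toLimit (AlcoveModel.shiftMap D) k x) =
        AlcoveModel.shiftIn D k x) ∧
      (∀ S' : Option (CrystalData.Limit (AlcoveModel.shiftMap D)) →
          Option (AlcoveModel.chainInf D).Al,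
        (∀ k x, S' (CrystalData.toLimit (AlcoveModel.shiftMap D) k x) =
          AlcoveModel.shiftIn D k x) → S' = S) ∧
      CrystalData.IsIsomorphism
        (CrystalData.limit (AlcoveModel.twistedCrystal D) (AlcoveModel.shiftMap D))
        (AlcoveModel.crystalInf D) S := by
  have hU := AlcoveModel.isUnion_crystalInf D
  refine ⟨AlcoveModel.isDirectedSystem D, fun k k' h => ?_, hU.isCrystal_limit,
    hU.isCrystal_union, ?_⟩
  · refine ⟨(AlcoveModel.isDirectedSystem D).isMorphism h, ?_⟩
    rw [AlcoveModel.shiftMap_eq]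
    exact Option.map_injective (AlcoveModel.twistedMap_injective D h)
  · simp only [AlcoveModel.shiftIn_eq]
    exact hU.exists_isomorphism
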